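/- Let $\mathbb{T}=\mathbb{R}/2\pi\mathbb{Z}$ with Lebesgue measure $d\theta$, let $\mathcal{D}'$ be the space of distributions on $\mathbb{T}$ (functions being identified with distributions via $\langle g,\phi\rangle=\int_{\mathbb{T}}g\,\phi\,d\theta$), and put $\widehat f(0)=(2\pi)^{-1}\langle f,1\rangle$ for $f\in\mathcal{D}'$. Let $\Psi_0(t)=t/\log(e+t)$ for $t\ge 0$, with $\Psi_0(\infty)=\infty$, and for measurable $G:\mathbb{T}\to[0,\infty]$ put $$\|G\|_{L^{\log}(\mathbb{T})}=\inf\Big\{\lambda>0:\ (2\pi)^{-1}\int_{\mathbb{T}}\Psi_0(\lambda^{-1}G(\theta))\,d\theta\le 1\Big\}.$$ For $\delta\in[0,1)$ let $$\mathcal{I}=\mathcal{I}^\delta=\big\{[2\pi(2^{-k}m+\delta),\,2\pi(2^{-k}(m+1)+\delta)):\ k\ge 0,\ 0\le m\le 2^k-1\big\}$$ be the associated system of dyadic arcs in $\mathbb{T}$; $|I|=2\pi 2^{-k}$ is the length of such an arc, $k$ its generation, and $h_I=|I|^{-1/2}(\chi_{I_-}-\chi_{I_+})$ its Haar function, where $I_-$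 and $I_+$ are the left and right halves of $I$. *Dyadic space.* For a collection of complex numbers $\mathbf f=\{f_I\}_{I\in\mathcal{I}}\cup\{f_0\}$ let $$S_{\mathcal I}[\mathbf f]=|f_0|+\Big(\sum_{I\in\mathcal I}|f_I|^2\frac{\chi_I}{|I|}\Big)^{1/2},$$ let $f_N$ be the sum of $f_0$ and of the $f_Ih_I$ over all $I\in\mathcal{I}$ of generation at most $N$, and let $h^{\log}_{\mathcal I}(\mathbb{T})$ be the set of all $\mathbf f$ with $\int_{\mathbb{T}}\Psi_0(S_{\mathcal I}[\mathbf f])\,d\theta<\infty$, with $\|\mathbf f\|_{h^{\log}_{\mathcal I}}=\|S_{\mathcal I}[\mathbf f]\|_{L^{\log}(\mathbb{T})}$. Write $\iota(\mathbf f)=\lim_{N\to\infty}f_N$ (limit in $\mathcal{D}'$), $H^{\log}_{\mathcal I}(\mathbb{T})=\iota[h^{\log}_{\mathcal I}(\mathbb{T})]$ and $\|\iota(\mathbf f)\|_{H^{\log}_{\mathcal I}}=\|\mathbf f\|_{h^{\log}_{\mathcal I}}$. *Atomic space.* An $H^{\log}_{\mathcal I}$-atom associated to $I\in\mathcal I$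 is a measurable function $a_I$ on $\mathbb{T}$ that vanishes outside $I$, with $\int_I a_I\,d\theta=0$ and $\|a_I\|_{L^\infty}\le\|\chi_I\|_{L^{\log}(\mathbb{T})}$. The space $H^{\log}_{\mathrm{at},\mathcal I}(\mathbb{T})$ consists of all $f\in\mathcal{D}'$ for which there are arcs $I_k\in\mathcal I$ and scalar multiples $\beta_{I_k}$ of atoms associated to $I_k$ ($k\in\mathbb{N}$) with $$f-\widehat f(0)=\sum_{k}\beta_{I_k}\ \text{ in }\mathcal{D}',\qquad \sum_k|I_k|\,\Psi_0(\|\beta_{I_k}\|_{L^\infty})<\infty,$$ and $\|f\|_{H^{\log}_{\mathrm{at},\mathcal I}}$ is the infimum, over all such decompositions of $f$, of $$\inf\Big\{\lambda>0:\ \Psi_0(\lambda^{-1}|\widehat f(0)|)+\sum_k|I_k|\,\Psi_0(\lambda^{-1}\|\beta_{I_k}\|_{L^\infty})\le 1\Big\}.$$ **Theorem.** There is an absolute constant $C>0$ such that for every $\delta\in[0,1)$ and $\mathcal I=\mathcal I^\delta$: the map $\iota$ is well defined and injective on $h^{\log}_{\mathcal I}(\mathbb{T})$ (so that $H^{\log}_{\mathcal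 I}(\mathbb{T})$ and its quasi-norm make sense), $H^{\log}_{\mathrm{at},\mathcal I}(\mathbb{T})=H^{\log}_{\mathcal I}(\mathbb{T})$, and $$\|f\|_{H^{\log}_{\mathrm{at},\mathcal I}}\le C\,\|f\|_{H^{\log}_{\mathcal I}},\qquad \|f\|_{H^{\log}_{\mathcal I}}\le C\,\|f\|_{H^{\log}_{\mathrm{at},\mathcal I}}\qquad\text{for all } f\in H^{\log}_{\mathcal I}(\mathbb{T}).$$ -/

import Mathlib

open Set Filter Topology MeasureTheory
open scoped ENNReal ContDiff

namespace DyadicHlog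

noncomputable section

/-! ### The torus, test functions and distributions -/

instance factTwoPiPos : Fact (0 < 2 * Real.pi) := ⟨Real.two_pi_pos⟩

/-- The torus `ℝ / 2πℤ`; its `volume` is Lebesgue measure `dθ`, of total mass `2π`. -/
abbrev Torus : Type := AddCircle (2 * Real.pi)

/-- `C^∞(𝕋)`: functions on the torus whose `2π`-periodic lift to `ℝ` is smooth. -/
def testFunctions : Submodule ℂ (Torus → ℂ) where
  carrier := {φ | ContDiff ℝ ∞ fun x : ℝ => φ (x : Torus)}
  add_mem' := fun {f g} (hf : ContDiff ℝ ∞ fun x : ℝ => f (x : Torus))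
    (hg : ContDiff ℝ ∞ fun x : ℝ => g (x : Torus)) => hf.add hg
  zero_mem' := show ContDiff ℝ ∞ fun _ : ℝ => (0 : ℂ) from contDiff_const
  smul_mem' := fun c f (hf : ContDiff ℝ ∞ fun x : ℝ => f (x : Torus)) => hf.const_smul c

/-- `𝒟'`: linear functionals on `C^∞(𝕋)` that are continuous for the topology of uniform
convergence of all derivatives, i.e. bounded by a multiple of `max_{j ≤ n} ‖φ^{(j)}‖_∞` for
some `n` (here `B` ranges over the upper bounds of that maximum). -/
def distributions : Submodule ℂ (testFunctions →ₗ[ℂ] ℂ) where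
  carrier := {u | ∃ (C : ℝ) (n : ℕ), ∀ (φ : testFunctions) (B : ℝ),
    (∀ j ≤ n, ∀ x : ℝ, ‖iteratedDeriv j (fun y : ℝ => φ.1 (y : Torus)) x‖ ≤ B) →
      ‖u φ‖ ≤ C * B}
  add_mem' := by
    rintro u v ⟨C, n, hu⟩ ⟨D, m, hv⟩
    refine ⟨C + D, max n m, fun φ B h => ?_⟩
    have h1 := hu φ B fun j hj => h j (hj.trans (le_max_left _ _))
    have h2 := hv φ B fun j hj => h j (hj.trans (le_max_right _ _))
    have h3 := norm_add_le (u φ) (v φ)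
    rw [LinearMap.add_apply, add_mul]
    linarith
  zero_mem' := ⟨0, 0, fun φ B _ => by simp⟩
  smul_mem' := by
    rintro c u ⟨C, n, hu⟩
    refine ⟨‖c‖ * C, n, fun φ B h => ?_⟩
    rw [LinearMap.smul_apply, norm_smul, mul_assoc]
    exact mul_le_mul_of_nonneg_left (hu φ B h) (norm_nonneg c)

/-- The pairing `⟨g, φ⟩ = ∫ g φ dθ` by which an integrable function `g` is a distribution. -/
def pairing (g : Torus → ℂ) (φ : testFunctions) : ℂ := ∫ θ, g θ * φ.1 θ

/-- The constant function `1` as a test function. -/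
def oneTest : testFunctions := ⟨fun _ => 1, show ContDiff ℝ ∞ fun _ : ℝ => (1 : ℂ) from contDiff_const⟩

/-- The mean `f̂(0) = (2π)⁻¹ ⟨f, 1⟩` of a distribution. -/
def zeroCoeff (f : distributions) : ℂ := ((2 * Real.pi : ℝ) : ℂ)⁻¹ * f.1 oneTest

/-! ### The growth function and the Luxemburg gauge -/

/-- `Ψ₀(t) = t / log (e + t)` for `t ≥ 0`. -/
def Psi0 (t : ℝ) : ℝ := t / Real.log (Real.exp 1 + t)

/-- The continuous extension of `Ψ₀` to `[0, ∞]`, with `Ψ₀(∞) = ∞`. -/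
def Psi (t : ℝ≥0∞) : ℝ≥0∞ := if t = ⊤ then ⊤ else ENNReal.ofReal (Psi0 t.toReal)

/-- `inf {λ > 0 : (2π)⁻¹ ∫ Ψ₀(λ⁻¹ G(θ)) dθ ≤ 1}` for `G : 𝕋 → [0, ∞]`. -/
def luxemburg (G : Torus → ℝ≥0∞) : ℝ :=
  sInf {l : ℝ | 0 < l ∧
    ENNReal.ofReal (2 * Real.pi)⁻¹ * ∫⁻ θ, Psi (ENNReal.ofReal l⁻¹ * G θ) ≤ 1}

/-! ### Dyadic arcs and Haar functions -/

/-- Index set of a dyadic system: `⟨k, m⟩` is the `m`-th arc of generation `k`. -/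
abbrev ArcIndex : Type := Σ k : ℕ, Fin (2 ^ k)

/-- The arc `[2π(2^{-k} m + δ), 2π(2^{-k}(m+1) + δ))` in the torus. -/
def arc (δ : ℝ) (k m : ℕ) : Set Torus :=
  (fun x : ℝ => (x : Torus)) ''
    Ico (2 * Real.pi * ((m : ℝ) / 2 ^ k + δ)) (2 * Real.pi * (((m : ℝ) + 1) / 2 ^ k + δ))

/-- The arc of the dyadic system `𝓘^δ` with index `I`. -/
def dyadicArc (δ : ℝ) (I : ArcIndex) : Set Torus := arc δ I.1 (I.2 : ℕ)

/-- The length `|I| = 2π 2^{-k}` of an arc of generation `k`. -/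
def arcLength (I : ArcIndex) : ℝ := 2 * Real.pi / 2 ^ I.1

/-- The Haar function `h_I = |I|^{-1/2} (χ_{I_-} - χ_{I_+})`, with `I_-`, `I_+` the left and
right halves of `I`. -/
def haar (δ : ℝ) (I : ArcIndex) (θ : Torus) : ℂ :=
  (((Real.sqrt (arcLength I))⁻¹ : ℝ) : ℂ) *
    ((arc δ (I.1 + 1) (2 * (I.2 : ℕ))).indicator (fun _ => (1 : ℂ)) θ -
      (arc δ (I.1 + 1) (2 * (I.2 : ℕ) + 1)).indicator (fun _ => (1 : ℂ)) θ)

/-! ### The dyadic space -/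

/-- A collection `𝐟 = {f_I}_I ∪ {f_0}` of complex numbers. -/
@[ext] structure HaarData where
  mean : ℂ
  coeff : ArcIndex → ℂ

/-- The partial sum `f_N = f_0 + ∑ f_I h_I` over the arcs of generation at most `N`. -/
def partialSum (δ : ℝ) (F : HaarData) (N : ℕ) (θ : Torus) : ℂ :=
  F.mean + ∑ k ∈ Finset.range (N + 1), ∑ m : Fin (2 ^ k), F.coeff ⟨k, m⟩ * haar δ ⟨k, m⟩ θ

/-- The dyadic square function `|f_0| + (∑_I |f_I|² χ_I / |I|)^{1/2}`, with values in `[0, ∞]`. -/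
def squareFunction (δ : ℝ) (F : HaarData) (θ : Torus) : ℝ≥0∞ :=
  ‖F.mean‖ₑ + (∑' I : ArcIndex, (dyadicArc δ I).indicator
    (fun _ => ‖F.coeff I‖ₑ ^ 2 / ENNReal.ofReal (arcLength I)) θ) ^ (1 / 2 : ℝ)

/-- The sequence space `h^log_𝓘`. -/
def hlog (δ : ℝ) : Set HaarData := {F | ∫⁻ θ, Psi (squareFunction δ F θ) < ⊤}

/-- The quasi-norm of `h^log_𝓘`. -/
def hlogNorm (δ : ℝ) (F : HaarData) : ℝ := luxemburg (squareFunction δ F)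

/-- `ι(𝐟) = f`: the functions `f_N` converge to `f` in `𝒟'`. -/
def IsHaarSum (δ : ℝ) (F : HaarData) (f : distributions) : Prop :=
  ∀ φ : testFunctions, Tendsto (fun N => pairing (partialSum δ F N) φ) atTop (𝓝 (f.1 φ))

/-- The dyadic space `H^log_𝓘(𝕋) = ι[h^log_𝓘]`. -/
def HlogDyadic (δ : ℝ) : Set distributions := {f | ∃ F ∈ hlog δ, IsHaarSum δ F f}

/-- `‖f‖ = ‖𝐟‖` where `𝐟 ∈ h^log_𝓘` is the collection with `ι(𝐟) = f` (the set below has at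
most one element as soon as `ι` is injective). -/
def HlogDyadicNorm (δ : ℝ) (f : distributions) : ℝ :=
  sInf {r : ℝ | ∃ F ∈ hlog δ, IsHaarSum δ F f ∧ hlogNorm δ F = r}

/-! ### The atomic space -/

/-- `a` is an `H^log_𝓘`-atom associated to the arc `I`. -/
structure IsAtom (δ : ℝ) (I : ArcIndex) (a : Torus → ℂ) : Prop where
  measurable : Measurable a
  support_subset : Function.support a ⊆ dyadicArc δ I
  integral_eq_zero : ∫ θ in dyadicArc δ I, a θ = 0
  norm_le : eLpNorm a ⊤ volume ≤
    ENNReal.ofReal (luxemburg ((dyadicArc δ I).indicator fun _ => (1 : ℝ≥0∞)))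

/-- `f - f̂(0) = ∑_k β_k` in `𝒟'`, where `β_k` is a scalar multiple of an atom associated to
`I_k` and `∑_k |I_k| Ψ₀(‖β_k‖_∞) < ∞`. -/
structure IsAtomicDecomposition (δ : ℝ) (f : distributions) (I : ℕ → ArcIndex)
    (β : ℕ → Torus → ℂ) : Prop where
  multiple : ∀ k, ∃ (μ : ℂ) (a : Torus → ℂ), IsAtom δ (I k) a ∧ β k = fun θ => μ * a θ
  summable : ∑' k, ENNReal.ofReal (arcLength (I k)) * Psi (eLpNorm (β k) ⊤ volume) < ⊤
  converges : ∀ φ : testFunctions,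
    Tendsto (fun N => pairing (fun θ => ∑ k ∈ Finset.range N, β k θ) φ) atTop
      (𝓝 (f.1 φ - pairing (fun _ => zeroCoeff f) φ))

/-- `Λ_∞(f, {β_k})`. -/
def Lam (f : distributions) (I : ℕ → ArcIndex) (β : ℕ → Torus → ℂ) : ℝ :=
  sInf {l : ℝ | 0 < l ∧
    Psi (ENNReal.ofReal l⁻¹ * ‖zeroCoeff f‖ₑ) +
      ∑' k, ENNReal.ofReal (arcLength (I k)) *
        Psi (ENNReal.ofReal l⁻¹ * eLpNorm (β k) ⊤ volume) ≤ 1}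

/-- The atomic space `H^log_{at,𝓘}(𝕋)`. -/
def HlogAtomic (δ : ℝ) : Set distributions := {f | ∃ I β, IsAtomicDecomposition δ f I β}

/-- The quasi-norm of `H^log_{at,𝓘}(𝕋)`. -/
def HlogAtomicNorm (δ : ℝ) (f : distributions) : ℝ :=
  sInf {r : ℝ | ∃ I β, IsAtomicDecomposition δ f I β ∧ Lam f I β = r}

end

end DyadicHlog

/-!
The proof passes through *blocks*, bounded functions of mean zero on dyadic arcs. They are exactly
the multiples of atoms, and for a family of blocks `β_k` on arcs `I_k` with bounds `b_k` everything is
controlled by `∑ |I_k| Ψ(b_k)`. If this sum is finite, then `log (e + b_k)` is at most a multiple of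
the generation of `I_k` plus one (`le_mul_Psi0_of_le`), hence `∑ b_k |I_k| / (gen I_k + 1)` converges
(`IsBlockFamily.summable_div`). In particular the Haar coefficients of `∑ β_k` are absolutely
convergent sums, and `∑ β_k` is a distribution equal to the sum of its Haar series
(`IsBlockFamily.isHaarSum`).

*From atoms to the square function.* The function `Ψ` is countably subadditive, and the square
function of a single block vanishes off its arc and is bounded in `L²` by Bessel's inequality. As
`Ψ` grows at most linearly, this gives `∫ Ψ(S[β]) ≤ 2 |I| Ψ(b)` for one block, and summing over
the blocks gives `IsBlockFamily.lintegral_Psi_squareFunction_le`.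

*From the square function to atoms.* The Haar series is a dyadic martingale. For each `i` it is
stopped as soon as its square function or the martingale itself exceeds `l 2^i`, where the square
function is predictable because `|h_I|` is constant on `I`. The stopped martingales are bounded by
`2 l 2^i` and therefore close to bounded functions; the difference of two successive ones is a sum of
blocks on the maximal stopping arcs. By orthogonality of the Haar functions, the total length of
these arcs is at most a multiple of `∫ min(S², (l 2^i)²) / (l 2^i)²` (`volume_bad_le`), and summing
over `i` against `Ψ(2^i)` gives a multiple of `∫ Ψ(S / l)`, because `Ψ` grows faster than the square
root and slower than the square (`tsum_Psi_level_le`). This is `exists_blockFamily`. Stopping the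
martingale and not only its square function is what makes the blocks bounded.

*Injectivity.* Haar data in the dyadic space come from a family of blocks, and they are determined by
the integrals of `∑ β_k` over dyadic arcs. The functions `χ_I` are not test functions, and the blocks
are summable only after division by the generation. However, a logarithmic average of smooth cutoffs
of `χ_I` at scales `2^{-j}`, `j ≤ N`, differs from `χ_I` by a function whose pairing with a block
bounded by `b` on an arc `J` of generation `k` is at most a multiple of `b |J| / ((k + 1) log N)`
(`exists_block_logCutoff_bound`). So the distribution determines these integrals
(`IsBlockFamily.tendsto_toDistribution_logCutoff`).

Both gauges are compared at the same scale `l`; the inequality `Ψ(r x) ≤ 2 √r Ψ(x)` for `r ≤ 1` turns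
a bounded Orlicz sum into one that is at most `1` at the cost of a constant factor in `l`.
-/

namespace DyadicHlog

noncomputable section

/-! ### The growth function -/

theorem one_le_log_exp_one_add {t : ℝ} (ht : 0 ≤ t) : 1 ≤ Real.log (Real.exp 1 + t) := by
  rw [Real.le_log_iff_exp_le (by positivity)]
  linarith

theorem Psi0_nonneg {t : ℝ} (ht : 0 ≤ t) : 0 ≤ Psi0 t :=
  div_nonneg ht (zero_le_one.trans (one_le_log_exp_one_add ht))

theorem log_exp_one_add_mul_le {c t : ℝ} (hc : 1 ≤ c) (ht : 0 ≤ t) :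
    Real.log (Real.exp 1 + c * t) ≤ Real.log c + Real.log (Real.exp 1 + t) := by
  have he := Real.exp_pos 1
  rw [← Real.log_mul (by positivity) (by positivity)]
  apply Real.log_le_log (by positivity)
  nlinarith

theorem Psi0_mul_le {c t : ℝ} (hc : 1 ≤ c) (ht : 0 ≤ t) : Psi0 (c * t) ≤ c * Psi0 t := by
  unfold Psi0
  have h1 := one_le_log_exp_one_add ht
  rw [← mul_div_assoc]
  apply div_le_div_of_nonneg_left (by positivity) (by linarith)
  apply Real.log_le_log (by positivity)
  nlinarith

theorem Psi0_mono {s t : ℝ} (hs : 0 ≤ s) (hst : s ≤ t) : Psi0 s ≤ Psi0 t := by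
  rcases hs.eq_or_lt with rfl | hs
  · simpa [Psi0] using Psi0_nonneg hst
  obtain ⟨c, hc, rfl⟩ : ∃ c, 1 ≤ c ∧ t = c * s :=
    ⟨t / s, (one_le_div hs).2 hst, by field_simp⟩
  have h1 := one_le_log_exp_one_add hs.le
  have h2 := one_le_log_exp_one_add (hs.le.trans hst)
  have h3 := log_exp_one_add_mul_le hc hs.le
  have h4 := Real.log_le_sub_one_of_pos (zero_lt_one.trans_le hc)
  unfold Psi0
  rw [div_le_div_iff₀ (by linarith) (by linarith)]
  have : Real.log (Real.exp 1 + c * s) ≤ c * Real.log (Real.exp 1 + s) := by nlinarith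
  nlinarith

/-- Lower growth of `Ψ₀`; the exponent `1/2` absorbs the logarithm `1 + log c ≤ 2 √c`. -/
theorem sqrt_mul_Psi0_le {c t : ℝ} (hc : 1 ≤ c) (ht : 0 ≤ t) :
    Real.sqrt c * Psi0 t ≤ 2 * Psi0 (c * t) := by
  have hc0 : 0 < c := by linarith
  have h1 := one_le_log_exp_one_add ht
  have h2 := one_le_log_exp_one_add (mul_nonneg hc0.le ht)
  have h3 := log_exp_one_add_mul_le hc ht
  have hs : 0 < Real.sqrt c := Real.sqrt_pos.2 hc0
  have h4 : Real.log c ≤ 2 * (Real.sqrt c - 1) := by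
    have := Real.log_le_sub_one_of_pos hs
    rw [Real.log_sqrt hc0.le] at this
    linarith
  have h5 : 1 ≤ Real.sqrt c := Real.one_le_sqrt.2 hc
  have h6 : Real.log (Real.exp 1 + c * t) ≤ 2 * Real.sqrt c * Real.log (Real.exp 1 + t) := by
    nlinarith
  unfold Psi0
  rw [← mul_div_assoc, ← mul_div_assoc, div_le_div_iff₀ (by linarith) (by linarith)]
  calc Real.sqrt c * t * Real.log (Real.exp 1 + c * t)
      ≤ Real.sqrt c * t * (2 * Real.sqrt c * Real.log (Real.exp 1 + t)) := by gcongr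
    _ = 2 * ((Real.sqrt c * Real.sqrt c) * t) * Real.log (Real.exp 1 + t) := by ring
    _ = 2 * (c * t) * Real.log (Real.exp 1 + t) := by rw [Real.mul_self_sqrt hc0.le]

theorem le_of_Psi0_le {b E : ℝ} (hb : 0 ≤ b) (h : Psi0 b ≤ E) : b ≤ 1 + 16 * E ^ 2 := by
  have hE : 0 ≤ E := (Psi0_nonneg hb).trans h
  rcases le_total b 1 with h1 | h1
  · nlinarith
  have h2 := sqrt_mul_Psi0_le h1 zero_le_one
  have h3 : (1 : ℝ) / 2 ≤ Psi0 1 := by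
    have := log_exp_one_add_mul_le (c := 2) (t := 0) (by norm_num) le_rfl
    have h5 : Real.log (Real.exp 1 + 1) ≤ 2 := by
      rw [Real.log_le_iff_le_exp (by positivity)]
      have : Real.exp 2 = Real.exp 1 * Real.exp 1 := by rw [← Real.exp_add]; norm_num
      nlinarith [Real.add_one_le_exp (1 : ℝ)]
    exact div_le_div_of_nonneg_left zero_le_one
      (zero_lt_one.trans_le (one_le_log_exp_one_add zero_le_one)) h5
  have h4 : Real.sqrt b ≤ 4 * E := by
    rw [mul_one] at h2
    nlinarith [Real.sqrt_nonneg b]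
  nlinarith [Real.sq_sqrt hb, Real.sqrt_nonneg b]

/-- If `|I| Ψ₀(b)` is bounded, `I` an arc of generation `g`, then `b / Ψ₀(b) = log (e + b)` is at
most a multiple of `g + 1`. -/
theorem le_mul_Psi0_of_le {b E : ℝ} {g : ℕ} (hb : 0 ≤ b) (h : Psi0 b ≤ E * 2 ^ g) :
    b ≤ (Real.log (4 + 16 * E ^ 2) + 2) * (g + 1) * Psi0 b := by
  have h1 := le_of_Psi0_le hb h
  have h2 := one_le_log_exp_one_add hb
  have h3 : b = Real.log (Real.exp 1 + b) * Psi0 b := by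
    unfold Psi0; field_simp
  have h4 : (1 : ℝ) ≤ 4 ^ g := one_le_pow₀ (by norm_num)
  have h5 : Real.exp 1 + b ≤ (4 + 16 * E ^ 2) * 4 ^ g := by
    have : ((2 : ℝ) ^ g) ^ 2 = 4 ^ g := by rw [← pow_mul, mul_comm, pow_mul]; norm_num
    rw [mul_pow, this] at h1
    linarith [Real.exp_one_lt_d9]
  have h6 : Real.log (Real.exp 1 + b) ≤ Real.log (4 + 16 * E ^ 2) + g * Real.log 4 := by
    have := Real.log_le_log (by positivity) h5
    rwa [Real.log_mul (by positivity) (by positivity), Real.log_pow] at this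
  have h7 : Real.log 4 ≤ 2 := by
    have : (4 : ℝ) = 2 ^ 2 := by norm_num
    rw [this, Real.log_pow]
    have := Real.log_two_lt_d9
    push_cast; linarith
  have h8 : 0 ≤ Real.log (4 + 16 * E ^ 2) := Real.log_nonneg (by nlinarith [sq_nonneg E])
  have h9 : (0 : ℝ) ≤ g := Nat.cast_nonneg g
  calc b = Real.log (Real.exp 1 + b) * Psi0 b := h3
    _ ≤ _ := by
      apply mul_le_mul_of_nonneg_right _ (Psi0_nonneg hb)
      nlinarith

theorem Psi_ofReal {t : ℝ} (ht : 0 ≤ t) : Psi (ENNReal.ofReal t) = ENNReal.ofReal (Psi0 t) := by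
  simp [Psi, ENNReal.toReal_ofReal ht]

@[simp] theorem Psi_top : Psi ⊤ = ⊤ := by simp [Psi]

@[simp] theorem Psi_zero : Psi 0 = 0 := by simp [Psi, Psi0]

theorem Psi_lt_top {x : ℝ≥0∞} (hx : x ≠ ⊤) : Psi x < ⊤ := by simp [Psi, hx]

theorem Psi_mono : Monotone Psi := by
  intro x y hxy
  rcases eq_or_ne y ⊤ with rfl | hy
  · simp
  have hx : x ≠ ⊤ := ne_top_of_le_ne_top hy hxy
  rw [← ENNReal.ofReal_toReal hx, ← ENNReal.ofReal_toReal hy, Psi_ofReal ENNReal.toReal_nonneg,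
    Psi_ofReal ENNReal.toReal_nonneg]
  exact ENNReal.ofReal_le_ofReal (Psi0_mono ENNReal.toReal_nonneg (ENNReal.toReal_mono hy hxy))

theorem measurable_Psi : Measurable Psi := Psi_mono.measurable

theorem Psi_mul_le {c : ℝ} (hc : 1 ≤ c) (x : ℝ≥0∞) :
    Psi (ENNReal.ofReal c * x) ≤ ENNReal.ofReal c * Psi x := by
  have hc0 : 0 < c := by linarith
  rcases eq_or_ne x ⊤ with rfl | hx
  · simp [ENNReal.mul_top, hc0]
  lift x to NNReal using hx
  rw [← ENNReal.ofReal_coe_nnreal, ← ENNReal.ofReal_mul hc0.le, Psi_ofReal (by positivity),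
    Psi_ofReal (by positivity), ← ENNReal.ofReal_mul hc0.le]
  exact ENNReal.ofReal_le_ofReal (Psi0_mul_le hc x.2)

theorem Psi_mul_le_sqrt {r : ℝ} (h0 : 0 < r) (h1 : r ≤ 1) (x : ℝ≥0∞) :
    Psi (ENNReal.ofReal r * x) ≤ ENNReal.ofReal (2 * Real.sqrt r) * Psi x := by
  have hs : 0 < Real.sqrt r := Real.sqrt_pos.2 h0
  rcases eq_or_ne x ⊤ with rfl | hx
  · simp [ENNReal.mul_top, h0]
  lift x to NNReal using hx
  rw [← ENNReal.ofReal_coe_nnreal, ← ENNReal.ofReal_mul h0.le, Psi_ofReal (by positivity),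
    Psi_ofReal (by positivity), ← ENNReal.ofReal_mul (by positivity)]
  apply ENNReal.ofReal_le_ofReal
  have := sqrt_mul_Psi0_le (c := r⁻¹) (t := r * x) ((one_le_inv₀ h0).2 h1) (by positivity)
  rw [inv_mul_cancel_left₀ h0.ne', Real.sqrt_inv, inv_mul_le_iff₀ hs] at this
  linarith

theorem Psi_eq_mul {x : ℝ≥0∞} (hx : x ≠ ⊤) :
    Psi x = x * ENNReal.ofReal (Real.log (Real.exp 1 + x.toReal))⁻¹ := by
  have h := one_le_log_exp_one_add (t := x.toReal) ENNReal.toReal_nonneg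
  rw [Psi, if_neg hx, Psi0, div_eq_mul_inv, ENNReal.ofReal_mul ENNReal.toReal_nonneg,
    ENNReal.ofReal_toReal hx]

/-- `Ψ` is countably subadditive, because `Ψ(x) / x` decreases. -/
theorem Psi_tsum_le {ι : Type*} (x : ι → ℝ≥0∞) : Psi (∑' i, x i) ≤ ∑' i, Psi (x i) := by
  have key : ∀ X : ℝ≥0∞, X ≠ ⊤ → ∀ y ≤ X,
      y * ENNReal.ofReal (Real.log (Real.exp 1 + X.toReal))⁻¹ ≤ Psi y := by
    intro X hX y hy
    rw [Psi_eq_mul (ne_top_of_le_ne_top hX hy)]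
    gcongr
    exact zero_lt_one.trans_le (one_le_log_exp_one_add ENNReal.toReal_nonneg)
  rcases eq_or_ne (∑' i, x i) ⊤ with h | h
  · by_contra! hlt
    have hfin : ∑' i, Psi (x i) ≠ ⊤ := hlt.ne_top
    -- All terms are bounded by a common finite `B`, so `Ψ(x i)` dominates a multiple of `x i`.
    set K := (∑' i, Psi (x i)).toReal with hK
    have hB : ∀ i, x i ≤ ENNReal.ofReal (1 + 16 * K ^ 2) := by
      intro i
      have h1 : Psi (x i) ≤ ∑' i, Psi (x i) := ENNReal.le_tsum i
      have h2 : x i ≠ ⊤ := by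
        intro h2
        rw [h2, Psi_top] at h1
        exact hfin (top_le_iff.1 h1)
      rw [← ENNReal.ofReal_toReal h2]
      apply ENNReal.ofReal_le_ofReal
      apply le_of_Psi0_le ENNReal.toReal_nonneg
      have h3 := ENNReal.toReal_mono hfin h1
      rwa [← ENNReal.ofReal_toReal h2, Psi_ofReal ENNReal.toReal_nonneg,
        ENNReal.toReal_ofReal (Psi0_nonneg ENNReal.toReal_nonneg)] at h3
    have h4 := ENNReal.tsum_le_tsum fun i => key _ ENNReal.ofReal_ne_top _ (hB i)
    rw [ENNReal.tsum_mul_right, h, ENNReal.top_mul] at h4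
    · exact hfin (top_le_iff.1 h4)
    · have := one_le_log_exp_one_add
        (t := (ENNReal.ofReal (1 + 16 * K ^ 2)).toReal) ENNReal.toReal_nonneg
      simp only [ne_eq, ENNReal.ofReal_eq_zero, not_le]
      positivity
  · rw [Psi_eq_mul h, ← ENNReal.tsum_mul_right]
    exact ENNReal.tsum_le_tsum fun i => key _ h _ (ENNReal.le_tsum i)

theorem Psi_add_le (x y : ℝ≥0∞) : Psi (x + y) ≤ Psi x + Psi y := by
  have := Psi_tsum_le fun i : Fin 2 => if i = 0 then x else y
  simpa [tsum_fintype] using this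

/-- A quadratic bound, through which `L²` estimates control Orlicz integrals. -/
theorem Psi_le_mul_one_add_sq (x : ℝ≥0∞) {b : ℝ≥0∞} (hb : b ≠ 0) (hb' : b ≠ ⊤) :
    Psi x ≤ Psi b * (1 + (x / b) ^ 2) := by
  rcases le_total x b with h | h
  · calc Psi x ≤ Psi b * 1 := by rw [mul_one]; exact Psi_mono h
      _ ≤ _ := by gcongr; exact le_self_add
  have hPb : Psi b ≠ 0 := by
    rw [Psi_eq_mul hb']
    have := one_le_log_exp_one_add (t := b.toReal) ENNReal.toReal_nonneg
    simp only [ne_eq, mul_eq_zero, hb, ENNReal.ofReal_eq_zero, not_le, false_or]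
    positivity
  rcases eq_or_ne x ⊤ with rfl | hx
  · simp [ENNReal.top_div, hb', ENNReal.mul_top, hPb]
  have h1 : 1 ≤ x / b := by
    rw [ENNReal.le_div_iff_mul_le (Or.inl hb) (Or.inl hb'), one_mul]
    exact h
  have hxb : x / b ≠ ⊤ := ENNReal.div_ne_top hx hb
  have h2 : 1 ≤ (x / b).toReal := by
    rwa [← ENNReal.toReal_one, ENNReal.toReal_le_toReal ENNReal.one_ne_top hxb]
  calc Psi x = Psi (ENNReal.ofReal (x / b).toReal * b) := by
        rw [ENNReal.ofReal_toReal hxb, ENNReal.div_mul_cancel hb hb']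
    _ ≤ x / b * Psi b := by
        have := Psi_mul_le h2 b
        rwa [ENNReal.ofReal_toReal hxb] at this ⊢
    _ = Psi b * (x / b) := mul_comm _ _
    _ ≤ Psi b * (1 + (x / b) ^ 2) := by
        gcongr
        calc x / b ≤ x / b * (x / b) := le_mul_of_one_le_right' h1
          _ = (x / b) ^ 2 := (sq _).symm
          _ ≤ _ := le_add_self

/-- Two-sided geometric sums, the exponent being the distance `|j - n|`. -/
theorem sum_three_quarters_pow_dist_le (n N : ℕ) :
    ∑ j ∈ Finset.range N, (3 / 4 : ℝ) ^ ((j - n) + (n - j)) ≤ 8 := by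
  have hA : ∀ M ≤ n, ∑ j ∈ Finset.range M, (3 / 4 : ℝ) ^ ((j - n) + (n - j))
      ≤ 4 * (3 / 4) ^ (n - M + 1) := by
    intro M
    induction M with
    | zero => intro _; simp; positivity
    | succ M ih =>
      intro hM
      rw [Finset.sum_range_succ]
      have h1 := ih (by omega)
      have h2 : n - M + 1 = n - (M + 1) + 1 + 1 := by omega
      have h3 : M - n + (n - M) = n - (M + 1) + 1 := by omega
      rw [h2, pow_succ] at h1
      rw [h3]
      linarith
  have hB : ∀ m, ∑ j ∈ Finset.range (n + m), (3 / 4 : ℝ) ^ ((j - n) + (n - j))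
      ≤ 7 - 4 * (3 / 4) ^ m := by
    intro m
    induction m with
    | zero => have := hA n le_rfl; simp at this ⊢; linarith
    | succ m ih =>
      rw [← add_assoc, Finset.sum_range_succ]
      have h3 : n + m - n + (n - (n + m)) = m := by omega
      rw [h3, pow_succ]
      linarith
  calc _ ≤ ∑ j ∈ Finset.range (n + N), (3 / 4 : ℝ) ^ ((j - n) + (n - j)) :=
        Finset.sum_le_sum_of_subset_of_nonneg (Finset.range_mono (by omega))
          fun _ _ _ => by positivity
    _ ≤ _ := (hB N).trans (by have : (0 : ℝ) < (3 / 4) ^ N := by positivity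
                              linarith)

theorem Psi0_level_le {s : ℝ} {n i : ℕ} (hs : 0 ≤ s) (h1 : s < 2 ^ (n + 1))
    (h2 : n = 0 ∨ 2 ^ n ≤ s) :
    Psi0 (2 ^ i) * (min (s ^ 2) (4 ^ i) / 4 ^ i) ≤
      2 * Psi0 s * (3 / 4) ^ ((i - n) + (n - i)) := by
  have h4 : (4 : ℝ) ^ i = 2 ^ i * 2 ^ i := by rw [← mul_pow]; norm_num
  have hp : (0 : ℝ) < 2 ^ i := by positivity
  have hPs := Psi0_nonneg hs
  have hPi := Psi0_nonneg hp.le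
  rcases hs.eq_or_lt with rfl | hs0
  · simp [Psi0]
  rcases le_total s (2 ^ i) with h | h
  · have hb : Psi0 (2 ^ i) ≤ 2 ^ i / s * Psi0 s := by
      have := Psi0_mul_le (c := 2 ^ i / s) ((one_le_div hs0).2 h) hs
      rwa [div_mul_cancel₀ _ hs0.ne'] at this
    have hc : s / 2 ^ i ≤ 2 * (3 / 4) ^ ((i - n) + (n - i)) := by
      rcases h2 with rfl | h2
      · simp only [Nat.sub_zero, Nat.zero_sub, add_zero, zero_add, pow_one] at h1 ⊢
        rw [div_le_iff₀ hp, mul_assoc, ← mul_pow]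
        have : (1 : ℝ) ≤ (3 / 4 * 2) ^ i := one_le_pow₀ (by norm_num)
        linarith
      · have hni : n ≤ i := (pow_le_pow_iff_right₀ (one_lt_two : (1 : ℝ) < 2)).1 (h2.trans h)
        obtain ⟨m, rfl⟩ := Nat.exists_eq_add_of_le hni
        have e : n + m - n + (n - (n + m)) = m := by omega
        rw [e, div_le_iff₀ hp, pow_add]
        have : (1 : ℝ) ≤ (3 / 4 * 2) ^ m := one_le_pow₀ (by norm_num)
        calc s ≤ 2 * 2 ^ n * 1 := by rw [pow_succ] at h1; linarith
          _ ≤ 2 * 2 ^ n * (3 / 4 * 2) ^ m := by gcongr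
          _ = _ := by rw [mul_pow]; ring
    calc _ ≤ 2 ^ i / s * Psi0 s * (s ^ 2 / 4 ^ i) := by
          gcongr
          exact min_le_left _ _
      _ = s / 2 ^ i * Psi0 s := by rw [h4]; field_simp
      _ ≤ _ := by nlinarith
  · have hin : i ≤ n := by
      have := (pow_lt_pow_iff_right₀ (one_lt_two : (1 : ℝ) < 2)).1 (h.trans_lt h1)
      omega
    obtain ⟨m, rfl⟩ := Nat.exists_eq_add_of_le hin
    have e : i - (i + m) + (i + m - i) = m := by omega
    have hm : (2 : ℝ) ^ m ≤ s / 2 ^ i := by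
      rw [le_div_iff₀ hp]
      rcases h2 with h2 | h2
      · obtain rfl : i = 0 := by omega
        obtain rfl : m = 0 := by omega
        simpa using h
      · rwa [pow_add, mul_comm] at h2
    have hm' : (4 / 3 : ℝ) ^ m ≤ Real.sqrt (s / 2 ^ i) := by
      apply Real.le_sqrt_of_sq_le
      refine le_trans ?_ hm
      rw [← pow_mul, mul_comm, pow_mul]
      gcongr
      norm_num
    have hk := sqrt_mul_Psi0_le (c := s / 2 ^ i) ((one_le_div hp).2 h) hp.le
    rw [div_mul_cancel₀ _ hp.ne'] at hk
    have hq : (4 / 3 : ℝ) ^ m * Psi0 (2 ^ i) ≤ 2 * Psi0 s :=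
      (mul_le_mul_of_nonneg_right hm' hPi).trans hk
    have hr : (3 / 4 : ℝ) ^ m * (4 / 3) ^ m = 1 := by rw [← mul_pow]; norm_num
    rw [e]
    calc _ ≤ Psi0 (2 ^ i) * 1 := by
          gcongr
          rw [div_le_one (by positivity)]
          exact min_le_right _ _
      _ = (3 / 4) ^ m * ((4 / 3 : ℝ) ^ m * Psi0 (2 ^ i)) := by rw [← mul_assoc, hr]; ring
      _ ≤ (3 / 4) ^ m * (2 * Psi0 s) := by gcongr
      _ = _ := by ring

/-- The level sets of a function `s` add up to its Orlicz integral: `Ψ` grows faster than a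
positive power and slower than the square. -/
theorem tsum_Psi_level_le (s : ℝ≥0∞) :
    ∑' i : ℕ, Psi (2 ^ i) * (min (s ^ 2) (4 ^ i) / 4 ^ i) ≤ 16 * Psi s := by
  rcases eq_or_ne s ⊤ with rfl | hs
  · simp
  lift s to NNReal using hs
  obtain ⟨n, h1, h2⟩ : ∃ n : ℕ, (s : ℝ) < 2 ^ (n + 1) ∧ (n = 0 ∨ (2 : ℝ) ^ n ≤ s) := by
    have hex : ∃ n : ℕ, (s : ℝ) < 2 ^ (n + 1) := by
      obtain ⟨n, hn⟩ := pow_unbounded_of_one_lt (s : ℝ) one_lt_two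
      exact ⟨n, hn.trans (pow_lt_pow_right₀ one_lt_two (Nat.lt_succ_self n))⟩
    classical
    refine ⟨Nat.find hex, Nat.find_spec hex, ?_⟩
    rcases Nat.eq_zero_or_pos (Nat.find hex) with h | h
    · exact Or.inl h
    · right
      have := Nat.find_min hex (Nat.sub_lt h one_pos)
      rwa [show Nat.find hex - 1 + 1 = Nat.find hex from Nat.sub_add_cancel h,
        not_lt] at this
  have hterm : ∀ i : ℕ, Psi (2 ^ i) * (min ((s : ℝ≥0∞) ^ 2) (4 ^ i) / 4 ^ i) ≤
      ENNReal.ofReal (2 * Psi0 s * (3 / 4) ^ ((i - n) + (n - i))) := by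
    intro i
    refine le_trans (le_of_eq ?_) (ENNReal.ofReal_le_ofReal (Psi0_level_le s.2 h1 h2))
    have e2 : (2 : ℝ≥0∞) ^ i = ENNReal.ofReal (2 ^ i) := by
      rw [ENNReal.ofReal_pow zero_le_two, ENNReal.ofReal_ofNat]
    have e4 : (4 : ℝ≥0∞) ^ i = ENNReal.ofReal (4 ^ i) := by
      rw [ENNReal.ofReal_pow (by norm_num), ENNReal.ofReal_ofNat]
    have es : (s : ℝ≥0∞) ^ 2 = ENNReal.ofReal ((s : ℝ) ^ 2) := by
      rw [ENNReal.ofReal_pow s.coe_nonneg, ENNReal.ofReal_coe_nnreal]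
    rw [e2, e4, es, Psi_ofReal (by positivity), ← ENNReal.ofReal_min,
      ← ENNReal.ofReal_div_of_pos (by positivity), ← ENNReal.ofReal_mul (Psi0_nonneg (by positivity))]
  refine (ENNReal.tsum_le_tsum hterm).trans ?_
  rw [ENNReal.tsum_eq_iSup_nat]
  refine iSup_le fun N => ?_
  have hP := Psi0_nonneg s.coe_nonneg
  rw [← ENNReal.ofReal_sum_of_nonneg (fun i _ => by positivity), ← Finset.mul_sum,
    ← ENNReal.ofReal_coe_nnreal, Psi_ofReal s.coe_nonneg, ← ENNReal.ofReal_ofNat 16,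
    ← ENNReal.ofReal_mul (by norm_num)]
  apply ENNReal.ofReal_le_ofReal
  have := sum_three_quarters_pow_dist_le n N
  nlinarith

/-! ### Dyadic coordinates on the torus -/


/-- The coordinate of `θ` in `[0, 1)` in which the arcs of the system `𝓘^δ` are the standard
dyadic intervals. -/
def pos (δ : ℝ) (θ : Torus) : ℝ :=
  (AddCircle.equivIco (2 * Real.pi) (2 * Real.pi * δ) θ : ℝ) / (2 * Real.pi) - δ

/-- The number, within its generation, of the arc of generation `k` that contains `θ`. -/
def idx (δ : ℝ) (k : ℕ) (θ : Torus) : ℕ := ⌊2 ^ k * pos δ θ⌋₊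

variable {δ : ℝ}

theorem pos_nonneg (θ : Torus) : 0 ≤ pos δ θ := by
  have h := (AddCircle.equivIco (2 * Real.pi) (2 * Real.pi * δ) θ).2.1
  have := Real.pi_pos
  rw [pos, sub_nonneg, le_div_iff₀ (by positivity)]
  linarith

theorem pos_lt_one (θ : Torus) : pos δ θ < 1 := by
  have h := (AddCircle.equivIco (2 * Real.pi) (2 * Real.pi * δ) θ).2.2
  have := Real.pi_pos
  rw [pos, sub_lt_iff_lt_add, div_lt_iff₀ (by positivity)]
  linarith

theorem coe_pos (θ : Torus) : ((2 * Real.pi * (pos δ θ + δ) : ℝ) : Torus) = θ := by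
  have := Real.pi_pos
  have e : 2 * Real.pi * (pos δ θ + δ) =
      (AddCircle.equivIco (2 * Real.pi) (2 * Real.pi * δ) θ : ℝ) := by
    rw [pos, sub_add_cancel]
    field_simp
  rw [e]
  exact AddCircle.coe_equivIco

theorem pos_coe {t : ℝ} (h0 : 0 ≤ t) (h1 : t < 1) :
    pos δ ((2 * Real.pi * (t + δ) : ℝ) : Torus) = t := by
  have := Real.pi_pos
  rw [pos, AddCircle.equivIco_coe_of_mem]
  · field_simp
    ring
  · constructor <;> nlinarith

theorem measurable_pos : Measurable (pos δ) :=
  ((measurable_subtype_coe.comp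
    (AddCircle.measurableEquivIco (2 * Real.pi) (2 * Real.pi * δ)).measurable).div_const _).sub_const _

theorem measurable_idx (k : ℕ) : Measurable (idx δ k) :=
  Nat.measurable_floor.comp (measurable_pos.const_mul _)

theorem idx_lt (k : ℕ) (θ : Torus) : idx δ k θ < 2 ^ k := by
  have h0 := pos_nonneg (δ := δ) θ
  rw [idx, Nat.floor_lt (by positivity)]
  have := pos_lt_one (δ := δ) θ
  push_cast
  have h2 : (0 : ℝ) < 2 ^ k := by positivity
  nlinarith

theorem idx_succ_div_two (k : ℕ) (θ : Torus) : idx δ (k + 1) θ / 2 = idx δ k θ := by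
  rw [idx, idx, ← Nat.floor_div_ofNat]
  congr 1
  rw [pow_succ]
  have : (OfNat.ofNat 2 : ℝ) = 2 := rfl
  rw [this]
  ring

theorem idx_zero (θ : Torus) : idx δ 0 θ = 0 := by
  have := idx_lt (δ := δ) 0 θ
  simpa using this

theorem idx_eq_of_le {k n : ℕ} (h : n ≤ k) {θ θ' : Torus} (he : idx δ k θ = idx δ k θ') :
    idx δ n θ = idx δ n θ' := by
  induction k, h using Nat.le_induction with
  | base => exact he
  | succ k _ ih =>
    apply ih
    rw [← idx_succ_div_two _ θ, ← idx_succ_div_two _ θ', he]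

theorem mem_arc_iff {k m : ℕ} (hm : m < 2 ^ k) {θ : Torus} :
    θ ∈ arc δ k m ↔ idx δ k θ = m := by
  have hpi := Real.pi_pos
  have h2 : (0 : ℝ) < 2 ^ k := by positivity
  have key : ∀ t : ℝ, 0 ≤ t →
      (⌊2 ^ k * t⌋₊ = m ↔ (m : ℝ) / 2 ^ k ≤ t ∧ t < ((m : ℝ) + 1) / 2 ^ k) := by
    intro t ht
    rw [Nat.floor_eq_iff (by positivity), div_le_iff₀' h2, lt_div_iff₀' h2]
  constructor
  · rintro ⟨x, ⟨hx1, hx2⟩, rfl⟩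
    have hm' : (m : ℝ) + 1 ≤ 2 ^ k := by exact_mod_cast hm
    obtain ⟨t, rfl⟩ : ∃ t, x = 2 * Real.pi * (t + δ) := ⟨x / (2 * Real.pi) - δ, by field_simp; ring⟩
    have h3 : (m : ℝ) / 2 ^ k ≤ t := by
      have := le_of_mul_le_mul_left hx1 (by positivity)
      linarith
    have h4 : t < ((m : ℝ) + 1) / 2 ^ k := by
      have := lt_of_mul_lt_mul_left hx2 (by positivity)
      linarith
    have h5 : 0 ≤ t := le_trans (by positivity) h3
    have h6 : t < 1 := h4.trans_le ((div_le_one h2).2 hm')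
    show idx δ k _ = m
    rw [idx, pos_coe h5 h6, key t h5]
    exact ⟨h3, h4⟩
  · intro h
    obtain ⟨h3, h4⟩ := (key _ (pos_nonneg θ)).1 h
    refine ⟨2 * Real.pi * (pos δ θ + δ), ⟨?_, ?_⟩, coe_pos θ⟩
    · gcongr
    · gcongr

theorem mem_dyadicArc_iff {I : ArcIndex} {θ : Torus} :
    θ ∈ dyadicArc δ I ↔ idx δ I.1 θ = I.2 := mem_arc_iff I.2.2

/-- The arc of generation `k` that contains `θ`. -/
def cellOf (δ : ℝ) (k : ℕ) (θ : Torus) : ArcIndex := ⟨k, ⟨idx δ k θ, idx_lt k θ⟩⟩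

theorem mem_dyadicArc_iff_cellOf {I : ArcIndex} {θ : Torus} :
    θ ∈ dyadicArc δ I ↔ cellOf δ I.1 θ = I := by
  rw [mem_dyadicArc_iff]
  obtain ⟨k, m⟩ := I
  simp [cellOf, Fin.ext_iff]

theorem mem_cellOf (k : ℕ) (θ : Torus) : θ ∈ dyadicArc δ (cellOf δ k θ) :=
  mem_dyadicArc_iff_cellOf.2 rfl

theorem cellOf_eq_of_le {k n : ℕ} (h : n ≤ k) {θ θ' : Torus}
    (he : cellOf δ k θ = cellOf δ k θ') : cellOf δ n θ = cellOf δ n θ' := by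
  have h1 : idx δ k θ = idx δ k θ' := by simpa [cellOf] using he
  simp [cellOf, idx_eq_of_le h h1]

theorem measurableSet_arc {k m : ℕ} (hm : m < 2 ^ k) : MeasurableSet (arc δ k m) := by
  have : arc δ k m = idx δ k ⁻¹' {m} := by ext θ; simp [mem_arc_iff hm]
  rw [this]
  exact measurable_idx k (measurableSet_singleton m)

theorem measurableSet_dyadicArc (I : ArcIndex) : MeasurableSet (dyadicArc δ I) :=
  measurableSet_arc I.2.2

/-- The left endpoint of an arc. -/
def arcPoint (δ : ℝ) (I : ArcIndex) : Torus :=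
  ((2 * Real.pi * (((I.2 : ℕ) : ℝ) / 2 ^ I.1 + δ) : ℝ) : Torus)

theorem arcPoint_mem (I : ArcIndex) : arcPoint δ I ∈ dyadicArc δ I := by
  have hpi := Real.pi_pos
  refine ⟨_, ⟨le_rfl, ?_⟩, rfl⟩
  gcongr
  linarith

@[simp] theorem cellOf_arcPoint (I : ArcIndex) : cellOf δ I.1 (arcPoint δ I) = I :=
  mem_dyadicArc_iff_cellOf.1 (arcPoint_mem I)

theorem arcLength_pos (I : ArcIndex) : 0 < arcLength I := by
  have := Real.pi_pos
  unfold arcLength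
  positivity

theorem volume_arc {k m : ℕ} (hm : m < 2 ^ k) :
    volume (arc δ k m) = ENNReal.ofReal (2 * Real.pi / 2 ^ k) := by
  have hpi := Real.pi_pos
  have h2 : (0 : ℝ) < 2 ^ k := by positivity
  have hm' : (m : ℝ) + 1 ≤ 2 ^ k := by exact_mod_cast hm
  set a : ℝ := 2 * Real.pi * ((m : ℝ) / 2 ^ k + δ) with ha
  set b : ℝ := 2 * Real.pi * (((m : ℝ) + 1) / 2 ^ k + δ) with hb
  have hab : b - a = 2 * Real.pi / 2 ^ k := by rw [ha, hb]; field_simp; ring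
  have ha0 : 2 * Real.pi * δ ≤ a := by
    have : (0 : ℝ) ≤ (m : ℝ) / 2 ^ k := by positivity
    rw [ha]; gcongr; linarith
  have hb1 : b ≤ 2 * Real.pi * δ + 2 * Real.pi := by
    have : ((m : ℝ) + 1) / 2 ^ k ≤ 1 := (div_le_one h2).2 hm'
    rw [hb]; nlinarith
  rw [AddCircle.add_projection_respects_measure (2 * Real.pi) (2 * Real.pi * δ)
    (measurableSet_arc hm), ← hab, ← Real.volume_Ioo]
  -- Off the endpoints the preimage of the arc in the fundamental domain is the interval itself.
  have hsub1 : Ioo a b ⊆ QuotientAddGroup.mk ⁻¹' arc δ k m ∩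
      Ioc (2 * Real.pi * δ) (2 * Real.pi * δ + 2 * Real.pi) := fun x hx =>
    ⟨⟨x, ⟨hx.1.le, hx.2⟩, rfl⟩, ha0.trans_lt hx.1, (hx.2.trans_le hb1).le⟩
  have hsub2 : QuotientAddGroup.mk ⁻¹' arc δ k m ∩
      Ioc (2 * Real.pi * δ) (2 * Real.pi * δ + 2 * Real.pi) ⊆
        Icc a b ∪ {2 * Real.pi * δ + 2 * Real.pi} := by
    rintro x ⟨⟨y, ⟨hy1, hy2⟩, hy⟩, hx1, hx2⟩
    rcases hx2.eq_or_lt with h | h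
    · exact Or.inr h
    left
    have e1 := AddCircle.equivIco_coe_of_mem (p := 2 * Real.pi) (a := 2 * Real.pi * δ)
      ⟨hx1.le, h⟩
    have e2 := AddCircle.equivIco_coe_of_mem (p := 2 * Real.pi) (a := 2 * Real.pi * δ) (y := y)
      ⟨ha0.trans hy1, hy2.trans_le hb1⟩
    have e3 : x = y := by
      rw [← e1, ← e2]
      congr 2
      exact hy.symm
    rw [e3]
    exact ⟨hy1, hy2.le⟩
  apply le_antisymm
  · refine (measure_mono hsub2).trans ((measure_union_le _ _).trans ?_)
    simp
  · exact measure_mono hsub1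

theorem volume_dyadicArc (I : ArcIndex) :
    volume (dyadicArc δ I) = ENNReal.ofReal (arcLength I) := volume_arc I.2.2

theorem volume_real_dyadicArc (I : ArcIndex) : volume.real (dyadicArc δ I) = arcLength I := by
  rw [Measure.real, volume_dyadicArc, ENNReal.toReal_ofReal (arcLength_pos I).le]

theorem volume_univ_torus : volume (univ : Set Torus) = ENNReal.ofReal (2 * Real.pi) :=
  AddCircle.measure_univ _

/-- The left half of an arc. -/
def leftHalf (I : ArcIndex) : ArcIndex :=
  ⟨I.1 + 1, ⟨2 * I.2, by have := I.2.2; rw [pow_succ]; omega⟩⟩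

/-- The right half of an arc. -/
def rightHalf (I : ArcIndex) : ArcIndex :=
  ⟨I.1 + 1, ⟨2 * I.2 + 1, by have := I.2.2; rw [pow_succ]; omega⟩⟩

theorem arcLength_leftHalf (I : ArcIndex) : arcLength (leftHalf I) = arcLength I / 2 := by
  simp only [arcLength, leftHalf, pow_succ]
  rw [div_div]

theorem arcLength_rightHalf (I : ArcIndex) : arcLength (rightHalf I) = arcLength I / 2 := by
  simp only [arcLength, rightHalf, pow_succ]
  rw [div_div]

theorem dyadicArc_eq_union (I : ArcIndex) :
    dyadicArc δ I = dyadicArc δ (leftHalf I) ∪ dyadicArc δ (rightHalf I) := by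
  ext θ
  simp only [mem_union, mem_dyadicArc_iff, leftHalf, rightHalf]
  rw [← idx_succ_div_two]
  omega

theorem disjoint_halves (I : ArcIndex) :
    Disjoint (dyadicArc δ (leftHalf I)) (dyadicArc δ (rightHalf I)) := by
  rw [Set.disjoint_left]
  intro θ
  simp only [mem_dyadicArc_iff, leftHalf, rightHalf]
  omega

theorem notMem_rightHalf {I : ArcIndex} {θ : Torus} (h : θ ∈ dyadicArc δ (leftHalf I)) :
    θ ∉ dyadicArc δ (rightHalf I) := fun h' => Set.disjoint_left.1 (disjoint_halves I) h h'

theorem haar_eq (I : ArcIndex) (θ : Torus) :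
    haar δ I θ = (((Real.sqrt (arcLength I))⁻¹ : ℝ) : ℂ) *
      ((dyadicArc δ (leftHalf I)).indicator (fun _ => (1 : ℂ)) θ -
        (dyadicArc δ (rightHalf I)).indicator (fun _ => (1 : ℂ)) θ) := rfl

theorem measurable_haar (I : ArcIndex) : Measurable (haar δ I) :=
  ((measurable_const.indicator (measurableSet_dyadicArc (leftHalf I))).sub
    (measurable_const.indicator (measurableSet_dyadicArc (rightHalf I)))).const_mul _

theorem haar_of_notMem {I : ArcIndex} {θ : Torus} (h : θ ∉ dyadicArc δ I) : haar δ I θ = 0 := by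
  rw [dyadicArc_eq_union, mem_union, not_or] at h
  simp [haar_eq, h.1, h.2]

theorem norm_haar_of_mem {I : ArcIndex} {θ : Torus} (h : θ ∈ dyadicArc δ I) :
    ‖haar δ I θ‖ = (Real.sqrt (arcLength I))⁻¹ := by
  rw [dyadicArc_eq_union, mem_union] at h
  have hd := notMem_rightHalf (δ := δ) (I := I) (θ := θ)
  rcases h with h | h
  · simp [haar_eq, h, hd h, abs_of_nonneg (Real.sqrt_nonneg _)]
  · have h' : θ ∉ dyadicArc δ (leftHalf I) := fun h' => hd h' h
    simp [haar_eq, h, h', abs_of_nonneg (Real.sqrt_nonneg _)]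

theorem norm_haar_le (I : ArcIndex) (θ : Torus) :
    ‖haar δ I θ‖ ≤ (Real.sqrt (arcLength I))⁻¹ := by
  by_cases h : θ ∈ dyadicArc δ I
  · exact (norm_haar_of_mem h).le
  · rw [haar_of_notMem h, norm_zero]
    positivity

theorem conj_haar (I : ArcIndex) (θ : Torus) : (starRingEnd ℂ) (haar δ I θ) = haar δ I θ := by
  simp only [haar_eq, map_mul, map_sub, Complex.conj_ofReal, Set.indicator]
  split_ifs <;> simp

/-- The value of `h_I` at a point depends only on the half of `I` it lies in. -/
theorem haar_congr {I : ArcIndex} {θ θ' : Torus} (h : idx δ (I.1 + 1) θ = idx δ (I.1 + 1) θ') :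
    haar δ I θ = haar δ I θ' := by
  have h1 : θ ∈ dyadicArc δ (leftHalf I) ↔ θ' ∈ dyadicArc δ (leftHalf I) := by
    simp only [mem_dyadicArc_iff, leftHalf, h]
  have h2 : θ ∈ dyadicArc δ (rightHalf I) ↔ θ' ∈ dyadicArc δ (rightHalf I) := by
    simp only [mem_dyadicArc_iff, rightHalf, h]
  have key : ∀ s : Set Torus, (θ ∈ s ↔ θ' ∈ s) →
      s.indicator (fun _ => (1 : ℂ)) θ = s.indicator (fun _ => (1 : ℂ)) θ' := by
    intro s hs
    by_cases hθ : θ ∈ s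
    · rw [indicator_of_mem hθ, indicator_of_mem (hs.1 hθ)]
    · rw [indicator_of_notMem hθ, indicator_of_notMem (fun h' => hθ (hs.2 h'))]
  rw [haar_eq, haar_eq, key _ h1, key _ h2]

theorem integrable_of_bounded {g : Torus → ℂ} (hg : AEStronglyMeasurable g volume) {c : ℝ}
    (hc : ∀ θ, ‖g θ‖ ≤ c) : Integrable g volume :=
  Integrable.of_bound hg c (ae_of_all _ hc)

theorem integrable_haar (I : ArcIndex) : Integrable (haar δ I) volume :=
  integrable_of_bounded (measurable_haar I).aestronglyMeasurable (norm_haar_le I)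

theorem integral_mul_haar {g : Torus → ℂ} (hg : Integrable g volume) (I : ArcIndex) :
    ∫ θ, g θ * haar δ I θ = (((Real.sqrt (arcLength I))⁻¹ : ℝ) : ℂ) *
      ((∫ θ in dyadicArc δ (leftHalf I), g θ) - ∫ θ in dyadicArc δ (rightHalf I), g θ) := by
  rw [← integral_indicator (measurableSet_dyadicArc _),
    ← integral_indicator (measurableSet_dyadicArc _),
    ← integral_sub (hg.indicator (measurableSet_dyadicArc _))
      (hg.indicator (measurableSet_dyadicArc _)), ← integral_const_mul]
  congr 1
  ext θ
  simp only [haar_eq, Set.indicator]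
  split_ifs <;> ring

theorem integral_dyadicArc_eq_add {g : Torus → ℂ} (hg : Integrable g volume) (I : ArcIndex) :
    ∫ θ in dyadicArc δ I, g θ =
      (∫ θ in dyadicArc δ (leftHalf I), g θ) + ∫ θ in dyadicArc δ (rightHalf I), g θ := by
  rw [dyadicArc_eq_union, setIntegral_union (disjoint_halves I) (measurableSet_dyadicArc _)
    hg.integrableOn hg.integrableOn]

theorem integral_haar (I : ArcIndex) : ∫ θ, haar δ I θ = 0 := by
  have := integral_mul_haar (δ := δ) (g := fun _ => 1) (integrable_const _) I
  simp only [one_mul] at this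
  rw [this]
  simp [volume_real_dyadicArc, arcLength_leftHalf, arcLength_rightHalf]

theorem cellOf_succ_eq_or (k : ℕ) (θ : Torus) :
    cellOf δ (k + 1) θ = leftHalf (cellOf δ k θ) ∨
      cellOf δ (k + 1) θ = rightHalf (cellOf δ k θ) := by
  have := idx_succ_div_two (δ := δ) k θ
  simp only [cellOf, leftHalf, rightHalf, Sigma.mk.injEq, heq_eq_eq, true_and, Fin.mk.injEq]
  omega

theorem dyadicArc_root (m : Fin (2 ^ 0)) : dyadicArc δ ⟨0, m⟩ = univ := by
  ext θ
  have := m.2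
  simp only [mem_dyadicArc_iff, idx_zero, mem_univ, iff_true]
  omega

/-- Averages over the arcs around a point are the partial sums of the Haar expansion. -/
theorem average_eq_sum_haar {g : Torus → ℂ} (hg : Integrable g volume) (k : ℕ) (θ : Torus) :
    ((arcLength (cellOf δ k θ) : ℝ) : ℂ)⁻¹ * ∫ x in dyadicArc δ (cellOf δ k θ), g x =
      ((2 * Real.pi : ℝ) : ℂ)⁻¹ * (∫ x, g x) + ∑ n ∈ Finset.range k,
        (∫ x, g x * haar δ (cellOf δ n θ) x) * haar δ (cellOf δ n θ) θ := by
  induction k with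
  | zero => simp [cellOf, dyadicArc_root, arcLength]
  | succ k ih =>
    rw [Finset.sum_range_succ, ← add_assoc, ← ih, integral_mul_haar hg,
      integral_dyadicArc_eq_add hg (cellOf δ k θ), haar_eq]
    set I := cellOf δ k θ
    have hl := arcLength_pos I
    have hsq : ((Real.sqrt (arcLength I) : ℝ) : ℂ)⁻¹ * ((Real.sqrt (arcLength I) : ℝ) : ℂ)⁻¹ =
        ((arcLength I : ℝ) : ℂ)⁻¹ := by
      rw [← mul_inv, ← Complex.ofReal_mul, Real.mul_self_sqrt hl.le]
    have hd := notMem_rightHalf (δ := δ) (I := I) (θ := θ)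
    have hmem := mem_cellOf (δ := δ) (k + 1) θ
    set A := ∫ x in dyadicArc δ (leftHalf I), g x
    set B := ∫ x in dyadicArc δ (rightHalf I), g x
    rcases cellOf_succ_eq_or (δ := δ) k θ with h | h
    · rw [h] at hmem ⊢
      rw [arcLength_leftHalf, indicator_of_mem hmem, indicator_of_notMem (hd hmem)]
      push_cast
      linear_combination (-(A - B)) * hsq
    · rw [h] at hmem ⊢
      rw [arcLength_rightHalf, indicator_of_mem hmem,
        indicator_of_notMem (fun h' => hd h' hmem)]
      push_cast
      linear_combination ((A - B)) * hsq

/-! ### Haar series in `L²` -/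


theorem integral_mul_haar_eq_zero {g : Torus → ℂ} {J : ArcIndex} (c : ℂ)
    (h : ∀ θ ∈ dyadicArc δ J, g θ = c) : ∫ θ, g θ * haar δ J θ = 0 := by
  have : (fun θ => g θ * haar δ J θ) = fun θ => c * haar δ J θ := by
    ext θ
    by_cases hθ : θ ∈ dyadicArc δ J
    · rw [h θ hθ]
    · simp [haar_of_notMem hθ]
  rw [this, integral_const_mul, integral_haar, mul_zero]

theorem haar_eq_on_smaller_arc {I J : ArcIndex} (h : I.1 < J.1) {θ : Torus}
    (hθ : θ ∈ dyadicArc δ J) : haar δ I θ = haar δ I (arcPoint δ J) := by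
  apply haar_congr
  apply idx_eq_of_le (k := J.1) h
  rw [mem_dyadicArc_iff.1 hθ, mem_dyadicArc_iff.1 (arcPoint_mem J)]

theorem eq_of_mem_of_mem {I J : ArcIndex} (h : I.1 = J.1) {θ : Torus}
    (hI : θ ∈ dyadicArc δ I) (hJ : θ ∈ dyadicArc δ J) : I = J := by
  rw [mem_dyadicArc_iff_cellOf] at hI hJ
  rw [← hI, ← hJ, h]

theorem integral_haar_mul_haar_of_ne {I J : ArcIndex} (h : I.1 ≤ J.1) (hne : I ≠ J) :
    ∫ θ, haar δ I θ * haar δ J θ = 0 := by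
  rcases h.eq_or_lt with h | h
  · refine integral_mul_haar_eq_zero 0 fun θ hθ => haar_of_notMem fun hI => ?_
    exact hne (eq_of_mem_of_mem h hI hθ)
  · exact integral_mul_haar_eq_zero _ fun θ hθ => haar_eq_on_smaller_arc h hθ

theorem integral_haar_mul_self (I : ArcIndex) : ∫ θ, haar δ I θ * haar δ I θ = 1 := by
  have hl := arcLength_pos I
  have : (fun θ => haar δ I θ * haar δ I θ) =
      (dyadicArc δ I).indicator fun _ => ((arcLength I : ℝ) : ℂ)⁻¹ := by
    ext θ
    by_cases hθ : θ ∈ dyadicArc δ I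
    · rw [indicator_of_mem hθ]
      nth_rewrite 1 [← conj_haar]
      rw [← Complex.normSq_eq_conj_mul_self, Complex.normSq_eq_norm_sq, norm_haar_of_mem hθ,
        inv_pow, Real.sq_sqrt hl.le, Complex.ofReal_inv]
    · rw [indicator_of_notMem hθ, haar_of_notMem hθ, mul_zero]
  rw [this, integral_indicator (measurableSet_dyadicArc I), setIntegral_const,
    volume_real_dyadicArc, Complex.real_smul, mul_inv_cancel₀]
  exact_mod_cast hl.ne'

theorem memLp_of_bounded {g : Torus → ℂ} (hg : Measurable g) {c : ℝ} (hc : ∀ θ, ‖g θ‖ ≤ c) :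
    MemLp g 2 (volume : Measure Torus) :=
  MemLp.of_bound hg.aestronglyMeasurable c (ae_of_all _ hc)

theorem memLp_haar (I : ArcIndex) : MemLp (haar δ I) 2 (volume : Measure Torus) :=
  memLp_of_bounded (measurable_haar I) (norm_haar_le I)

/-- The Haar function as an element of `L²(𝕋)`. -/
def haarL2 (δ : ℝ) (I : ArcIndex) : Lp ℂ 2 (volume : Measure Torus) := (memLp_haar (δ := δ) I).toLp

theorem coeFn_haarL2 (I : ArcIndex) : haarL2 δ I =ᵐ[volume] haar δ I :=
  (memLp_haar (δ := δ) I).coeFn_toLp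

theorem inner_haarL2_of_ae {g : Torus → ℂ} {u : Lp ℂ 2 (volume : Measure Torus)}
    (h : u =ᵐ[volume] g) (I : ArcIndex) :
    inner ℂ (haarL2 δ I) u = ∫ θ, g θ * haar δ I θ := by
  rw [MeasureTheory.L2.inner_def]
  apply integral_congr_ae
  filter_upwards [coeFn_haarL2 (δ := δ) I, h] with θ h1 h2
  rw [h1, h2, RCLike.inner_apply, conj_haar]

theorem orthonormal_haarL2 (δ : ℝ) : Orthonormal ℂ (haarL2 δ) := by
  classical
  rw [orthonormal_iff_ite]
  intro I J
  rw [inner_haarL2_of_ae (coeFn_haarL2 J)]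
  split_ifs with h
  · rw [h, integral_haar_mul_self]
  · rcases le_total I.1 J.1 with h' | h'
    · simp_rw [mul_comm (haar δ J _)]
      exact integral_haar_mul_haar_of_ne h' h
    · exact integral_haar_mul_haar_of_ne h' (Ne.symm h)

theorem lintegral_enorm_sq_of_ae {g : Torus → ℂ} {u : Lp ℂ 2 (volume : Measure Torus)}
    (h : u =ᵐ[volume] g) : ∫⁻ θ, ‖g θ‖ₑ ^ 2 = ENNReal.ofReal (‖u‖ ^ 2) := by
  rw [Lp.norm_def, ← ENNReal.toReal_pow, ENNReal.ofReal_toReal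
    (ENNReal.pow_ne_top (Lp.eLpNorm_ne_top u)), eLpNorm_congr_ae h,
    eLpNorm_eq_lintegral_rpow_enorm_toReal two_ne_zero ENNReal.ofNat_ne_top]
  simp only [ENNReal.toReal_ofNat, ENNReal.rpow_ofNat]
  rw [← ENNReal.rpow_natCast, ← ENNReal.rpow_mul]
  norm_num

/-- Bessel's inequality for the Haar functions. -/
theorem tsum_enorm_sq_haar_le {g : Torus → ℂ}
    (hm : MemLp g 2 (volume : Measure Torus)) :
    ∑' J, ‖∫ θ, g θ * haar δ J θ‖ₑ ^ 2 ≤ ∫⁻ θ, ‖g θ‖ₑ ^ 2 := by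
  rw [lintegral_enorm_sq_of_ae hm.coeFn_toLp, ENNReal.tsum_eq_iSup_sum]
  refine iSup_le fun s => ?_
  have := (orthonormal_haarL2 δ).sum_inner_products_le (x := hm.toLp) (s := s)
  refine le_trans (le_of_eq ?_) (ENNReal.ofReal_le_ofReal this)
  rw [ENNReal.ofReal_sum_of_nonneg fun _ _ => by positivity]
  refine Finset.sum_congr rfl fun J _ => ?_
  rw [inner_haarL2_of_ae hm.coeFn_toLp, ENNReal.ofReal_pow (norm_nonneg _), ofReal_norm]

/-- The term of generation `k` of the Haar series `∑ a_I h_I` at the point `θ`. -/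
def haarTerm (δ : ℝ) (a : ArcIndex → ℂ) (k : ℕ) (θ : Torus) : ℂ :=
  a (cellOf δ k θ) * haar δ (cellOf δ k θ) θ

/-- The sum of the terms of generation less than `N` of the Haar series `∑ a_I h_I`. -/
def haarSum (δ : ℝ) (a : ArcIndex → ℂ) (N : ℕ) (θ : Torus) : ℂ :=
  ∑ k ∈ Finset.range N, haarTerm δ a k θ

/-- The arcs of generation less than `N`. -/
def arcsBelow (N : ℕ) : Finset ArcIndex := (Finset.range N).sigma fun _ => Finset.univ

theorem mem_arcsBelow {N : ℕ} {I : ArcIndex} : I ∈ arcsBelow N ↔ I.1 < N := by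
  simp [arcsBelow]

theorem sum_fin_mul_haar (a : ArcIndex → ℂ) (k : ℕ) (θ : Torus) :
    ∑ m : Fin (2 ^ k), a ⟨k, m⟩ * haar δ ⟨k, m⟩ θ = haarTerm δ a k θ := by
  rw [Finset.sum_eq_single (⟨idx δ k θ, idx_lt k θ⟩ : Fin (2 ^ k))]
  · rfl
  · intro m _ hm
    rw [haar_of_notMem, mul_zero]
    rw [mem_dyadicArc_iff]
    exact fun h => hm (Fin.ext h.symm)
  · simp

theorem sum_arcsBelow_mul_haar (a : ArcIndex → ℂ) (N : ℕ) (θ : Torus) :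
    ∑ I ∈ arcsBelow N, a I * haar δ I θ = haarSum δ a N θ := by
  rw [arcsBelow, Finset.sum_sigma]
  exact Finset.sum_congr rfl fun k _ => sum_fin_mul_haar a k θ

theorem partialSum_eq (F : HaarData) (N : ℕ) (θ : Torus) :
    partialSum δ F N θ = F.mean + haarSum δ F.coeff (N + 1) θ := by
  rw [partialSum, haarSum]
  congr 1
  exact Finset.sum_congr rfl fun k _ => sum_fin_mul_haar F.coeff k θ

theorem measurable_haarSum (a : ArcIndex → ℂ) (N : ℕ) : Measurable (haarSum δ a N) := by
  have : haarSum δ a N = fun θ => ∑ I ∈ arcsBelow N, a I * haar δ I θ := by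
    ext θ; rw [sum_arcsBelow_mul_haar]
  rw [this]
  exact Finset.measurable_sum _ fun I _ => (measurable_haar I).const_mul _

theorem coeFn_sum_haarL2 (a : ArcIndex → ℂ) (N : ℕ) :
    (∑ I ∈ arcsBelow N, a I • haarL2 δ I : Lp ℂ 2 (volume : Measure Torus))
      =ᵐ[volume] haarSum δ a N := by
  refine (Lp.coeFn_finsetSum _ _).trans ?_
  have : ∀ᵐ θ ∂(volume : Measure Torus), ∀ I ∈ arcsBelow N,
      (a I • haarL2 δ I : Lp ℂ 2 (volume : Measure Torus)) θ = a I * haar δ I θ := by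
    rw [Finset.eventually_all]
    intro I _
    filter_upwards [Lp.coeFn_smul (a I) (haarL2 δ I), coeFn_haarL2 (δ := δ) I] with θ h1 h2
    rw [h1, Pi.smul_apply, h2, smul_eq_mul]
  filter_upwards [this] with θ hθ
  rw [← sum_arcsBelow_mul_haar, Finset.sum_apply]
  exact Finset.sum_congr rfl hθ

theorem lintegral_enorm_sq_haarSum (a : ArcIndex → ℂ) (N : ℕ) :
    ∫⁻ θ, ‖haarSum δ a N θ‖ₑ ^ 2 = ∑ I ∈ arcsBelow N, ‖a I‖ₑ ^ 2 := by
  rw [lintegral_enorm_sq_of_ae (coeFn_sum_haarL2 a N)]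
  have h := (orthonormal_haarL2 δ).inner_sum a a (arcsBelow N)
  rw [inner_self_eq_norm_sq_to_K] at h
  have h2 : ‖∑ I ∈ arcsBelow N, a I • haarL2 δ I‖ ^ 2 = ∑ I ∈ arcsBelow N, ‖a I‖ ^ 2 := by
    have h3 : ∀ I, (starRingEnd ℂ) (a I) * a I = ((‖a I‖ ^ 2 : ℝ) : ℂ) := fun I => by
      rw [← Complex.normSq_eq_conj_mul_self, Complex.normSq_eq_norm_sq]
    simp_rw [h3] at h
    apply Complex.ofReal_injective
    push_cast at h ⊢
    exact h
  rw [h2, ENNReal.ofReal_sum_of_nonneg fun _ _ => by positivity]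
  refine Finset.sum_congr rfl fun I _ => ?_
  rw [ENNReal.ofReal_pow (norm_nonneg _), ofReal_norm]

theorem enorm_haarTerm_sq (a : ArcIndex → ℂ) (k : ℕ) (θ : Torus) :
    ‖haarTerm δ a k θ‖ₑ ^ 2 =
      ‖a (cellOf δ k θ)‖ₑ ^ 2 / ENNReal.ofReal (arcLength (cellOf δ k θ)) := by
  have hl := arcLength_pos (cellOf δ k θ)
  rw [haarTerm, enorm_mul, mul_pow, div_eq_mul_inv]
  congr 1
  rw [← ofReal_norm, norm_haar_of_mem (mem_cellOf k θ), ← ENNReal.ofReal_pow (by positivity),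
    inv_pow, Real.sq_sqrt hl.le, ENNReal.ofReal_inv_of_pos hl]

theorem lintegral_comp_cellOf (w : ArcIndex → ℝ≥0∞) (k : ℕ) :
    ∫⁻ θ, w (cellOf δ k θ) =
      ∑ m : Fin (2 ^ k), w ⟨k, m⟩ * ENNReal.ofReal (arcLength ⟨k, m⟩) := by
  have : ∀ θ, w (cellOf δ k θ) =
      ∑ m : Fin (2 ^ k), (dyadicArc δ ⟨k, m⟩).indicator (fun _ => w ⟨k, m⟩) θ := by
    intro θ
    rw [Finset.sum_eq_single (⟨idx δ k θ, idx_lt k θ⟩ : Fin (2 ^ k))]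
    · rw [indicator_of_mem]
      · rfl
      · exact mem_cellOf k θ
    · intro m _ hm
      rw [indicator_of_notMem]
      rw [mem_dyadicArc_iff]
      exact fun h => hm (Fin.ext h.symm)
    · simp
  simp_rw [this]
  rw [lintegral_finsetSum _ fun m _ => measurable_const.indicator (measurableSet_dyadicArc _)]
  refine Finset.sum_congr rfl fun m _ => ?_
  rw [lintegral_indicator_const (measurableSet_dyadicArc _), volume_dyadicArc]

theorem lintegral_enorm_haarTerm_sq (a : ArcIndex → ℂ) (k : ℕ) :
    ∫⁻ θ, ‖haarTerm δ a k θ‖ₑ ^ 2 = ∑ m : Fin (2 ^ k), ‖a ⟨k, m⟩‖ₑ ^ 2 := by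
  simp_rw [enorm_haarTerm_sq]
  rw [lintegral_comp_cellOf fun I => ‖a I‖ₑ ^ 2 / ENNReal.ofReal (arcLength I)]
  refine Finset.sum_congr rfl fun m _ => ?_
  rw [ENNReal.div_mul_cancel]
  · simpa using arcLength_pos _
  · exact ENNReal.ofReal_ne_top

theorem measurable_haarTerm (a : ArcIndex → ℂ) (k : ℕ) : Measurable (haarTerm δ a k) := by
  have : haarTerm δ a k = fun θ => haarSum δ a (k + 1) θ - haarSum δ a k θ := by
    ext θ; simp [haarSum, Finset.sum_range_succ]
  rw [this]
  exact (measurable_haarSum a _).sub (measurable_haarSum a _)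

/-- The square function and the Haar sum have the same norm in `L²`. -/
theorem lintegral_enorm_sq_haarSum_eq (a : ArcIndex → ℂ) (N : ℕ) :
    ∫⁻ θ, ‖haarSum δ a N θ‖ₑ ^ 2 =
      ∫⁻ θ, ∑ k ∈ Finset.range N, ‖haarTerm δ a k θ‖ₑ ^ 2 := by
  rw [lintegral_enorm_sq_haarSum, lintegral_finsetSum _ fun k _ =>
    ((measurable_haarTerm a k).enorm.pow_const 2), arcsBelow, Finset.sum_sigma]
  exact Finset.sum_congr rfl fun k _ => (lintegral_enorm_haarTerm_sq a k).symm

theorem summable_norm_sq_of_bounded {a : ArcIndex → ℂ} {c : ℝ}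
    (hc : ∀ N θ, ‖haarSum δ a N θ‖ ≤ c) : Summable fun I => ‖a I‖ ^ 2 := by
  apply summable_of_sum_le (c := 2 * Real.pi * c ^ 2) (fun _ => by positivity)
  intro s
  obtain ⟨N, hN⟩ : ∃ N, s ⊆ arcsBelow N := by
    refine ⟨s.sup (fun I => I.1) + 1, fun I hI => mem_arcsBelow.2 ?_⟩
    exact Nat.lt_succ_of_le (Finset.le_sup (f := fun I : ArcIndex => I.1) hI)
  refine (Finset.sum_le_sum_of_subset_of_nonneg hN fun _ _ _ => by positivity).trans ?_
  rw [← ENNReal.ofReal_le_ofReal_iff (by have := Real.pi_pos; positivity),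
    ENNReal.ofReal_sum_of_nonneg fun _ _ => by positivity]
  have e : ∀ I, ENNReal.ofReal (‖a I‖ ^ 2) = ‖a I‖ₑ ^ 2 := fun I => by
    rw [ENNReal.ofReal_pow (norm_nonneg _), ofReal_norm]
  simp_rw [e]
  rw [← lintegral_enorm_sq_haarSum (δ := δ)]
  calc _ ≤ ∫⁻ _ : Torus, ENNReal.ofReal (c ^ 2) := by
        refine lintegral_mono fun θ => ?_
        have h0 := norm_nonneg (haarSum δ a N θ)
        rw [← ofReal_norm, ← ENNReal.ofReal_pow h0]
        exact ENNReal.ofReal_le_ofReal (pow_le_pow_left₀ h0 (hc N θ) 2)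
    _ = _ := by
        rw [lintegral_const, volume_univ_torus, mul_comm, ← ENNReal.ofReal_mul]
        have := Real.pi_pos
        positivity

theorem tendsto_arcsBelow : Tendsto arcsBelow atTop atTop := by
  apply tendsto_atTop_finset_of_monotone
  · intro M N h I hI
    rw [mem_arcsBelow] at hI ⊢
    omega
  · exact fun I => ⟨I.1 + 1, mem_arcsBelow.2 (Nat.lt_succ_self _)⟩

/-- A bounded dyadic martingale is closed by a bounded function: the Haar series converges in
`L²`, and a subsequence of its partial sums converges almost everywhere. -/
theorem exists_bounded_of_haarSum_bounded {a : ArcIndex → ℂ} {c : ℝ}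
    (hc : ∀ N θ, ‖haarSum δ a N θ‖ ≤ c) :
    ∃ β : Torus → ℂ, Measurable β ∧ (∀ θ, ‖β θ‖ ≤ c) ∧
      (∀ J, ∫ θ, β θ * haar δ J θ = a J) ∧ ∫ θ, β θ = 0 := by
  have hc0 : 0 ≤ c := (norm_nonneg _).trans (hc 0 (arcPoint δ ⟨0, 0⟩))
  have hon := orthonormal_haarL2 δ
  have hsum : Summable fun I => a I • haarL2 δ I := by
    have := (hon.orthogonalFamily.summable_iff_norm_sq_summable a).2
      (summable_norm_sq_of_bounded hc)
    simpa using this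
  obtain ⟨u, hu⟩ := hsum
  have hlim : Tendsto (fun N => ∑ I ∈ arcsBelow N, a I • haarL2 δ I) atTop (𝓝 u) :=
    hu.comp tendsto_arcsBelow
  have hcoef : ∀ J, inner ℂ (haarL2 δ J) u = a J := by
    intro J
    have h1 := hu.mapL (innerSL ℂ (haarL2 δ J))
    have h2 : HasSum (fun I => innerSL ℂ (haarL2 δ J) (a I • haarL2 δ I)) (a J) := by
      classical
      have h3 : ∀ I, innerSL ℂ (haarL2 δ J) (a I • haarL2 δ I) = if I = J then a J else 0 := by
        intro I
        rw [innerSL_apply_apply, inner_smul_right, orthonormal_iff_ite.1 hon J I]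
        by_cases h : I = J
        · simp [h]
        · simp [h, Ne.symm h]
      simp_rw [h3]
      exact hasSum_ite_eq J (a J)
    exact h1.unique h2
  have hmean : ∫ θ, u θ = 0 := by
    have hone : MemLp (fun _ : Torus => (1 : ℂ)) 2 (volume : Measure Torus) := memLp_const 1
    have e : ∀ v : Lp ℂ 2 (volume : Measure Torus), inner ℂ hone.toLp v = ∫ θ, v θ := by
      intro v
      rw [MeasureTheory.L2.inner_def]
      apply integral_congr_ae
      filter_upwards [hone.coeFn_toLp] with θ h1
      rw [h1]
      simp
    have h1 := hu.mapL (innerSL ℂ hone.toLp)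
    have h2 : ∀ I, innerSL ℂ hone.toLp (a I • haarL2 δ I) = 0 := by
      intro I
      rw [innerSL_apply_apply, inner_smul_right, e,
        integral_congr_ae (coeFn_haarL2 I), integral_haar, mul_zero]
    simp_rw [h2] at h1
    rw [← e]
    exact h1.unique hasSum_zero
  have hbound : ∀ᵐ θ ∂(volume : Measure Torus), ‖u θ‖ ≤ c := by
    have h1 := Lp.tendsto_Lp_iff_tendsto_eLpNorm' (fi := atTop)
      (fun N => ∑ I ∈ arcsBelow N, a I • haarL2 δ I) u
    have h2 := tendstoInMeasure_of_tendsto_eLpNorm (p := 2) two_ne_zero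
      (fun N => Lp.aestronglyMeasurable _) (Lp.aestronglyMeasurable u) (h1.1 hlim)
    obtain ⟨ns, -, hns⟩ := h2.exists_seq_tendsto_ae
    have h3 : ∀ᵐ θ ∂(volume : Measure Torus), ∀ N,
        (∑ I ∈ arcsBelow N, a I • haarL2 δ I : Lp ℂ 2 (volume : Measure Torus)) θ =
          haarSum δ a N θ := ae_all_iff.2 fun N => coeFn_sum_haarL2 a N
    filter_upwards [hns, h3] with θ h4 h5
    refine le_of_tendsto h4.norm (Eventually.of_forall fun N => ?_)
    rw [h5]
    exact hc _ _
  obtain ⟨v, hv, huv⟩ := (Lp.aestronglyMeasurable u)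
  have hvm : Measurable v := hv.measurable
  classical
  have hae : (u : Torus → ℂ) =ᵐ[volume] fun θ => if ‖v θ‖ ≤ c then v θ else 0 := by
    filter_upwards [huv, hbound] with θ h1 h2
    rw [h1] at h2
    rw [if_pos h2, h1]
  refine ⟨fun θ => if ‖v θ‖ ≤ c then v θ else 0,
    Measurable.ite (measurableSet_le hvm.norm measurable_const) hvm measurable_const, ?_, ?_, ?_⟩
  · intro θ
    dsimp only
    split_ifs with h
    · exact h
    · simpa using hc0
  · intro J
    rw [← hcoef J, inner_haarL2_of_ae hae]
  · rw [← integral_congr_ae hae, hmean]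

/-! ### Blocks and their Haar coefficients -/


theorem ENNReal_tsum_mul_le {ι : Type*} (x y : ι → ℝ≥0∞) :
    ∑' i, x i * y i ≤ (∑' i, x i ^ 2) ^ (1 / 2 : ℝ) * (∑' i, y i ^ 2) ^ (1 / 2 : ℝ) := by
  rw [ENNReal.tsum_eq_iSup_sum]
  refine iSup_le fun s => ?_
  refine (ENNReal.inner_le_Lp_mul_Lq s x y Real.HolderConjugate.two_two).trans ?_
  simp only [ENNReal.rpow_two]
  gcongr
  · exact ENNReal.sum_le_tsum s
  · exact ENNReal.sum_le_tsum s

theorem ENNReal_sqrt_mul_self (x : ℝ≥0∞) : x ^ (1 / 2 : ℝ) * x ^ (1 / 2 : ℝ) = x := by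
  rw [← ENNReal.rpow_add_of_nonneg _ _ (by norm_num) (by norm_num)]
  norm_num

theorem ENNReal_sqrt_sq (x : ℝ≥0∞) : (x ^ (1 / 2 : ℝ)) ^ 2 = x := by
  rw [sq, ENNReal_sqrt_mul_self]

theorem ENNReal_sq_sqrt (x : ℝ≥0∞) : (x ^ 2) ^ (1 / 2 : ℝ) = x := by
  rw [← ENNReal.rpow_natCast, ← ENNReal.rpow_mul]
  norm_num

/-- Minkowski's inequality for a series of sequences in `ℓ²`. -/
theorem ENNReal_sqrt_tsum_sq_tsum_le {ι κ : Type*} (x : κ → ι → ℝ≥0∞) :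
    (∑' n, (∑' k, x k n) ^ 2) ^ (1 / 2 : ℝ) ≤ ∑' k, (∑' n, x k n ^ 2) ^ (1 / 2 : ℝ) := by
  have h : ∑' n, (∑' k, x k n) ^ 2 ≤ (∑' k, (∑' n, x k n ^ 2) ^ (1 / 2 : ℝ)) ^ 2 := by
    calc ∑' n, (∑' k, x k n) ^ 2 = ∑' n, ∑' k, ∑' j, x k n * x j n := by
          congr 1; ext n
          rw [sq, ← ENNReal.tsum_mul_right]
          simp_rw [ENNReal.tsum_mul_left]
      _ = ∑' k, ∑' j, ∑' n, x k n * x j n := by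
          rw [ENNReal.tsum_comm]
          congr 1; ext k
          rw [ENNReal.tsum_comm]
      _ ≤ ∑' k, ∑' j, (∑' n, x k n ^ 2) ^ (1 / 2 : ℝ) * (∑' n, x j n ^ 2) ^ (1 / 2 : ℝ) :=
          ENNReal.tsum_le_tsum fun k => ENNReal.tsum_le_tsum fun j => ENNReal_tsum_mul_le _ _
      _ = _ := by
          rw [sq, ← ENNReal.tsum_mul_right]
          simp_rw [ENNReal.tsum_mul_left]
  calc _ ≤ ((∑' k, (∑' n, x k n ^ 2) ^ (1 / 2 : ℝ)) ^ 2) ^ (1 / 2 : ℝ) := by gcongr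
    _ = _ := ENNReal_sq_sqrt _

theorem summable_of_tsum_enorm_ne_top {ι : Type*} {x : ι → ℂ} (h : ∑' i, ‖x i‖ₑ ≠ ⊤) :
    Summable x := by
  simp only [enorm_eq_nnnorm, ENNReal.tsum_coe_ne_top_iff_summable] at h
  exact Summable.of_norm (by simpa using NNReal.summable_coe.2 h)

/-- A function `β` with mean zero that vanishes off the arc `I` and is essentially bounded by `b`.
These are the multiples of atoms, without the normalization of the latter. -/
structure IsBlock (δ : ℝ) (I : ArcIndex) (β : Torus → ℂ) (b : ℝ) : Prop where
  measurable : Measurable β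
  nonneg : 0 ≤ b
  bound : ∀ᵐ θ ∂(volume : Measure Torus), ‖β θ‖ ≤ b
  eq_zero : ∀ θ ∉ dyadicArc δ I, β θ = 0
  integral : ∫ θ, β θ = 0

/-- A bounded function that is Lipschitz along the arcs of the dyadic system: its oscillation on
an arc `I` is at most `L |I|`. -/
structure IsDyadicLipschitz (δ : ℝ) (φ : Torus → ℂ) (L A : ℝ) : Prop where
  measurable : Measurable φ
  nonneg : 0 ≤ L
  bound : ∀ θ, ‖φ θ‖ ≤ A
  osc : ∀ (I : ArcIndex), ∀ θ ∈ dyadicArc δ I, ∀ θ' ∈ dyadicArc δ I,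
    ‖φ θ - φ θ'‖ ≤ L * arcLength I

theorem lintegral_enorm_sq_le_of_support {g : Torus → ℂ} {I : ArcIndex} {b : ℝ}
    (hb : 0 ≤ b) (hg : ∀ᵐ θ ∂(volume : Measure Torus), ‖g θ‖ ≤ b)
    (h0 : ∀ θ ∉ dyadicArc δ I, g θ = 0) :
    ∫⁻ θ, ‖g θ‖ₑ ^ 2 ≤ ENNReal.ofReal (b ^ 2 * arcLength I) := by
  calc ∫⁻ θ, ‖g θ‖ₑ ^ 2
      ≤ ∫⁻ θ, (dyadicArc δ I).indicator (fun _ => ENNReal.ofReal (b ^ 2)) θ := by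
        apply lintegral_mono_ae
        filter_upwards [hg] with θ hθ
        by_cases hI : θ ∈ dyadicArc δ I
        · rw [indicator_of_mem hI, ENNReal.ofReal_pow hb, ← ofReal_norm]
          gcongr
        · simp [h0 θ hI]
    _ = _ := by
        rw [lintegral_indicator_const (measurableSet_dyadicArc I), volume_dyadicArc,
          ENNReal.ofReal_mul (sq_nonneg b)]

theorem dyadicArc_subset_of_mem {I J : ArcIndex} (h : I.1 ≤ J.1)
    (hm : arcPoint δ J ∈ dyadicArc δ I) : dyadicArc δ J ⊆ dyadicArc δ I := by
  intro θ hθ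
  rw [mem_dyadicArc_iff] at hm ⊢
  rw [← hm]
  apply idx_eq_of_le h
  rw [mem_dyadicArc_iff.1 hθ, mem_dyadicArc_iff.1 (arcPoint_mem J)]

theorem disjoint_of_notMem {I J : ArcIndex} (h : I.1 ≤ J.1)
    (hm : arcPoint δ J ∉ dyadicArc δ I) : ∀ θ ∈ dyadicArc δ J, θ ∉ dyadicArc δ I := by
  intro θ hθ hI
  apply hm
  rw [mem_dyadicArc_iff] at hI ⊢
  rw [← hI]
  apply idx_eq_of_le h
  rw [mem_dyadicArc_iff.1 hθ, mem_dyadicArc_iff.1 (arcPoint_mem J)]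

namespace IsBlock

variable {I : ArcIndex} {β : Torus → ℂ} {b : ℝ}

theorem memLp (h : IsBlock δ I β b) : MemLp β 2 (volume : Measure Torus) :=
  MemLp.of_bound h.measurable.aestronglyMeasurable b h.bound

theorem integrable (h : IsBlock δ I β b) : Integrable β (volume : Measure Torus) :=
  Integrable.of_bound h.measurable.aestronglyMeasurable b h.bound

theorem integrable_mul (h : IsBlock δ I β b) {φ : Torus → ℂ} (hφ : Measurable φ) {A : ℝ}
    (hA : ∀ θ, ‖φ θ‖ ≤ A) : Integrable (fun θ => β θ * φ θ) (volume : Measure Torus) :=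
  h.integrable.mul_bdd hφ.aestronglyMeasurable (ae_of_all _ hA)

theorem coeff_eq_zero_of_lt (h : IsBlock δ I β b) {J : ArcIndex} (hJ : J.1 < I.1) :
    ∫ θ, β θ * haar δ J θ = 0 := by
  have : (fun θ => β θ * haar δ J θ) = fun θ => β θ * haar δ J (arcPoint δ I) := by
    ext θ
    by_cases hθ : θ ∈ dyadicArc δ I
    · rw [haar_eq_on_smaller_arc hJ hθ]
    · simp [h.eq_zero θ hθ]
  rw [this, integral_mul_const, h.integral, zero_mul]

theorem coeff_eq_zero_or_subset (h : IsBlock δ I β b) (J : ArcIndex) :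
    ∫ θ, β θ * haar δ J θ = 0 ∨ (I.1 ≤ J.1 ∧ dyadicArc δ J ⊆ dyadicArc δ I) := by
  rcases lt_or_ge J.1 I.1 with hJ | hJ
  · exact Or.inl (h.coeff_eq_zero_of_lt hJ)
  by_cases hm : arcPoint δ J ∈ dyadicArc δ I
  · exact Or.inr ⟨hJ, dyadicArc_subset_of_mem hJ hm⟩
  · exact Or.inl (integral_mul_haar_eq_zero 0 fun θ hθ => h.eq_zero θ (disjoint_of_notMem hJ hm θ hθ))

theorem norm_integral_mul_le (h : IsBlock δ I β b) {g : Torus → ℂ} {B : ℝ}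
    (hg : ∀ θ ∈ dyadicArc δ I, ‖g θ‖ ≤ B) :
    ‖∫ θ, β θ * g θ‖ ≤ b * B * arcLength I := by
  have e : ∫ θ, β θ * g θ = ∫ θ in dyadicArc δ I, β θ * g θ := by
    rw [setIntegral_eq_integral_of_forall_compl_eq_zero]
    intro θ hθ
    rw [h.eq_zero θ hθ, zero_mul]
  have hB : 0 ≤ B := (norm_nonneg _).trans (hg _ (arcPoint_mem I))
  rw [e, ← volume_real_dyadicArc (δ := δ)]
  apply norm_setIntegral_le_of_norm_le_const_ae
  · rw [volume_dyadicArc]; exact ENNReal.ofReal_lt_top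
  · rw [ae_restrict_iff' (measurableSet_dyadicArc I)]
    filter_upwards [h.bound] with θ h1 h2
    rw [norm_mul]
    exact mul_le_mul h1 (hg θ h2) (norm_nonneg _) h.nonneg

theorem norm_coeff_le (h : IsBlock δ I β b) (J : ArcIndex) :
    ‖∫ θ, β θ * haar δ J θ‖ ≤ b * (Real.sqrt (arcLength J))⁻¹ * arcLength I :=
  h.norm_integral_mul_le fun θ _ => norm_haar_le J θ

theorem tsum_coeff_sq_le (h : IsBlock δ I β b) :
    ∑' J, ‖∫ θ, β θ * haar δ J θ‖ₑ ^ 2 ≤ ENNReal.ofReal (b ^ 2 * arcLength I) :=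
  (tsum_enorm_sq_haar_le h.memLp).trans
    (lintegral_enorm_sq_le_of_support h.nonneg h.bound h.eq_zero)

/-- The mean zero condition gains a factor `|I|` over the trivial bound. -/
theorem norm_pairing_le (h : IsBlock δ I β b) {φ : Torus → ℂ} {L A : ℝ}
    (hφ : IsDyadicLipschitz δ φ L A) :
    ‖∫ θ, β θ * φ θ‖ ≤ b * L * arcLength I ^ 2 := by
  have e : ∫ θ, β θ * φ θ = ∫ θ, β θ * (φ θ - φ (arcPoint δ I)) := by
    simp_rw [mul_sub]
    rw [integral_sub (h.integrable_mul hφ.measurable hφ.bound) (h.integrable.mul_const _),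
      integral_mul_const, h.integral, zero_mul, sub_zero]
  rw [e]
  refine (h.norm_integral_mul_le fun θ hθ => hφ.osc I θ hθ _ (arcPoint_mem I)).trans (le_of_eq ?_)
  ring

/-- The Haar expansion of the pairing of a block with a Lipschitz function converges absolutely:
Bessel's inequality for the block and for the function minus a constant on the arc. -/
theorem tsum_coeff_mul_le (h : IsBlock δ I β b) {φ : Torus → ℂ} {L A : ℝ}
    (hφ : IsDyadicLipschitz δ φ L A) :
    ∑' J, ‖(∫ θ, β θ * haar δ J θ) * ∫ θ, φ θ * haar δ J θ‖ₑ ≤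
      ENNReal.ofReal (b * L * arcLength I ^ 2) := by
  have hl := arcLength_pos I
  set g : Torus → ℂ := (dyadicArc δ I).indicator fun θ => φ θ - φ (arcPoint δ I) with hg
  have hgm : Measurable g :=
    (hφ.measurable.sub measurable_const).indicator (measurableSet_dyadicArc I)
  have hgb : ∀ θ, ‖g θ‖ ≤ L * arcLength I := by
    intro θ
    by_cases hθ : θ ∈ dyadicArc δ I
    · rw [hg, indicator_of_mem hθ]
      exact hφ.osc I θ hθ _ (arcPoint_mem I)
    · rw [hg, indicator_of_notMem hθ, norm_zero]
      exact mul_nonneg hφ.nonneg hl.le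
  have hφi : Integrable φ (volume : Measure Torus) :=
    integrable_of_bounded hφ.measurable.aestronglyMeasurable hφ.bound
  have e : ∀ J, (∫ θ, β θ * haar δ J θ) * ∫ θ, φ θ * haar δ J θ =
      (∫ θ, β θ * haar δ J θ) * ∫ θ, g θ * haar δ J θ := by
    intro J
    rcases h.coeff_eq_zero_or_subset J with h0 | ⟨-, hs⟩
    · rw [h0, zero_mul, zero_mul]
    · congr 1
      have e1 : (fun θ => g θ * haar δ J θ) =
          fun θ => φ θ * haar δ J θ - φ (arcPoint δ I) * haar δ J θ := by
        ext θ
        by_cases hθ : θ ∈ dyadicArc δ J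
        · rw [hg, indicator_of_mem (hs hθ), sub_mul]
        · simp [haar_of_notMem hθ]
      rw [e1, integral_sub (hφi.mul_bdd (measurable_haar J).aestronglyMeasurable
        (ae_of_all _ (norm_haar_le J))) ((integrable_haar J).const_mul _), integral_const_mul,
        integral_haar, mul_zero, sub_zero]
  simp_rw [e, enorm_mul]
  refine (ENNReal_tsum_mul_le _ _).trans ?_
  have h1 := h.tsum_coeff_sq_le
  have h2 : ∑' J, ‖∫ θ, g θ * haar δ J θ‖ₑ ^ 2 ≤
      ENNReal.ofReal ((L * arcLength I) ^ 2 * arcLength I) :=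
    (tsum_enorm_sq_haar_le (memLp_of_bounded hgm hgb)).trans
      (lintegral_enorm_sq_le_of_support (I := I) (mul_nonneg hφ.nonneg hl.le) (ae_of_all _ hgb)
        fun θ hθ => by rw [hg, indicator_of_notMem hθ])
  calc _ ≤ (ENNReal.ofReal (b ^ 2 * arcLength I)) ^ (1 / 2 : ℝ) *
        (ENNReal.ofReal ((L * arcLength I) ^ 2 * arcLength I)) ^ (1 / 2 : ℝ) := by gcongr
    _ = _ := by
      have hb := h.nonneg
      have hL := hφ.nonneg
      rw [← ENNReal.mul_rpow_of_nonneg _ _ (by norm_num), ← ENNReal.ofReal_mul (by positivity)]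
      have : b ^ 2 * arcLength I * ((L * arcLength I) ^ 2 * arcLength I) =
          (b * L * arcLength I ^ 2) ^ 2 := by ring
      rw [this, ENNReal.ofReal_pow (by positivity), ENNReal_sq_sqrt]

theorem hasSum_coeff_mul (h : IsBlock δ I β b) {φ : Torus → ℂ} {L A : ℝ}
    (hφ : IsDyadicLipschitz δ φ L A) :
    HasSum (fun J => (∫ θ, β θ * haar δ J θ) * ∫ θ, φ θ * haar δ J θ) (∫ θ, β θ * φ θ) := by
  have hsum : Summable fun J => (∫ θ, β θ * haar δ J θ) * ∫ θ, φ θ * haar δ J θ :=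
    summable_of_tsum_enorm_ne_top
      (ne_top_of_le_ne_top ENNReal.ofReal_ne_top (h.tsum_coeff_mul_le hφ))
  have hφi : Integrable φ (volume : Measure Torus) :=
    integrable_of_bounded hφ.measurable.aestronglyMeasurable hφ.bound
  have hlim := hsum.hasSum.comp tendsto_arcsBelow
  suffices hs : Tendsto ((fun s => ∑ J ∈ s, (∫ θ, β θ * haar δ J θ) * ∫ θ, φ θ * haar δ J θ) ∘
      arcsBelow) atTop (𝓝 (∫ θ, β θ * φ θ)) by
    rw [← tendsto_nhds_unique hlim hs]
    exact hsum.hasSum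
  -- The partial sums pair `β` with the averages of `φ` over arcs, which converge uniformly.
  set a : ArcIndex → ℂ := fun J => ∫ θ, φ θ * haar δ J θ with ha
  set c : ℂ := ((2 * Real.pi : ℝ) : ℂ)⁻¹ * ∫ x, φ x with hc
  have hunif : ∀ N θ, ‖φ θ - (c + haarSum δ a N θ)‖ ≤ L * (2 * Real.pi / 2 ^ N) := by
    intro N θ
    have hl := arcLength_pos (cellOf δ N θ)
    have h1 : c + haarSum δ a N θ = _ := (average_eq_sum_haar hφi N θ).symm
    have h2 : φ θ - (c + haarSum δ a N θ) = ((arcLength (cellOf δ N θ) : ℝ) : ℂ)⁻¹ *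
        ∫ x in dyadicArc δ (cellOf δ N θ), (φ θ - φ x) := by
      rw [h1, integral_sub (integrable_const _) hφi.integrableOn, setIntegral_const,
        volume_real_dyadicArc, Complex.real_smul, mul_sub, inv_mul_cancel_left₀]
      exact_mod_cast hl.ne'
    rw [h2, norm_mul, norm_inv, Complex.norm_real, Real.norm_of_nonneg hl.le,
      inv_mul_le_iff₀ hl, mul_comm (arcLength _)]
    rw [← volume_real_dyadicArc (δ := δ) (cellOf δ N θ)]
    apply norm_setIntegral_le_of_norm_le_const
    · rw [volume_dyadicArc]; exact ENNReal.ofReal_lt_top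
    · intro x hx
      exact hφ.osc (cellOf δ N θ) θ (mem_cellOf N θ) x hx
  have hpart : ∀ N, ∑ J ∈ arcsBelow N, (∫ θ, β θ * haar δ J θ) * a J =
      ∫ θ, β θ * (c + haarSum δ a N θ) := by
    intro N
    have e1 : (fun θ => β θ * (c + haarSum δ a N θ)) =
        fun θ => β θ * c + ∑ J ∈ arcsBelow N, β θ * haar δ J θ * a J := by
      ext θ
      rw [← sum_arcsBelow_mul_haar, mul_add, Finset.mul_sum]
      congr 1
      exact Finset.sum_congr rfl fun J _ => by ring
    have hi : ∀ J ∈ arcsBelow N, Integrable (fun θ => β θ * haar δ J θ * a J) volume :=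
      fun J _ => (h.integrable_mul (measurable_haar J) (norm_haar_le J)).mul_const _
    rw [e1, integral_add (h.integrable.mul_const _) (integrable_finsetSum _ hi),
      integral_mul_const, h.integral, zero_mul, zero_add, integral_finsetSum _ hi]
    exact Finset.sum_congr rfl fun J _ => (integral_mul_const _ _).symm
  have hgoal : Tendsto (fun N : ℕ => b * (L * (2 * Real.pi / 2 ^ N)) * arcLength I) atTop (𝓝 0) := by
    have h1 : Tendsto (fun N : ℕ => (2 * Real.pi / 2 ^ N : ℝ)) atTop (𝓝 0) :=
      tendsto_const_nhds.div_atTop (tendsto_pow_atTop_atTop_of_one_lt one_lt_two)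
    simpa using ((h1.const_mul L).const_mul b).mul_const (arcLength I)
  rw [tendsto_iff_norm_sub_tendsto_zero]
  refine squeeze_zero (fun _ => norm_nonneg _) (fun N => ?_) hgoal
  have hbd : ∀ θ, ‖c + haarSum δ a N θ‖ ≤ A + L * (2 * Real.pi / 2 ^ N) := by
    intro θ
    have h1 := norm_sub_norm_le (c + haarSum δ a N θ) (φ θ)
    rw [norm_sub_rev] at h1
    linarith [hunif N θ, hφ.bound θ]
  simp only [Function.comp_apply]
  have hi : Integrable (fun θ => β θ * (c + haarSum δ a N θ)) volume :=
    h.integrable_mul (measurable_const.add (measurable_haarSum a N)) hbd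
  rw [hpart, norm_sub_rev, ← integral_sub (h.integrable_mul hφ.measurable hφ.bound) hi]
  simp_rw [← mul_sub]
  exact h.norm_integral_mul_le fun θ _ => hunif N θ

end IsBlock

/-! ### Families of blocks and the distributions they define -/


theorem continuous_testFunction (φ : testFunctions) : Continuous φ.1 := by
  have h : ContDiff ℝ ∞ fun x : ℝ => φ.1 (x : Torus) := φ.2
  exact (QuotientAddGroup.isQuotientMap_mk _).continuous_iff.2 h.continuous

theorem periodic_testFunction (φ : testFunctions) :
    Function.Periodic (fun x : ℝ => φ.1 (x : Torus)) (2 * Real.pi) := by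
  intro x
  simp only [AddCircle.coe_add_period]

theorem exists_bound_testFunction (φ : testFunctions) :
    ∃ B : ℝ, ∀ j ≤ 1, ∀ x : ℝ, ‖iteratedDeriv j (fun y : ℝ => φ.1 (y : Torus)) x‖ ≤ B := by
  have h : ContDiff ℝ ∞ fun x : ℝ => φ.1 (x : Torus) := φ.2
  have hp := periodic_testFunction φ
  have hpi := Real.two_pi_pos
  have hp' : Function.Periodic (deriv fun x : ℝ => φ.1 (x : Torus)) (2 * Real.pi) := by
    intro x
    rw [← deriv_comp_add_const]
    congr 1
    ext y
    exact hp y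
  have hb : ∀ g : ℝ → ℂ, Continuous g → Function.Periodic g (2 * Real.pi) →
      ∃ B, ∀ x, ‖g x‖ ≤ B := by
    intro g hg hgp
    obtain ⟨B, hB⟩ := (hgp.isBounded_of_continuous hpi.ne' hg).exists_norm_le
    exact ⟨B, fun x => hB _ (mem_range_self x)⟩
  obtain ⟨B0, hB0⟩ := hb _ h.continuous hp
  obtain ⟨B1, hB1⟩ := hb _ (h.continuous_deriv (by simp)) hp'
  refine ⟨max B0 B1, fun j hj x => ?_⟩
  interval_cases j
  · rw [iteratedDeriv_zero]
    exact (hB0 x).trans (le_max_left _ _)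
  · rw [iteratedDeriv_one]
    exact (hB1 x).trans (le_max_right _ _)

theorem exists_real_of_mem {I : ArcIndex} {θ θ' : Torus} (hθ : θ ∈ dyadicArc δ I)
    (hθ' : θ' ∈ dyadicArc δ I) :
    ∃ x y : ℝ, (x : Torus) = θ ∧ (y : Torus) = θ' ∧ |x - y| ≤ arcLength I := by
  obtain ⟨x, hx, rfl⟩ := hθ
  obtain ⟨y, hy, rfl⟩ := hθ'
  have e : arcLength I = 2 * Real.pi * (((I.2 : ℕ) + 1 : ℝ) / 2 ^ I.1 + δ) -
      2 * Real.pi * (((I.2 : ℕ) : ℝ) / 2 ^ I.1 + δ) := by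
    rw [arcLength]; field_simp; ring
  refine ⟨x, y, rfl, rfl, ?_⟩
  rw [e, abs_le]
  constructor <;> linarith [hx.1, hx.2, hy.1, hy.2]

theorem isDyadicLipschitz_testFunction (δ : ℝ) (φ : testFunctions) {B : ℝ}
    (hB : ∀ j ≤ 1, ∀ x : ℝ, ‖iteratedDeriv j (fun y : ℝ => φ.1 (y : Torus)) x‖ ≤ B) :
    IsDyadicLipschitz δ φ.1 B B := by
  have h : ContDiff ℝ ∞ fun x : ℝ => φ.1 (x : Torus) := φ.2
  have hB0 : 0 ≤ B := (norm_nonneg _).trans (hB 0 zero_le_one 0)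
  refine ⟨(continuous_testFunction φ).measurable, hB0, ?_, ?_⟩
  · intro θ
    obtain ⟨x, rfl⟩ := QuotientAddGroup.mk_surjective θ
    simpa using hB 0 zero_le_one x
  · intro I θ hθ θ' hθ'
    obtain ⟨x, y, rfl, rfl, hxy⟩ := exists_real_of_mem hθ hθ'
    have h1 := Convex.norm_image_sub_le_of_norm_deriv_le (s := univ) (x := y) (y := x) (C := B)
      (fun z _ => (h.differentiable (by simp)) z)
      (fun z _ => by simpa [iteratedDeriv_one] using hB 1 le_rfl z) convex_univ (mem_univ _)
      (mem_univ _)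
    exact h1.trans (mul_le_mul_of_nonneg_left hxy hB0)

/-- A sequence of blocks `β k` on the arcs `I k` with `∑ |I k| Ψ(b k) < ∞`. -/
structure IsBlockFamily (δ : ℝ) (I : ℕ → ArcIndex) (β : ℕ → Torus → ℂ) (b : ℕ → ℝ) : Prop where
  block : ∀ k, IsBlock δ (I k) (β k) (b k)
  sum : ∑' k, ENNReal.ofReal (arcLength (I k)) * Psi (ENNReal.ofReal (b k)) ≠ ⊤

/-- The Haar data of the sum of a family of blocks and the constant `c`. -/
def blockData (δ : ℝ) (c : ℂ) (β : ℕ → Torus → ℂ) : HaarData :=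
  ⟨c, fun J => ∑' k, ∫ θ, β k θ * haar δ J θ⟩

theorem arcLength_mul_le (I : ArcIndex) : arcLength I * (I.1 + 1) ≤ 2 * Real.pi := by
  have hpi := Real.pi_pos
  have h : (I.1 : ℝ) + 1 ≤ 2 ^ I.1 := by exact_mod_cast Nat.lt_two_pow_self (n := I.1)
  rw [arcLength, div_mul_eq_mul_div, div_le_iff₀ (by positivity)]
  gcongr

namespace IsBlockFamily

variable {I : ℕ → ArcIndex} {β : ℕ → Torus → ℂ} {b : ℕ → ℝ}

/-- The logarithm in `Ψ₀` costs at most a factor comparable to the generation of the arc. -/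
theorem summable_div (h : IsBlockFamily δ I β b) :
    Summable fun k => b k * arcLength (I k) / ((I k).1 + 1) := by
  have hpi := Real.pi_pos
  have hb := fun k => (h.block k).nonneg
  have hl := fun k => arcLength_pos (I k)
  have hterm : ∀ k, (ENNReal.ofReal (arcLength (I k)) * Psi (ENNReal.ofReal (b k))).toReal =
      arcLength (I k) * Psi0 (b k) := fun k => by
    rw [Psi_ofReal (hb k), ← ENNReal.ofReal_mul (hl k).le,
      ENNReal.toReal_ofReal (mul_nonneg (hl k).le (Psi0_nonneg (hb k)))]
  have hs : Summable fun k => arcLength (I k) * Psi0 (b k) := by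
    have := ENNReal.summable_toReal h.sum
    simpa only [hterm] using this
  set E := (∑' k, arcLength (I k) * Psi0 (b k)) / (2 * Real.pi) with hE
  have hle : ∀ k, Psi0 (b k) ≤ E * 2 ^ (I k).1 := by
    intro k
    have h1 := hs.le_tsum k fun j _ => mul_nonneg (hl j).le (Psi0_nonneg (hb j))
    rw [hE, div_mul_eq_mul_div, le_div_iff₀ (by positivity)]
    unfold arcLength at h1
    rw [div_mul_eq_mul_div, div_le_iff₀ (by positivity)] at h1
    unfold arcLength
    linarith
  refine Summable.of_nonneg_of_le
    (fun k => div_nonneg (mul_nonneg (hb k) (hl k).le) (by positivity)) (fun k => ?_)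
    (hs.mul_left (Real.log (4 + 16 * E ^ 2) + 2))
  have h1 := le_mul_Psi0_of_le (hb k) (hle k)
  rw [div_le_iff₀ (by positivity)]
  calc b k * arcLength (I k) ≤ _ := mul_le_mul_of_nonneg_right h1 (hl k).le
    _ = _ := by ring

theorem summable_mul_arcLength_sq (h : IsBlockFamily δ I β b) :
    Summable fun k => b k * arcLength (I k) ^ 2 := by
  refine Summable.of_nonneg_of_le
    (fun k => mul_nonneg (h.block k).nonneg (sq_nonneg _)) (fun k => ?_)
    (h.summable_div.mul_left (2 * Real.pi))
  have h1 := arcLength_mul_le (I k)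
  rw [mul_div_assoc', le_div_iff₀ (by positivity)]
  nlinarith [mul_nonneg (h.block k).nonneg (arcLength_pos (I k)).le]

theorem summable_pairing (h : IsBlockFamily δ I β b) {φ : Torus → ℂ} {L A : ℝ}
    (hφ : IsDyadicLipschitz δ φ L A) : Summable fun k => ∫ θ, β k θ * φ θ := by
  refine Summable.of_norm_bounded (h.summable_mul_arcLength_sq.mul_left L) fun k => ?_
  refine ((h.block k).norm_pairing_le hφ).trans (le_of_eq ?_)
  ring

theorem summable_coeff (h : IsBlockFamily δ I β b) (J : ArcIndex) :
    Summable fun k => ∫ θ, β k θ * haar δ J θ := by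
  refine Summable.of_norm_bounded
    (h.summable_div.mul_left ((J.1 + 1) * (Real.sqrt (arcLength J))⁻¹)) fun k => ?_
  have hb := (h.block k).nonneg
  have hl := arcLength_pos (I k)
  rcases (h.block k).coeff_eq_zero_or_subset J with h0 | ⟨hg, -⟩
  · rw [h0, norm_zero]
    positivity
  · refine ((h.block k).norm_coeff_le J).trans ?_
    rw [mul_div_assoc', le_div_iff₀ (by positivity)]
    have : ((I k).1 : ℝ) + 1 ≤ J.1 + 1 := by exact_mod_cast Nat.succ_le_succ hg
    calc _ ≤ b k * (Real.sqrt (arcLength J))⁻¹ * arcLength (I k) * (J.1 + 1) := by gcongr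
      _ = _ := by ring

theorem tendsto_pairing_partialSum (h : IsBlockFamily δ I β b) (c : ℂ) {φ : Torus → ℂ} {L A : ℝ}
    (hφ : IsDyadicLipschitz δ φ L A) :
    Tendsto (fun N => ∫ θ, partialSum δ (blockData δ c β) N θ * φ θ) atTop
      (𝓝 (c * (∫ θ, φ θ) + ∑' k, ∫ θ, β k θ * φ θ)) := by
  have hφi : Integrable φ (volume : Measure Torus) :=
    integrable_of_bounded hφ.measurable.aestronglyMeasurable hφ.bound
  set f : ℕ × ArcIndex → ℂ := fun p =>
    (∫ θ, β p.1 θ * haar δ p.2 θ) * ∫ θ, φ θ * haar δ p.2 θ with hf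
  have hfs : Summable f := by
    apply summable_of_tsum_enorm_ne_top
    rw [ENNReal.tsum_prod']
    have h1 : ∑' k, ENNReal.ofReal (b k * L * arcLength (I k) ^ 2) ≠ ⊤ := by
      have := (h.summable_mul_arcLength_sq.mul_left L).tsum_ofReal_ne_top
      refine ne_of_eq_of_ne (tsum_congr fun k => ?_) this
      congr 1; ring
    exact ne_top_of_le_ne_top h1
      (ENNReal.tsum_le_tsum fun k => (h.block k).tsum_coeff_mul_le hφ)
  have h1 : HasSum f (∑' k, ∫ θ, β k θ * φ θ) := by
    have : HasSum (fun k => ∫ θ, β k θ * φ θ) (∑' p, f p) :=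
      hfs.hasSum.prod_fiberwise fun k => (h.block k).hasSum_coeff_mul hφ
    rw [this.tsum_eq]
    exact hfs.hasSum
  have h2 : HasSum (fun J => (blockData δ c β).coeff J * ∫ θ, φ θ * haar δ J θ)
      (∑' k, ∫ θ, β k θ * φ θ) := by
    have h3 : HasSum (f ∘ Prod.swap) (∑' k, ∫ θ, β k θ * φ θ) :=
      (Equiv.prodComm ArcIndex ℕ).hasSum_iff.2 h1
    exact h3.prod_fiberwise fun J => (h.summable_coeff J).hasSum.mul_right _
  have h4 := (h2.comp tendsto_arcsBelow).comp (tendsto_add_atTop_nat 1)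
  refine (h4.const_add (c * ∫ θ, φ θ)).congr fun N => ?_
  have hi : ∀ J ∈ arcsBelow (N + 1), Integrable
      (fun θ => (blockData δ c β).coeff J * (φ θ * haar δ J θ)) volume := fun J _ =>
    (hφi.mul_bdd (measurable_haar J).aestronglyMeasurable
      (ae_of_all _ (norm_haar_le J))).const_mul _
  have e : (fun θ => partialSum δ (blockData δ c β) N θ * φ θ) = fun θ => c * φ θ +
      ∑ J ∈ arcsBelow (N + 1), (blockData δ c β).coeff J * (φ θ * haar δ J θ) := by
    ext θ
    rw [partialSum_eq, ← sum_arcsBelow_mul_haar, add_mul, Finset.sum_mul]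
    congr 1
    exact Finset.sum_congr rfl fun J _ => by ring
  rw [e, integral_add (hφi.const_mul c) (integrable_finsetSum _ hi), integral_const_mul,
    integral_finsetSum _ hi]
  simp only [Function.comp_apply, integral_const_mul]

/-- The distribution `c + ∑ β k`. -/
def toDistribution (h : IsBlockFamily δ I β b) (c : ℂ) : distributions where
  val :=
    { toFun := fun φ => c * (∫ θ, φ.1 θ) + ∑' k, ∫ θ, β k θ * φ.1 θ
      map_add' := by
        intro φ ψ
        obtain ⟨B, hB⟩ := exists_bound_testFunction φ
        obtain ⟨D, hD⟩ := exists_bound_testFunction ψ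
        have hφ := isDyadicLipschitz_testFunction δ φ hB
        have hψ := isDyadicLipschitz_testFunction δ ψ hD
        have hφi := integrable_of_bounded hφ.measurable.aestronglyMeasurable hφ.bound
        have hψi := integrable_of_bounded hψ.measurable.aestronglyMeasurable hψ.bound
        have e : ∀ k, ∫ θ, β k θ * (φ + ψ).1 θ =
            (∫ θ, β k θ * φ.1 θ) + ∫ θ, β k θ * ψ.1 θ := fun k => by
          rw [← integral_add ((h.block k).integrable_mul hφ.measurable hφ.bound)
            ((h.block k).integrable_mul hψ.measurable hψ.bound)]
          congr 1; ext θ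
          exact mul_add _ _ _
        have e' : ∫ θ, (φ + ψ).1 θ = (∫ θ, φ.1 θ) + ∫ θ, ψ.1 θ := integral_add hφi hψi
        simp_rw [e]
        rw [e', (h.summable_pairing hφ).tsum_add (h.summable_pairing hψ)]
        ring
      map_smul' := by
        intro a φ
        have e : ∀ k, ∫ θ, β k θ * (a • φ).1 θ = a * ∫ θ, β k θ * φ.1 θ := fun k => by
          rw [← integral_const_mul]
          congr 1; ext θ
          exact mul_left_comm _ _ _
        have e' : ∫ θ, (a • φ).1 θ = a * ∫ θ, φ.1 θ := integral_const_mul _ _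
        simp_rw [e]
        rw [e', tsum_mul_left, RingHom.id_apply, smul_eq_mul]
        ring }
  property := by
    refine ⟨‖c‖ * (2 * Real.pi) + ∑' k, b k * arcLength (I k) ^ 2, 1, fun φ B hB => ?_⟩
    have hφ := isDyadicLipschitz_testFunction δ φ hB
    have hpi := Real.pi_pos
    have h1 : ‖∫ θ, φ.1 θ‖ ≤ B * (2 * Real.pi) := by
      have := norm_integral_le_of_norm_le_const (μ := (volume : Measure Torus))
        (ae_of_all _ hφ.bound)
      rwa [Measure.real, volume_univ_torus, ENNReal.toReal_ofReal (by positivity)] at this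
    have h2 : ‖∑' k, ∫ θ, β k θ * φ.1 θ‖ ≤ B * ∑' k, b k * arcLength (I k) ^ 2 := by
      rw [← tsum_mul_left]
      refine tsum_of_norm_bounded (h.summable_mul_arcLength_sq.mul_left B).hasSum fun k => ?_
      refine ((h.block k).norm_pairing_le hφ).trans (le_of_eq ?_)
      ring
    calc _ ≤ ‖c * ∫ θ, φ.1 θ‖ + ‖∑' k, ∫ θ, β k θ * φ.1 θ‖ := norm_add_le _ _
      _ ≤ ‖c‖ * (B * (2 * Real.pi)) + B * ∑' k, b k * arcLength (I k) ^ 2 := by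
        rw [norm_mul]
        gcongr
      _ = _ := by ring

theorem toDistribution_apply (h : IsBlockFamily δ I β b) (c : ℂ) (φ : testFunctions) :
    (h.toDistribution c).1 φ = c * (∫ θ, φ.1 θ) + ∑' k, ∫ θ, β k θ * φ.1 θ := rfl

theorem isHaarSum (h : IsBlockFamily δ I β b) (c : ℂ) :
    IsHaarSum δ (blockData δ c β) (h.toDistribution c) := by
  intro φ
  obtain ⟨B, hB⟩ := exists_bound_testFunction φ
  exact h.tendsto_pairing_partialSum c (isDyadicLipschitz_testFunction δ φ hB)

end IsBlockFamily

theorem isHaarSum_unique {F : HaarData} {f g : distributions} (hf : IsHaarSum δ F f)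
    (hg : IsHaarSum δ F g) : f = g :=
  Subtype.ext (LinearMap.ext fun φ => tendsto_nhds_unique (hf φ) (hg φ))

/-! ### The square function of a sum of blocks -/

/-- The square function `(∑_I |a_I|² χ_I / |I|)^{1/2}`. -/
def sqFun (δ : ℝ) (a : ArcIndex → ℂ) (θ : Torus) : ℝ≥0∞ :=
  (∑' k, ‖haarTerm δ a k θ‖ₑ ^ 2) ^ (1 / 2 : ℝ)

theorem squareFunction_eq (F : HaarData) (θ : Torus) :
    squareFunction δ F θ = ‖F.mean‖ₑ + sqFun δ F.coeff θ := by
  rw [squareFunction, sqFun]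
  congr 2
  rw [ENNReal.tsum_sigma']
  refine tsum_congr fun k => ?_
  rw [tsum_fintype, Finset.sum_eq_single (⟨idx δ k θ, idx_lt k θ⟩ : Fin (2 ^ k)), enorm_haarTerm_sq,
    indicator_of_mem]
  · rfl
  · exact mem_cellOf k θ
  · intro m _ hm
    rw [indicator_of_notMem]
    rw [mem_dyadicArc_iff]
    exact fun h => hm (Fin.ext h.symm)
  · simp

theorem measurable_sqFun (a : ArcIndex → ℂ) : Measurable (sqFun δ a) :=
  (Measurable.tsum fun k => (measurable_haarTerm a k).enorm.pow_const 2).pow_const _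

theorem lintegral_sqFun_sq (a : ArcIndex → ℂ) :
    ∫⁻ θ, sqFun δ a θ ^ 2 = ∑' J, ‖a J‖ₑ ^ 2 := by
  simp_rw [sqFun, ENNReal_sqrt_sq]
  rw [lintegral_tsum fun k => ((measurable_haarTerm a k).enorm.pow_const 2).aemeasurable,
    ENNReal.tsum_sigma']
  refine tsum_congr fun k => ?_
  rw [lintegral_enorm_haarTerm_sq, tsum_fintype]

/-- Orlicz estimate for one block: its square function lives on its arc and has `L²` norm at most
`b |I|^{1/2}`. -/
theorem IsBlock.lintegral_Psi_sqFun_le {I : ArcIndex} {β : Torus → ℂ} {b : ℝ}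
    (h : IsBlock δ I β b) {r : ℝ} (hr : 0 < r) :
    ∫⁻ θ, Psi (ENNReal.ofReal r * sqFun δ (fun J => ∫ x, β x * haar δ J x) θ) ≤
      2 * (ENNReal.ofReal (arcLength I) * Psi (ENNReal.ofReal r * ENNReal.ofReal b)) := by
  set a : ArcIndex → ℂ := fun J => ∫ x, β x * haar δ J x with ha
  have hl := arcLength_pos I
  have hint : ∫⁻ θ, sqFun δ a θ ^ 2 ≤ ENNReal.ofReal (b ^ 2 * arcLength I) := by
    rw [lintegral_sqFun_sq]
    exact h.tsum_coeff_sq_le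
  rcases h.nonneg.eq_or_lt with rfl | hb
  · have h0 : ∀ᵐ θ ∂(volume : Measure Torus), sqFun δ a θ ^ 2 = 0 := by
      apply (lintegral_eq_zero_iff' ((measurable_sqFun a).pow_const 2).aemeasurable).1
      simpa using hint
    have h1 : ∫⁻ θ, Psi (ENNReal.ofReal r * sqFun δ a θ) = 0 := by
      apply (lintegral_eq_zero_iff' (measurable_Psi.comp
        ((measurable_sqFun a).const_mul _)).aemeasurable).2
      filter_upwards [h0] with θ hθ
      have : sqFun δ a θ = 0 := by simpa using hθ
      simp [this]
    rw [h1]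
    exact zero_le
  have hbo : ENNReal.ofReal b ≠ 0 := by simpa using hb
  have hro : ENNReal.ofReal r ≠ 0 := by simpa using hr
  have hoff : ∀ θ ∉ dyadicArc δ I, sqFun δ a θ = 0 := by
    intro θ hθ
    have : ∀ k, haarTerm δ a k θ = 0 := by
      intro k
      rcases h.coeff_eq_zero_or_subset (cellOf δ k θ) with h0 | ⟨-, hs⟩
      · simp [haarTerm, ha, h0]
      · exact absurd (hs (mem_cellOf k θ)) hθ
    simp [sqFun, this]
  set P := Psi (ENNReal.ofReal r * ENNReal.ofReal b) with hP
  calc ∫⁻ θ, Psi (ENNReal.ofReal r * sqFun δ a θ)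
      ≤ ∫⁻ θ, (dyadicArc δ I).indicator (fun _ => P) θ +
          P * (ENNReal.ofReal b)⁻¹ ^ 2 * sqFun δ a θ ^ 2 := by
        refine lintegral_mono fun θ => ?_
        by_cases hθ : θ ∈ dyadicArc δ I
        · rw [indicator_of_mem hθ]
          refine (Psi_le_mul_one_add_sq _ (mul_ne_zero hro hbo)
            (ENNReal.mul_ne_top ENNReal.ofReal_ne_top ENNReal.ofReal_ne_top)).trans (le_of_eq ?_)
          rw [ENNReal.mul_div_mul_left _ _ hro ENNReal.ofReal_ne_top, ENNReal.div_eq_inv_mul]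
          ring
        · simp [hoff θ hθ]
    _ = P * ENNReal.ofReal (arcLength I) +
          P * (ENNReal.ofReal b)⁻¹ ^ 2 * ∫⁻ θ, sqFun δ a θ ^ 2 := by
        rw [lintegral_add_left (measurable_const.indicator (measurableSet_dyadicArc I)),
          lintegral_indicator_const (measurableSet_dyadicArc I), volume_dyadicArc,
          lintegral_const_mul _ ((measurable_sqFun a).pow_const 2)]
    _ ≤ P * ENNReal.ofReal (arcLength I) +
          P * (ENNReal.ofReal b)⁻¹ ^ 2 * ENNReal.ofReal (b ^ 2 * arcLength I) := by gcongr
    _ = _ := by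
        have e : (ENNReal.ofReal b)⁻¹ ^ 2 * ENNReal.ofReal (b ^ 2 * arcLength I) =
            ENNReal.ofReal (arcLength I) := by
          rw [ENNReal.ofReal_mul (sq_nonneg b), ENNReal.ofReal_pow hb.le, ← mul_assoc, ← mul_pow,
            ENNReal.inv_mul_cancel hbo ENNReal.ofReal_ne_top, one_pow, one_mul]
        rw [mul_assoc, e]
        ring

theorem sqFun_blockData_le (c : ℂ) (β : ℕ → Torus → ℂ) (θ : Torus) :
    sqFun δ (blockData δ c β).coeff θ ≤
      ∑' k, sqFun δ (fun J => ∫ x, β k x * haar δ J x) θ := by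
  refine le_trans ?_ (ENNReal_sqrt_tsum_sq_tsum_le
    fun k n => ‖haarTerm δ (fun J => ∫ x, β k x * haar δ J x) n θ‖ₑ)
  refine ENNReal.rpow_le_rpow (ENNReal.tsum_le_tsum fun n => ?_) (by norm_num)
  gcongr
  have : haarTerm δ (blockData δ c β).coeff n θ =
      ∑' k, haarTerm δ (fun J => ∫ x, β k x * haar δ J x) n θ := by
    simp only [haarTerm, blockData]
    exact tsum_mul_right.symm
  rw [this]
  exact enorm_tsum_le_tsum_enorm

namespace IsBlockFamily

variable {I : ℕ → ArcIndex} {β : ℕ → Torus → ℂ} {b : ℕ → ℝ}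

/-- The Orlicz integral of the square function of `c + ∑ β k` is controlled by the atomic sum. -/
theorem lintegral_Psi_squareFunction_le (h : IsBlockFamily δ I β b) (c : ℂ) {r : ℝ} (hr : 0 < r) :
    ENNReal.ofReal (2 * Real.pi)⁻¹ *
        ∫⁻ θ, Psi (ENNReal.ofReal r * squareFunction δ (blockData δ c β) θ) ≤
      Psi (ENNReal.ofReal r * ‖c‖ₑ) + ∑' k, ENNReal.ofReal (arcLength (I k)) *
        Psi (ENNReal.ofReal r * ENNReal.ofReal (b k)) := by
  have hpi := Real.two_pi_pos
  have hpt : ∀ θ, Psi (ENNReal.ofReal r * squareFunction δ (blockData δ c β) θ) ≤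
      Psi (ENNReal.ofReal r * ‖c‖ₑ) +
        ∑' k, Psi (ENNReal.ofReal r * sqFun δ (fun J => ∫ x, β k x * haar δ J x) θ) := by
    intro θ
    rw [squareFunction_eq, mul_add]
    refine (Psi_add_le _ _).trans ?_
    gcongr
    · rfl
    · refine le_trans (Psi_mono ?_) (Psi_tsum_le _)
      rw [ENNReal.tsum_mul_left]
      gcongr
      exact sqFun_blockData_le c β θ
  have hm : ∀ k, Measurable fun θ =>
      Psi (ENNReal.ofReal r * sqFun δ (fun J => ∫ x, β k x * haar δ J x) θ) := fun k =>
    measurable_Psi.comp ((measurable_sqFun _).const_mul _)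
  have h1 : ∫⁻ θ, Psi (ENNReal.ofReal r * squareFunction δ (blockData δ c β) θ) ≤
      ENNReal.ofReal (2 * Real.pi) * Psi (ENNReal.ofReal r * ‖c‖ₑ) +
        ∑' k, 2 * (ENNReal.ofReal (arcLength (I k)) *
          Psi (ENNReal.ofReal r * ENNReal.ofReal (b k))) := by
    refine (lintegral_mono hpt).trans ?_
    rw [lintegral_add_left measurable_const, lintegral_const, volume_univ_torus, mul_comm,
      lintegral_tsum fun k => (hm k).aemeasurable]
    gcongr with k
    exact (h.block k).lintegral_Psi_sqFun_le hr
  have hinv : ENNReal.ofReal (2 * Real.pi)⁻¹ * ENNReal.ofReal (2 * Real.pi) = 1 := by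
    rw [← ENNReal.ofReal_mul (by positivity), inv_mul_cancel₀ hpi.ne', ENNReal.ofReal_one]
  have hle : ENNReal.ofReal (2 * Real.pi)⁻¹ * 2 ≤ 1 := by
    rw [← ENNReal.ofReal_ofNat 2, ← ENNReal.ofReal_mul (by positivity), ENNReal.ofReal_le_one,
      inv_mul_le_iff₀ hpi]
    linarith [Real.pi_gt_three]
  refine (mul_le_mul_right h1 _).trans ?_
  rw [mul_add, ← mul_assoc, hinv, one_mul, ENNReal.tsum_mul_left, ← mul_assoc]
  gcongr
  exact mul_le_of_le_one_left' hle

theorem blockData_mem_hlog (h : IsBlockFamily δ I β b) (c : ℂ) : blockData δ c β ∈ hlog δ := by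
  have hpi := Real.two_pi_pos
  have h1 := h.lintegral_Psi_squareFunction_le c one_pos
  simp only [ENNReal.ofReal_one, one_mul] at h1
  have h2 : Psi ‖c‖ₑ + ∑' k, ENNReal.ofReal (arcLength (I k)) * Psi (ENNReal.ofReal (b k)) < ⊤ :=
    ENNReal.add_lt_top.2 ⟨Psi_lt_top enorm_ne_top, h.sum.lt_top⟩
  by_contra h3
  have h4 : ∫⁻ θ, Psi (squareFunction δ (blockData δ c β) θ) = ⊤ := not_lt_top_iff.1 h3
  rw [h4, ENNReal.mul_top] at h1
  · exact absurd h2 (not_lt.2 h1)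
  · simpa using Real.pi_pos

end IsBlockFamily

/-! ### Predictable stopping -/


/-- The stopping condition at time `k` for the martingale with differences `d`: neither the square
function up to and including time `k` nor the martingale before time `k` has exceeded the
height `√t`. For a Haar series this depends only on the arc of generation `k`. -/
def IsGood (d : ℕ → ℂ) (t : ℝ) (k : ℕ) : Prop :=
  ∑ n ∈ Finset.range (k + 1), ‖d n‖ ^ 2 ≤ t ∧ ∀ n ≤ k, ‖∑ j ∈ Finset.range n, d j‖ ^ 2 ≤ t

theorem IsGood.of_le {d : ℕ → ℂ} {t : ℝ} {k m : ℕ} (h : IsGood d t k) (hm : m ≤ k) :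
    IsGood d t m := by
  refine ⟨le_trans ?_ h.1, fun n hn => h.2 n (hn.trans hm)⟩
  exact Finset.sum_le_sum_of_subset_of_nonneg (Finset.range_mono (by omega))
    fun _ _ _ => by positivity

theorem IsGood.mono {d : ℕ → ℂ} {s t : ℝ} {k : ℕ} (h : IsGood d s k) (hst : s ≤ t) :
    IsGood d t k := ⟨h.1.trans hst, fun n hn => (h.2 n hn).trans hst⟩

open Classical in
/-- The stopping time, truncated at `N`: summing over the good times is the same as summing up to
the first bad one. -/
theorem exists_stopping_time (d : ℕ → ℂ) (t : ℝ) (N : ℕ) :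
    ∃ m ≤ N, (∀ k < m, IsGood d t k) ∧ (m = N ∨ ¬ IsGood d t m) ∧
      (∑ k ∈ Finset.range N, if IsGood d t k then d k else 0) = ∑ k ∈ Finset.range m, d k ∧
      (∑ k ∈ Finset.range N, if IsGood d t k then ‖d k‖ ^ 2 else 0) =
        ∑ k ∈ Finset.range m, ‖d k‖ ^ 2 := by
  induction N with
  | zero => exact ⟨0, le_rfl, by simp, Or.inl rfl, by simp, by simp⟩
  | succ N ih =>
    obtain ⟨m, hm, h1, h2, h3, h4⟩ := ih
    rw [Finset.sum_range_succ, Finset.sum_range_succ, h3, h4]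
    by_cases hg : IsGood d t N
    · have hmN : m = N := by
        rcases h2 with h2 | h2
        · exact h2
        · exact absurd (hg.of_le hm) h2
      subst hmN
      refine ⟨m + 1, le_rfl, fun k hk => hg.of_le (by omega), Or.inl rfl, ?_, ?_⟩
      · rw [if_pos hg, Finset.sum_range_succ]
      · rw [if_pos hg, Finset.sum_range_succ]
    · refine ⟨m, by omega, h1, Or.inr ?_, by simp [hg], by simp [hg]⟩
      rcases h2 with h2 | h2
      · rwa [h2]
      · exact h2

open Classical in
/-- Since the square function is stopped predictably, the last jump is bounded too. -/
theorem norm_stopped_le (d : ℕ → ℂ) {c : ℝ} (hc : 0 ≤ c) (N : ℕ) :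
    ‖∑ k ∈ Finset.range N, if IsGood d (c ^ 2) k then d k else 0‖ ≤ 2 * c := by
  obtain ⟨m, -, h1, -, h3, -⟩ := exists_stopping_time d (c ^ 2) N
  rw [h3]
  rcases m with _ | m
  · simpa using hc
  have hg := h1 m (Nat.lt_succ_self m)
  have h4 : ‖∑ k ∈ Finset.range m, d k‖ ≤ c := (sq_le_sq₀ (norm_nonneg _) hc).1 (hg.2 m le_rfl)
  have h5 : ‖d m‖ ≤ c := by
    have : ‖d m‖ ^ 2 ≤ c ^ 2 := le_trans (Finset.single_le_sum (f := fun n => ‖d n‖ ^ 2)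
      (fun _ _ => by positivity) (Finset.self_mem_range_succ m)) hg.1
    exact (sq_le_sq₀ (norm_nonneg _) hc).1 this
  rw [Finset.sum_range_succ]
  exact (norm_add_le _ _).trans (by linarith)

open Classical in
theorem sum_stopped_sq_le (d : ℕ → ℂ) {t : ℝ} (ht : 0 ≤ t) (N : ℕ) :
    (∑ k ∈ Finset.range N, if IsGood d t k then ‖d k‖ ^ 2 else 0) ≤ t := by
  obtain ⟨m, -, h1, -, -, h4⟩ := exists_stopping_time d t N
  rw [h4]
  rcases m with _ | m
  · simpa using ht
  · exact (h1 m (Nat.lt_succ_self m)).1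

open Classical in
/-- If only the martingale exceeds the height, the stopped martingale stays above it. -/
theorem lt_norm_stopped_sq (d : ℕ → ℂ) {t : ℝ} {N n : ℕ}
    (hs : ∀ k, ∑ n ∈ Finset.range (k + 1), ‖d n‖ ^ 2 ≤ t) (hn : n ≤ N)
    (hd : t < ‖∑ j ∈ Finset.range n, d j‖ ^ 2) :
    t < ‖∑ k ∈ Finset.range N, if IsGood d t k then d k else 0‖ ^ 2 := by
  obtain ⟨m, hm, h1, h2, h3, -⟩ := exists_stopping_time d t N
  rw [h3]
  have hnm : m ≤ n := by
    by_contra! h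
    exact absurd ((h1 n h).2 n le_rfl) (not_le.2 hd)
  rcases h2 with rfl | h2
  · rwa [le_antisymm hnm hn]
  · by_contra! h
    refine h2 ⟨hs m, fun j hj => ?_⟩
    rcases hj.eq_or_lt with rfl | hj
    · exact h
    · exact (h1 j hj).2 j le_rfl

theorem haarTerm_congr {a : ArcIndex → ℂ} {k n : ℕ} (h : n < k) {θ θ' : Torus}
    (he : cellOf δ k θ = cellOf δ k θ') : haarTerm δ a n θ = haarTerm δ a n θ' := by
  rw [haarTerm, haarTerm, cellOf_eq_of_le h.le he]
  congr 1
  apply haar_congr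
  have h1 := cellOf_eq_of_le (n := n + 1) h he
  simpa [cellOf] using h1

theorem norm_haarTerm (a : ArcIndex → ℂ) (k : ℕ) (θ : Torus) :
    ‖haarTerm δ a k θ‖ = ‖a (cellOf δ k θ)‖ * (Real.sqrt (arcLength (cellOf δ k θ)))⁻¹ := by
  rw [haarTerm, norm_mul, norm_haar_of_mem (mem_cellOf k θ)]

theorem isGood_congr {a : ArcIndex → ℂ} {t : ℝ} {k : ℕ} {θ θ' : Torus}
    (he : cellOf δ k θ = cellOf δ k θ') :
    IsGood (fun n => haarTerm δ a n θ) t k ↔ IsGood (fun n => haarTerm δ a n θ') t k := by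
  unfold IsGood
  have h1 : ∑ n ∈ Finset.range (k + 1), ‖haarTerm δ a n θ‖ ^ 2 =
      ∑ n ∈ Finset.range (k + 1), ‖haarTerm δ a n θ'‖ ^ 2 := by
    refine Finset.sum_congr rfl fun n hn => ?_
    rw [norm_haarTerm, norm_haarTerm, cellOf_eq_of_le (Finset.mem_range_succ_iff.1 hn) he]
  have h2 : ∀ n ≤ k, ∑ j ∈ Finset.range n, haarTerm δ a j θ =
      ∑ j ∈ Finset.range n, haarTerm δ a j θ' := fun n hn =>
    Finset.sum_congr rfl fun j hj =>
      haarTerm_congr ((Finset.mem_range.1 hj).trans_le hn) he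
  rw [h1]
  refine and_congr_right fun _ => forall₂_congr fun n hn => ?_
  rw [h2 n hn]

/-- The stopping condition as a condition on arcs. -/
def IsGoodArc (δ : ℝ) (a : ArcIndex → ℂ) (t : ℝ) (J : ArcIndex) : Prop :=
  IsGood (fun n => haarTerm δ a n (arcPoint δ J)) t J.1

theorem isGoodArc_cellOf {a : ArcIndex → ℂ} {t : ℝ} {k : ℕ} {θ : Torus} :
    IsGoodArc δ a t (cellOf δ k θ) ↔ IsGood (fun n => haarTerm δ a n θ) t k :=
  isGood_congr (cellOf_arcPoint (cellOf δ k θ))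

open Classical in
/-- The coefficients `a`, replaced by zero at the arcs that violate `P`. If `P` is a stopping
condition, these are the Haar coefficients of the stopped martingale. -/
def restrictTo (P : ArcIndex → Prop) (a : ArcIndex → ℂ) (J : ArcIndex) : ℂ :=
  if P J then a J else 0

open Classical in
theorem haarTerm_restrictTo (P : ArcIndex → Prop) (a : ArcIndex → ℂ) (k : ℕ) (θ : Torus) :
    haarTerm δ (restrictTo P a) k θ = if P (cellOf δ k θ) then haarTerm δ a k θ else 0 := by
  simp only [haarTerm, restrictTo]
  split_ifs <;> simp

open Classical in
theorem haarSum_stopped (a : ArcIndex → ℂ) (t : ℝ) (N : ℕ) (θ : Torus) :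
    haarSum δ (restrictTo (IsGoodArc δ a t) a) N θ =
      ∑ k ∈ Finset.range N, if IsGood (fun n => haarTerm δ a n θ) t k
        then haarTerm δ a k θ else 0 := by
  unfold haarSum
  refine Finset.sum_congr rfl fun k _ => ?_
  simp only [haarTerm_restrictTo, isGoodArc_cellOf]

theorem norm_haarSum_stopped_le (a : ArcIndex → ℂ) {c : ℝ} (hc : 0 ≤ c) (N : ℕ) (θ : Torus) :
    ‖haarSum δ (restrictTo (IsGoodArc δ a (c ^ 2)) a) N θ‖ ≤ 2 * c := by
  classical
  rw [haarSum_stopped]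
  exact norm_stopped_le _ hc N

theorem sum_enorm_haarTerm_stopped_le (a : ArcIndex → ℂ) {t : ℝ} (ht : 0 ≤ t) (N : ℕ)
    (θ : Torus) :
    ∑ k ∈ Finset.range N, ‖haarTerm δ (restrictTo (IsGoodArc δ a t) a) k θ‖ₑ ^ 2 ≤
      min (sqFun δ a θ ^ 2) (ENNReal.ofReal t) := by
  classical
  have e : ∀ k, ‖haarTerm δ (restrictTo (IsGoodArc δ a t) a) k θ‖ₑ ^ 2 =
      ENNReal.ofReal (if IsGood (fun n => haarTerm δ a n θ) t k
        then ‖haarTerm δ a k θ‖ ^ 2 else 0) := by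
    intro k
    simp only [haarTerm_restrictTo, isGoodArc_cellOf]
    split_ifs
    · rw [ENNReal.ofReal_pow (norm_nonneg _), ofReal_norm]
    · simp
  apply le_min
  · rw [sqFun, ENNReal_sqrt_sq]
    refine (Finset.sum_le_sum fun k _ => ?_).trans (ENNReal.sum_le_tsum (Finset.range N))
    simp only [haarTerm_restrictTo]
    split_ifs
    · exact le_rfl
    · simp
  · simp_rw [e]
    rw [← ENNReal.ofReal_sum_of_nonneg fun k _ => by split_ifs <;> positivity]
    exact ENNReal.ofReal_le_ofReal (sum_stopped_sq_le (fun n => haarTerm δ a n θ) ht N)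

theorem sum_norm_sq_le_of_sqFun {a : ArcIndex → ℂ} {t : ℝ} (ht : 0 ≤ t) {θ : Torus}
    (h : sqFun δ a θ ^ 2 ≤ ENNReal.ofReal t) (k : ℕ) :
    ∑ n ∈ Finset.range (k + 1), ‖haarTerm δ a n θ‖ ^ 2 ≤ t := by
  rw [sqFun, ENNReal_sqrt_sq] at h
  rw [← ENNReal.ofReal_le_ofReal_iff ht, ENNReal.ofReal_sum_of_nonneg fun _ _ => by positivity]
  refine le_trans (le_of_eq ?_) ((ENNReal.sum_le_tsum (Finset.range (k + 1))).trans h)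
  refine Finset.sum_congr rfl fun n _ => ?_
  rw [ENNReal.ofReal_pow (norm_nonneg _), ofReal_norm]

/-- Distribution inequality for the stopping time. The part where the square function is large is
Chebyshev's inequality; on the rest the stopped martingale is large, and its `L²` norm is that of
the truncated square function. -/
theorem volume_bad_le (a : ArcIndex → ℂ) {t : ℝ} (ht : 0 ≤ t) :
    ENNReal.ofReal t * volume {θ : Torus | ∃ k, ¬ IsGoodArc δ a t (cellOf δ k θ)} ≤
      2 * ∫⁻ θ, min (sqFun δ a θ ^ 2) (ENNReal.ofReal t) := by
  set R := ∫⁻ θ, min (sqFun δ a θ ^ 2) (ENNReal.ofReal t) with hR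
  set D : ℕ → Set Torus := fun N => {θ | sqFun δ a θ ^ 2 ≤ ENNReal.ofReal t ∧
    ∃ n ≤ N, t < ‖∑ j ∈ Finset.range n, haarTerm δ a j θ‖ ^ 2} with hD
  have hsub : {θ : Torus | ∃ k, ¬ IsGoodArc δ a t (cellOf δ k θ)} ⊆
      {θ | ENNReal.ofReal t ≤ min (sqFun δ a θ ^ 2) (ENNReal.ofReal t)} ∪ ⋃ N, D N := by
    rintro θ ⟨k, hk⟩
    rw [isGoodArc_cellOf] at hk
    rcases le_total (ENNReal.ofReal t) (sqFun δ a θ ^ 2) with h | h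
    · exact Or.inl (le_min h le_rfl)
    · right
      by_contra hcon
      simp only [hD, mem_iUnion, mem_ofPred_eq, not_exists, not_and, not_lt] at hcon
      exact hk ⟨sum_norm_sq_le_of_sqFun ht h k, fun n hn => hcon n h n le_rfl⟩
  have h1 : ENNReal.ofReal t *
      volume {θ | ENNReal.ofReal t ≤ min (sqFun δ a θ ^ 2) (ENNReal.ofReal t)} ≤ R :=
    mul_meas_ge_le_lintegral (((measurable_sqFun a).pow_const 2).min measurable_const) _
  have hDN : ∀ N, ENNReal.ofReal t * volume (D N) ≤ R := by
    intro N
    classical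
    have hs : D N ⊆ {θ | ENNReal.ofReal t ≤
        ‖haarSum δ (restrictTo (IsGoodArc δ a t) a) N θ‖ₑ ^ 2} := by
      rintro θ ⟨hθ, n, hn, hlt⟩
      have := lt_norm_stopped_sq (fun n => haarTerm δ a n θ) (sum_norm_sq_le_of_sqFun ht hθ) hn hlt
      rw [mem_ofPred_eq, haarSum_stopped, ← ofReal_norm, ← ENNReal.ofReal_pow (norm_nonneg _)]
      exact ENNReal.ofReal_le_ofReal this.le
    calc _ ≤ ENNReal.ofReal t * volume {θ | ENNReal.ofReal t ≤
          ‖haarSum δ (restrictTo (IsGoodArc δ a t) a) N θ‖ₑ ^ 2} := by gcongr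
      _ ≤ ∫⁻ θ, ‖haarSum δ (restrictTo (IsGoodArc δ a t) a) N θ‖ₑ ^ 2 :=
        mul_meas_ge_le_lintegral ((measurable_haarSum _ N).enorm.pow_const 2) _
      _ ≤ R := by
        rw [lintegral_enorm_sq_haarSum_eq]
        exact lintegral_mono fun θ => sum_enorm_haarTerm_stopped_le a ht N θ
  have hmono : Monotone D := by
    rintro M N hMN θ ⟨hθ, n, hn, hlt⟩
    exact ⟨hθ, n, hn.trans hMN, hlt⟩
  have h2 : ENNReal.ofReal t * volume (⋃ N, D N) ≤ R := by
    rw [hmono.measure_iUnion, ENNReal.mul_iSup]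
    exact iSup_le hDN
  calc _ ≤ ENNReal.ofReal t * (volume
        {θ | ENNReal.ofReal t ≤ min (sqFun δ a θ ^ 2) (ENNReal.ofReal t)} +
          volume (⋃ N, D N)) := by
        gcongr
        exact (measure_mono hsub).trans (measure_union_le _ _)
    _ ≤ R + R := by rw [mul_add]; exact add_le_add h1 h2
    _ = 2 * R := (two_mul R).symm

/-! ### Decomposition of Haar data into blocks -/


/-- The arcs at which level `i` is not yet exceeded: height `l 2^i` for `i ≥ 1`, and no arc at all
for `i = 0`. -/
def goodLevel (δ : ℝ) (a : ArcIndex → ℂ) (l : ℝ) : ℕ → ArcIndex → Prop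
  | 0 => fun _ => False
  | i + 1 => IsGoodArc δ a ((l * 2 ^ (i + 1)) ^ 2)

theorem goodLevel_of_le {a : ArcIndex → ℂ} {l : ℝ} {i k n : ℕ} {θ : Torus}
    (h : goodLevel δ a l i (cellOf δ k θ)) (hn : n ≤ k) : goodLevel δ a l i (cellOf δ n θ) := by
  cases i with
  | zero => exact h
  | succ i =>
    simp only [goodLevel, isGoodArc_cellOf] at h ⊢
    exact h.of_le hn

theorem goodLevel_succ {a : ArcIndex → ℂ} {l : ℝ} (hl : 0 ≤ l) {i : ℕ} {J : ArcIndex}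
    (h : goodLevel δ a l i J) : goodLevel δ a l (i + 1) J := by
  cases i with
  | zero => exact h.elim
  | succ i =>
    refine IsGood.mono h ?_
    gcongr
    · norm_num
    · omega

theorem goodLevel_eventually (a : ArcIndex → ℂ) {l : ℝ} (hl : 0 < l) (J : ArcIndex) :
    ∃ n, ∀ i ≥ n, goodLevel δ a l i J := by
  set d : ℕ → ℂ := fun n => haarTerm δ a n (arcPoint δ J) with hd
  set M := ∑ n ∈ Finset.range (J.1 + 1), ‖d n‖ ^ 2 +
    ∑ n ∈ Finset.range (J.1 + 1), ‖∑ j ∈ Finset.range n, d j‖ ^ 2 with hM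
  have hlim : Tendsto (fun i : ℕ => (l * 2 ^ i) ^ 2) atTop atTop := by
    apply (tendsto_pow_atTop two_ne_zero).comp
    exact (tendsto_pow_atTop_atTop_of_one_lt one_lt_two).const_mul_atTop hl
  obtain ⟨n, hn⟩ := eventually_atTop.1 (hlim.eventually_ge_atTop M)
  refine ⟨n + 1, fun i hi => ?_⟩
  obtain ⟨i, rfl⟩ : ∃ j, i = j + 1 := ⟨i - 1, by omega⟩
  have h1 := hn (i + 1) (by omega)
  have p1 : 0 ≤ ∑ n ∈ Finset.range (J.1 + 1), ‖d n‖ ^ 2 :=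
    Finset.sum_nonneg fun _ _ => by positivity
  have p2 : 0 ≤ ∑ n ∈ Finset.range (J.1 + 1), ‖∑ j ∈ Finset.range n, d j‖ ^ 2 :=
    Finset.sum_nonneg fun _ _ => by positivity
  refine ⟨le_trans (by linarith) h1, fun m hm => ?_⟩
  have := Finset.single_le_sum (f := fun n => ‖∑ j ∈ Finset.range n, d j‖ ^ 2)
    (fun _ _ => by positivity) (Finset.mem_range_succ_iff.2 hm)
  exact le_trans (by linarith) h1

theorem norm_haarSum_goodLevel_le (a : ArcIndex → ℂ) {l : ℝ} (hl : 0 ≤ l) (i N : ℕ) (θ : Torus) :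
    ‖haarSum δ (restrictTo (goodLevel δ a l i) a) N θ‖ ≤ 2 * (l * 2 ^ i) := by
  cases i with
  | zero =>
    have : haarSum δ (restrictTo (goodLevel δ a l 0) a) N θ = 0 :=
      Finset.sum_eq_zero fun k _ => by simp [haarTerm, restrictTo, goodLevel]
    rw [this, norm_zero]
    positivity
  | succ i => exact norm_haarSum_stopped_le a (by positivity) N θ

/-- `J` is a maximal arc among those violating `P`. -/
def IsFirstBad (δ : ℝ) (P : ArcIndex → Prop) (J : ArcIndex) : Prop :=
  ¬ P J ∧ ∀ n < J.1, P (cellOf δ n (arcPoint δ J))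

theorem IsFirstBad.eq_of_mem {P : ArcIndex → Prop} {J K : ArcIndex} (hJ : IsFirstBad δ P J)
    (hK : IsFirstBad δ P K) {θ : Torus} (h1 : θ ∈ dyadicArc δ J) (h2 : θ ∈ dyadicArc δ K) :
    J = K := by
  have key : ∀ {J K : ArcIndex}, IsFirstBad δ P J → IsFirstBad δ P K → θ ∈ dyadicArc δ J →
      θ ∈ dyadicArc δ K → K.1 ≤ J.1 := by
    intro J K hJ hK h1 h2
    by_contra! hlt
    rw [mem_dyadicArc_iff_cellOf] at h1 h2
    have e : cellOf δ K.1 (arcPoint δ K) = cellOf δ K.1 θ := by rw [cellOf_arcPoint, h2]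
    have := hK.2 J.1 hlt
    rw [cellOf_eq_of_le hlt.le e, h1] at this
    exact hJ.1 this
  exact eq_of_mem_of_mem (le_antisymm (key hK hJ h2 h1) (key hJ hK h1 h2)) h1 h2

open Classical in
theorem exists_isFirstBad {P : ArcIndex → Prop} {K : ArcIndex} (hK : ¬ P K) :
    ∃ J, IsFirstBad δ P J ∧ J.1 ≤ K.1 ∧ arcPoint δ K ∈ dyadicArc δ J := by
  have hex : ∃ k, ¬ P (cellOf δ k (arcPoint δ K)) := ⟨K.1, by rwa [cellOf_arcPoint]⟩
  refine ⟨cellOf δ (Nat.find hex) (arcPoint δ K), ⟨Nat.find_spec hex, fun n hn => ?_⟩,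
    Nat.find_min' hex (by rwa [cellOf_arcPoint]), mem_cellOf _ _⟩
  have h1 := Nat.find_min hex hn
  rw [not_not] at h1
  have e : cellOf δ (Nat.find hex) (arcPoint δ (cellOf δ (Nat.find hex) (arcPoint δ K))) =
      cellOf δ (Nat.find hex) (arcPoint δ K) := cellOf_arcPoint (cellOf δ _ _)
  rwa [cellOf_eq_of_le (Nat.le_of_lt hn) e]

open Classical in
theorem tsum_arcLength_firstBad_le (P : ArcIndex → Prop) :
    ∑' J, (if IsFirstBad δ P J then ENNReal.ofReal (arcLength J) else 0) ≤
      volume {θ : Torus | ∃ k, ¬ P (cellOf δ k θ)} := by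
  set S : ArcIndex → Set Torus := fun J => if IsFirstBad δ P J then dyadicArc δ J else ∅ with hS
  have hSm : ∀ J, MeasurableSet (S J) := by
    intro J
    simp only [hS]
    split_ifs
    · exact measurableSet_dyadicArc J
    · exact MeasurableSet.empty
  have hd : Pairwise (Function.onFun Disjoint S) := by
    intro J K hJK
    simp only [Function.onFun, hS]
    split_ifs with h1 h2
    · rw [Set.disjoint_left]
      exact fun θ hθ hθ' => hJK (h1.eq_of_mem h2 hθ hθ')
    all_goals simp
  have e : ∀ J, (if IsFirstBad δ P J then ENNReal.ofReal (arcLength J) else 0) = volume (S J) := by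
    intro J
    simp only [hS]
    split_ifs
    · rw [volume_dyadicArc]
    · simp
  simp_rw [e]
  rw [← measure_iUnion hd hSm]
  apply measure_mono
  intro θ hθ
  obtain ⟨J, hJ⟩ := mem_iUnion.1 hθ
  simp only [hS] at hJ
  split_ifs at hJ with h
  · refine ⟨J.1, ?_⟩
    rw [mem_dyadicArc_iff_cellOf.1 hJ]
    exact h.1
  · exact hJ.elim

/-- A function without Haar coefficients on the ancestors of `J` restricts to a block on `J`. For the
difference of two successive stopped martingales this applies to the maximal stopping arcs. -/
theorem isBlock_difference {g : Torus → ℂ} (hg : Measurable g) {b : ℝ} (hb : ∀ θ, ‖g θ‖ ≤ b)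
    {J : ArcIndex} (hmean : ∫ θ, g θ = 0)
    (h0 : ∀ n < J.1, ∫ θ, g θ * haar δ (cellOf δ n (arcPoint δ J)) θ = 0) :
    IsBlock δ J ((dyadicArc δ J).indicator g) b where
  measurable := hg.indicator (measurableSet_dyadicArc J)
  nonneg := (norm_nonneg _).trans (hb (arcPoint δ J))
  bound := ae_of_all _ fun θ => (norm_indicator_le_norm_self _ _).trans (hb θ)
  eq_zero := fun θ hθ => indicator_of_notMem hθ _
  integral := by
    have hi := integrable_of_bounded hg.aestronglyMeasurable hb
    have h1 := average_eq_sum_haar (δ := δ) hi J.1 (arcPoint δ J)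
    rw [cellOf_arcPoint, hmean, mul_zero, zero_add, Finset.sum_eq_zero fun n hn => by
      rw [h0 n (Finset.mem_range.1 hn), zero_mul]] at h1
    rw [integral_indicator (measurableSet_dyadicArc J)]
    rcases mul_eq_zero.1 h1 with h2 | h2
    · have := (arcLength_pos J).ne'
      simp only [inv_eq_zero, Complex.ofReal_eq_zero] at h2
      exact absurd h2 this
    · exact h2

theorem integral_indicator_mul_haar {g : Torus → ℂ} {J K : ArcIndex}
    (h : dyadicArc δ K ⊆ dyadicArc δ J) :
    ∫ θ, (dyadicArc δ J).indicator g θ * haar δ K θ = ∫ θ, g θ * haar δ K θ := by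
  congr 1
  ext θ
  by_cases hθ : θ ∈ dyadicArc δ K
  · rw [indicator_of_mem (h hθ)]
  · simp [haar_of_notMem hθ]

open Classical in
/-- The stopped martingales at heights `l 2^i` differ by blocks on the maximal stopping arcs, and
these blocks add up to the given Haar series with control of the Orlicz sum. -/
theorem exists_blockFamily (a : ArcIndex → ℂ) {l : ℝ} (hl : 0 < l)
    (hS : ∫⁻ θ, Psi (ENNReal.ofReal l⁻¹ * sqFun δ a θ) ≠ ⊤) :
    ∃ (I : ℕ → ArcIndex) (β : ℕ → Torus → ℂ) (b : ℕ → ℝ), IsBlockFamily δ I β b ∧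
      (∀ K, HasSum (fun k => ∫ θ, β k θ * haar δ K θ) (a K)) ∧
      ∑' k, ENNReal.ofReal (arcLength (I k)) * Psi (ENNReal.ofReal l⁻¹ * ENNReal.ofReal (b k)) ≤
        6 * (ENNReal.ofReal (2 * Real.pi) +
          32 * ∫⁻ θ, Psi (ENNReal.ofReal l⁻¹ * sqFun δ a θ)) := by
  set P := goodLevel δ a l with hP
  choose G hGm hGb hGc hG0 using fun i =>
    exists_bounded_of_haarSum_bounded (norm_haarSum_goodLevel_le (δ := δ) a hl.le i)
  have hGi : ∀ i, Integrable (G i) (volume : Measure Torus) := fun i =>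
    integrable_of_bounded (hGm i).aestronglyMeasurable (hGb i)
  set g : ℕ → Torus → ℂ := fun i θ => G (i + 1) θ - G i θ with hg
  have hgb : ∀ i θ, ‖g i θ‖ ≤ 6 * (l * 2 ^ i) := by
    intro i θ
    refine (norm_sub_le _ _).trans ((add_le_add (hGb (i + 1) θ) (hGb i θ)).trans (le_of_eq ?_))
    rw [pow_succ]; ring
  have hgc : ∀ i K, ∫ θ, g i θ * haar δ K θ =
      restrictTo (P (i + 1)) a K - restrictTo (P i) a K := by
    intro i K
    rw [← hGc, ← hGc, ← integral_sub
      ((hGi (i + 1)).mul_bdd (measurable_haar K).aestronglyMeasurable (ae_of_all _ (norm_haar_le K)))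
      ((hGi i).mul_bdd (measurable_haar K).aestronglyMeasurable (ae_of_all _ (norm_haar_le K)))]
    simp_rw [← sub_mul]
    rfl
  have hgood : ∀ i K, P i K → ∫ θ, g i θ * haar δ K θ = 0 := by
    intro i K hK
    rw [hgc, restrictTo, restrictTo, if_pos hK, if_pos (goodLevel_succ hl.le hK), sub_self]
  set β' : ℕ × ArcIndex → Torus → ℂ := fun p =>
    if IsFirstBad δ (P p.1) p.2 then (dyadicArc δ p.2).indicator (g p.1) else 0 with hβ'
  set b' : ℕ × ArcIndex → ℝ := fun p =>
    if IsFirstBad δ (P p.1) p.2 then 6 * (l * 2 ^ p.1) else 0 with hb'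
  have hblock : ∀ p, IsBlock δ p.2 (β' p) (b' p) := by
    rintro ⟨i, J⟩
    simp only [hβ', hb']
    split_ifs with h
    · have hmean : ∫ θ, g i θ = 0 := by
        rw [hg, integral_sub (hGi _) (hGi _), hG0, hG0, sub_zero]
      exact isBlock_difference ((hGm (i + 1)).sub (hGm i)) (hgb i) hmean
        fun n hn => hgood i _ (h.2 n hn)
    · exact ⟨measurable_const, le_rfl, by simp, fun _ _ => rfl, by simp⟩
  -- The Haar coefficients of the blocks of one level.
  have hnz : ∀ i J K, ∫ θ, β' (i, J) θ * haar δ K θ ≠ 0 →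
      IsFirstBad δ (P i) J ∧ J.1 ≤ K.1 ∧ dyadicArc δ K ⊆ dyadicArc δ J := by
    intro i J K hne
    have h1 := ((hblock (i, J)).coeff_eq_zero_or_subset K).resolve_left hne
    refine ⟨?_, h1⟩
    by_contra h2
    apply hne
    simp [hβ', h2]
  have hbadK : ∀ i J K, ∫ θ, β' (i, J) θ * haar δ K θ ≠ 0 → ¬ P i K := by
    intro i J K hne hK
    obtain ⟨h1, h2, h3⟩ := hnz i J K hne
    have h4 := h3 (arcPoint_mem K)
    rw [mem_dyadicArc_iff_cellOf] at h4
    apply h1.1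
    rw [← h4]
    apply goodLevel_of_le (k := K.1) _ h2
    rwa [cellOf_arcPoint]
  have hlevel : ∀ K i, HasSum (fun J => ∫ θ, β' (i, J) θ * haar δ K θ)
      (restrictTo (P (i + 1)) a K - restrictTo (P i) a K) := by
    intro K i
    rw [← hgc]
    by_cases hK : P i K
    · rw [hgood i K hK]
      have h0 : ∀ J, ∫ θ, β' (i, J) θ * haar δ K θ = 0 := fun J => by
        by_contra hne
        exact hbadK i J K hne hK
      simp_rw [h0]
      exact hasSum_zero
    · obtain ⟨J, hJ, hle, hmem⟩ := exists_isFirstBad (δ := δ) hK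
      have hsub := dyadicArc_subset_of_mem hle hmem
      have hval : ∫ θ, g i θ * haar δ K θ = ∫ θ, β' (i, J) θ * haar δ K θ := by
        simp only [hβ', if_pos hJ]
        exact (integral_indicator_mul_haar hsub).symm
      rw [hval]
      refine hasSum_single (f := fun J => ∫ θ, β' (i, J) θ * haar δ K θ) J fun J' hJ' => ?_
      by_contra hne
      obtain ⟨h1, -, h3⟩ := hnz i J' K hne
      exact hJ' (h1.eq_of_mem hJ (h3 (arcPoint_mem K)) hmem)
  have htotal : ∀ K, HasSum (fun p => ∫ θ, β' p θ * haar δ K θ) (a K) := by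
    intro K
    obtain ⟨n, hn⟩ := goodLevel_eventually (δ := δ) a hl K
    have hfin : (Function.support fun p => ∫ θ, β' p θ * haar δ K θ).Finite := by
      refine (((Finset.range n) ×ˢ ((Finset.range (K.1 + 1)).image
        fun k => cellOf δ k (arcPoint δ K))).finite_toSet).subset ?_
      rintro ⟨i, J⟩ hne
      obtain ⟨-, h2, h3⟩ := hnz i J K hne
      have h4 := hbadK i J K hne
      simp only [Finset.coe_product, mem_prod, Finset.mem_coe, Finset.mem_range, Finset.mem_image]
      refine ⟨?_, J.1, by omega, mem_dyadicArc_iff_cellOf.1 (h3 (arcPoint_mem K))⟩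
      by_contra! hi
      exact h4 (hn i hi)
    have hsm : Summable fun p => ∫ θ, β' p θ * haar δ K θ := summable_of_hasFiniteSupport hfin
    have hs := hsm.hasSum
    have h1 := hs.prod_fiberwise (hlevel K)
    have h2 : HasSum (fun i => restrictTo (P (i + 1)) a K - restrictTo (P i) a K)
        (∑ i ∈ Finset.range n, (restrictTo (P (i + 1)) a K - restrictTo (P i) a K)) := by
      apply hasSum_sum_of_ne_finset_zero
      intro i hi
      rw [Finset.mem_range, not_lt] at hi
      rw [restrictTo, restrictTo, if_pos (hn i hi), if_pos (hn (i + 1) (by omega)), sub_self]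
    rw [Finset.sum_range_sub fun i => restrictTo (P i) a K] at h2
    have h3 : restrictTo (P n) a K - restrictTo (P 0) a K = a K := by
      rw [restrictTo, restrictTo, if_pos (hn n le_rfl), if_neg (fun h : P 0 K => h), sub_zero]
    rw [h3] at h2
    rwa [h1.unique h2] at hs
  -- The Orlicz sum, level by level.
  set R := ∫⁻ θ, Psi (ENNReal.ofReal l⁻¹ * sqFun δ a θ) with hR
  have hlinv : ENNReal.ofReal l⁻¹ * ENNReal.ofReal l = 1 := by
    rw [← ENNReal.ofReal_mul (by positivity), inv_mul_cancel₀ hl.ne', ENNReal.ofReal_one]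
  have hpsi6 : ∀ i : ℕ, Psi (ENNReal.ofReal l⁻¹ * ENNReal.ofReal (6 * (l * 2 ^ i))) ≤
      6 * Psi (2 ^ i) := by
    intro i
    have e : ENNReal.ofReal l⁻¹ * ENNReal.ofReal (6 * (l * 2 ^ i)) = ENNReal.ofReal 6 * 2 ^ i := by
      rw [ENNReal.ofReal_mul (by norm_num), ENNReal.ofReal_mul hl.le,
        ENNReal.ofReal_pow zero_le_two, ENNReal.ofReal_ofNat 2]
      calc _ = ENNReal.ofReal 6 * (ENNReal.ofReal l⁻¹ * ENNReal.ofReal l) * 2 ^ i := by ring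
        _ = _ := by rw [hlinv, mul_one]
    rw [e]
    simpa using Psi_mul_le (c := 6) (by norm_num) ((2 : ℝ≥0∞) ^ i)
  set V : ℕ → ℝ≥0∞ := fun i => volume {θ : Torus | ∃ k, ¬ P i (cellOf δ k θ)} with hV
  have hrow : ∀ i, ∑' J, ENNReal.ofReal (arcLength J) *
      Psi (ENNReal.ofReal l⁻¹ * ENNReal.ofReal (b' (i, J))) ≤ 6 * (Psi (2 ^ i) * V i) := by
    intro i
    calc _ ≤ ∑' J, 6 * Psi (2 ^ i) *
          (if IsFirstBad δ (P i) J then ENNReal.ofReal (arcLength J) else 0) := by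
          refine ENNReal.tsum_le_tsum fun J => ?_
          simp only [hb']
          split_ifs
          · rw [mul_comm]
            gcongr
            exact hpsi6 i
          · simp
      _ ≤ 6 * Psi (2 ^ i) * V i := by
          rw [ENNReal.tsum_mul_left]
          gcongr
          exact tsum_arcLength_firstBad_le (P i)
      _ = _ := mul_assoc _ _ _
  have hPsi1 : Psi 1 ≤ 1 := by
    have h1 : Psi 1 = ENNReal.ofReal (Psi0 1) := by
      rw [← Psi_ofReal zero_le_one, ENNReal.ofReal_one]
    rw [h1, ENNReal.ofReal_le_one, Psi0]
    exact div_le_one_of_le₀ (one_le_log_exp_one_add zero_le_one)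
      (zero_le_one.trans (one_le_log_exp_one_add zero_le_one))
  have hV0 : Psi (2 ^ 0) * V 0 ≤ ENNReal.ofReal (2 * Real.pi) := by
    rw [pow_zero, ← volume_univ_torus]
    calc _ ≤ 1 * volume univ := by
          exact mul_le_mul' hPsi1 (measure_mono (subset_univ _))
      _ = _ := one_mul _
  have hVs : ∀ i, Psi (2 ^ (i + 1)) * V (i + 1) ≤
      2 * ∫⁻ θ, Psi (2 ^ (i + 1)) *
        (min ((ENNReal.ofReal l⁻¹ * sqFun δ a θ) ^ 2) (4 ^ (i + 1)) / 4 ^ (i + 1)) := by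
    intro i
    have h1 := volume_bad_le (δ := δ) a (t := (l * 2 ^ (i + 1)) ^ 2) (sq_nonneg _)
    have h2 : ENNReal.ofReal ((l * 2 ^ (i + 1)) ^ 2) = ENNReal.ofReal l ^ 2 * 4 ^ (i + 1) := by
      have : (l * 2 ^ (i + 1)) ^ 2 = l ^ 2 * 4 ^ (i + 1) := by
        rw [mul_pow, ← pow_mul, mul_comm (i + 1) 2, pow_mul]; norm_num
      rw [this, ENNReal.ofReal_mul (sq_nonneg l), ENNReal.ofReal_pow hl.le,
        ENNReal.ofReal_pow (by norm_num), ENNReal.ofReal_ofNat]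
    have h4 : (4 : ℝ≥0∞) ^ (i + 1) ≠ 0 := pow_ne_zero _ (by norm_num)
    have h4' : (4 : ℝ≥0∞) ^ (i + 1) ≠ ⊤ := ENNReal.pow_ne_top ENNReal.ofNat_ne_top
    have hVeq : V (i + 1) = ((4 : ℝ≥0∞) ^ (i + 1))⁻¹ * (ENNReal.ofReal l⁻¹ ^ 2 *
        (ENNReal.ofReal ((l * 2 ^ (i + 1)) ^ 2) * V (i + 1))) := by
      rw [h2]
      calc V (i + 1) = (((4 : ℝ≥0∞) ^ (i + 1))⁻¹ * 4 ^ (i + 1)) *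
            (ENNReal.ofReal l⁻¹ * ENNReal.ofReal l) ^ 2 * V (i + 1) := by
            rw [hlinv, ENNReal.inv_mul_cancel h4 h4', one_pow, one_mul, one_mul]
        _ = _ := by ring
    have hm : Measurable fun θ => min (sqFun δ a θ ^ 2) (ENNReal.ofReal ((l * 2 ^ (i + 1)) ^ 2)) :=
      ((measurable_sqFun a).pow_const 2).min measurable_const
    have hpt : ∀ θ, min ((ENNReal.ofReal l⁻¹ * sqFun δ a θ) ^ 2) (4 ^ (i + 1)) =
        ENNReal.ofReal l⁻¹ ^ 2 * min (sqFun δ a θ ^ 2) (ENNReal.ofReal ((l * 2 ^ (i + 1)) ^ 2)) := by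
      intro θ
      rw [mul_min, h2, ← mul_assoc, ← mul_pow, ← mul_pow, hlinv, one_pow, one_mul]
    calc Psi (2 ^ (i + 1)) * V (i + 1) ≤ Psi (2 ^ (i + 1)) * (((4 : ℝ≥0∞) ^ (i + 1))⁻¹ *
          (ENNReal.ofReal l⁻¹ ^ 2 * (2 * ∫⁻ θ, min (sqFun δ a θ ^ 2)
            (ENNReal.ofReal ((l * 2 ^ (i + 1)) ^ 2))))) := by
          nth_rewrite 1 [hVeq]
          exact mul_le_mul_right (mul_le_mul_right (mul_le_mul_right h1 _) _) _
      _ = _ := by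
          simp_rw [hpt, ENNReal.div_eq_inv_mul]
          rw [lintegral_const_mul _ ((hm.const_mul _).const_mul _),
            lintegral_const_mul _ (hm.const_mul _), lintegral_const_mul _ hm]
          ring
  have hsum : ∑' p : ℕ × ArcIndex, ENNReal.ofReal (arcLength p.2) *
      Psi (ENNReal.ofReal l⁻¹ * ENNReal.ofReal (b' p)) ≤
        6 * (ENNReal.ofReal (2 * Real.pi) + 32 * R) := by
    rw [ENNReal.tsum_prod']
    refine (ENNReal.tsum_le_tsum hrow).trans ?_
    rw [ENNReal.tsum_mul_left, tsum_eq_zero_add' ENNReal.summable]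
    gcongr
    calc ∑' i, Psi (2 ^ (i + 1)) * V (i + 1)
        ≤ ∑' i, 2 * ∫⁻ θ, Psi (2 ^ (i + 1)) *
          (min ((ENNReal.ofReal l⁻¹ * sqFun δ a θ) ^ 2) (4 ^ (i + 1)) / 4 ^ (i + 1)) :=
          ENNReal.tsum_le_tsum hVs
      _ = 2 * ∫⁻ θ, ∑' i, Psi (2 ^ (i + 1)) *
          (min ((ENNReal.ofReal l⁻¹ * sqFun δ a θ) ^ 2) (4 ^ (i + 1)) / 4 ^ (i + 1)) := by
          rw [ENNReal.tsum_mul_left, lintegral_tsum]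
          intro i
          exact (((((measurable_sqFun a).const_mul _).pow_const 2).min
            measurable_const).div_const _ |>.const_mul _).aemeasurable
      _ ≤ 2 * ∫⁻ θ, 16 * Psi (ENNReal.ofReal l⁻¹ * sqFun δ a θ) := by
          gcongr with θ
          refine le_trans ?_ (tsum_Psi_level_le _)
          exact ENNReal.tsum_comp_le_tsum_of_injective (add_left_injective 1)
            (fun i => Psi (2 ^ i) *
              (min ((ENNReal.ofReal l⁻¹ * sqFun δ a θ) ^ 2) (4 ^ i) / 4 ^ i))
      _ = 32 * R := by
          have hm : Measurable fun θ => Psi (ENNReal.ofReal l⁻¹ * sqFun δ a θ) :=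
            measurable_Psi.comp ((measurable_sqFun a).const_mul _)
          rw [lintegral_const_mul _ hm, ← mul_assoc, ← hR]
          norm_num
  obtain ⟨e⟩ : Nonempty (ℕ ≃ ℕ × ArcIndex) := nonempty_equiv_of_countable
  have hsum' : ∑' k, ENNReal.ofReal (arcLength (e k).2) *
      Psi (ENNReal.ofReal l⁻¹ * ENNReal.ofReal (b' (e k))) ≤
        6 * (ENNReal.ofReal (2 * Real.pi) + 32 * R) := by
    rwa [e.tsum_eq fun p : ℕ × ArcIndex => ENNReal.ofReal (arcLength p.2) *
      Psi (ENNReal.ofReal l⁻¹ * ENNReal.ofReal (b' p))]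
  refine ⟨fun k => (e k).2, fun k => β' (e k), fun k => b' (e k), ⟨fun k => hblock (e k), ?_⟩,
    fun K => e.hasSum_iff.2 (htotal K), hsum'⟩
  have hfinite : 6 * (ENNReal.ofReal (2 * Real.pi) + 32 * R) ≠ ⊤ :=
    ENNReal.mul_ne_top ENNReal.ofNat_ne_top (ENNReal.add_ne_top.2
      ⟨ENNReal.ofReal_ne_top, ENNReal.mul_ne_top ENNReal.ofNat_ne_top hS⟩)
  refine ne_top_of_le_ne_top
    (ENNReal.mul_ne_top (ENNReal.ofReal_ne_top (r := max 1 l)) (ne_top_of_le_ne_top hfinite hsum')) ?_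
  rw [← ENNReal.tsum_mul_left]
  refine ENNReal.tsum_le_tsum fun k => ?_
  rw [mul_left_comm]
  gcongr
  refine le_trans (Psi_mono ?_) (Psi_mul_le (le_max_left 1 l) _)
  calc ENNReal.ofReal (b' (e k)) =
        ENNReal.ofReal l * (ENNReal.ofReal l⁻¹ * ENNReal.ofReal (b' (e k))) := by
        rw [← mul_assoc, mul_comm (ENNReal.ofReal l), hlinv, one_mul]
    _ ≤ _ := by
        gcongr
        exact le_max_right 1 l

/-! ### Recovering Haar coefficients from a distribution -/


theorem exists_lipschitz_smoothTransition :
    ∃ K : ℝ, 0 ≤ K ∧ ∀ x y, |Real.smoothTransition x - Real.smoothTransition y| ≤ K * |x - y| := by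
  have hc : ContDiff ℝ 1 Real.smoothTransition := Real.smoothTransition.contDiff (n := 1)
  obtain ⟨K, hK⟩ := (isCompact_Icc (a := (0 : ℝ)) (b := 1)).exists_bound_of_continuousOn
    (hc.continuous_deriv le_rfl).continuousOn
  have hK0 : 0 ≤ K := (norm_nonneg _).trans (hK 0 (by simp))
  refine ⟨K, hK0, fun x y => ?_⟩
  rw [← Real.smoothTransition.projIcc (x := x), ← Real.smoothTransition.projIcc (x := y)]
  refine (Convex.norm_image_sub_le_of_norm_deriv_le (s := Icc (0 : ℝ) 1)
    (fun z _ => (hc.differentiable one_ne_zero) z) hK (convex_Icc 0 1)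
    (projIcc (0 : ℝ) 1 zero_le_one y).2 (projIcc (0 : ℝ) 1 zero_le_one x).2).trans ?_
  gcongr
  exact Set.abs_projIcc_sub_projIcc _

/-- The left endpoint of an arc, as a real number. -/
def arcStart (δ : ℝ) (I : ArcIndex) : ℝ := 2 * Real.pi * (((I.2 : ℕ) : ℝ) / 2 ^ I.1 + δ)

/-- The function `cos (x - c) - cos r`, where `c` is the midpoint of the arc `I` and `2 r` is its
length. It is smooth on the torus, and if `2 r ≤ π` it is positive inside `I`, vanishes to first
order at the endpoints and is negative elsewhere. -/
def hump (δ : ℝ) (I : ArcIndex) : Torus → ℝ :=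
  Function.Periodic.lift (f := fun x : ℝ =>
    Real.cos (x - (arcStart δ I + arcLength I / 2)) - Real.cos (arcLength I / 2)) (by
      intro x
      dsimp only
      rw [add_sub_right_comm, Real.cos_add_two_pi])

theorem hump_coe (I : ArcIndex) (x : ℝ) : hump δ I (x : Torus) =
    Real.cos (x - (arcStart δ I + arcLength I / 2)) - Real.cos (arcLength I / 2) := rfl

theorem continuous_hump (I : ArcIndex) : Continuous (hump δ I) := by
  refine (QuotientAddGroup.isQuotientMap_mk _).continuous_iff.2 ?_
  exact (Real.continuous_cos.comp (continuous_id.sub continuous_const)).sub continuous_const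

theorem abs_hump_sub_le {I J : ArcIndex} {θ θ' : Torus} (h : θ ∈ dyadicArc δ J)
    (h' : θ' ∈ dyadicArc δ J) : |hump δ I θ - hump δ I θ'| ≤ arcLength J := by
  obtain ⟨x, y, rfl, rfl, hxy⟩ := exists_real_of_mem h h'
  rw [hump_coe, hump_coe, sub_sub_sub_cancel_right]
  refine (Real.abs_cos_sub_cos_le _ _).trans ?_
  rwa [sub_sub_sub_cancel_right]

theorem dyadicArc_eq_image (I : ArcIndex) : dyadicArc δ I =
    (fun x : ℝ => (x : Torus)) '' Ico (arcStart δ I) (arcStart δ I + arcLength I) := by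
  have e : arcStart δ I + arcLength I = 2 * Real.pi * (((I.2 : ℕ) + 1 : ℝ) / 2 ^ I.1 + δ) := by
    rw [arcLength, arcStart]; field_simp; ring
  rw [e]
  rfl

theorem arcLength_le_pi {I : ArcIndex} (hI : 1 ≤ I.1) : arcLength I ≤ Real.pi := by
  have hpi := Real.pi_pos
  rw [arcLength, div_le_iff₀ (by positivity)]
  have : (2 : ℝ) ^ 1 ≤ 2 ^ I.1 := pow_le_pow_right₀ one_le_two hI
  nlinarith

theorem hump_nonpos {I : ArcIndex} (hI : 1 ≤ I.1) {θ : Torus} (hθ : θ ∉ dyadicArc δ I) :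
    hump δ I θ ≤ 0 := by
  have hl := arcLength_pos I
  have hlp := arcLength_le_pi hI
  obtain ⟨x, hx1, hx2, rfl⟩ : ∃ x : ℝ, arcStart δ I ≤ x ∧ x < arcStart δ I + 2 * Real.pi ∧
      (x : Torus) = θ :=
    ⟨_, (AddCircle.equivIco (2 * Real.pi) (arcStart δ I) θ).2.1,
      (AddCircle.equivIco (2 * Real.pi) (arcStart δ I) θ).2.2, AddCircle.coe_equivIco⟩
  have hx3 : arcStart δ I + arcLength I ≤ x := by
    by_contra! h
    exact hθ (by rw [dyadicArc_eq_image]; exact ⟨x, ⟨hx1, h⟩, rfl⟩)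
  rw [hump_coe, sub_nonpos]
  rcases le_total (x - (arcStart δ I + arcLength I / 2)) Real.pi with h | h
  · exact Real.cos_le_cos_of_nonneg_of_le_pi (by linarith) h (by linarith)
  · rw [← Real.cos_two_pi_sub]
    exact Real.cos_le_cos_of_nonneg_of_le_pi (by linarith) (by linarith) (by linarith)

theorem one_sub_cos_pos {I : ArcIndex} (hI : 1 ≤ I.1) : 0 < 1 - Real.cos (arcLength I / 2) := by
  have hl := arcLength_pos I
  have hlp := arcLength_le_pi hI
  have := Real.cos_lt_cos_of_nonneg_of_le_pi_div_two le_rfl (y := arcLength I / 2) (by linarith)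
    (by linarith)
  rw [Real.cos_zero] at this
  linarith

/-- By concavity of the cosine the hump lies above a tent. -/
theorem tent_le_cos {r y : ℝ} (hr : 0 < r) (hr' : r ≤ Real.pi / 2) (hy : |y| ≤ r) :
    (1 - |y| / r) * (1 - Real.cos r) ≤ Real.cos y - Real.cos r := by
  rw [← Real.cos_abs y]
  have h1 : |y| / r ≤ 1 := (div_le_one hr).2 hy
  have m0 : (0 : ℝ) ∈ Icc (-(Real.pi / 2)) (Real.pi / 2) := by constructor <;> linarith
  have mr : r ∈ Icc (-(Real.pi / 2)) (Real.pi / 2) := by constructor <;> linarith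
  have c0 : 0 ≤ 1 - |y| / r := by linarith
  have c1 : 0 ≤ |y| / r := by positivity
  have h2 := strictConcaveOn_cos_Icc.concaveOn.2 m0 mr c0 c1 (by ring)
  simp only [smul_eq_mul, mul_zero, zero_add, Real.cos_zero, mul_one] at h2
  rw [div_mul_cancel₀ _ hr.ne'] at h2
  linarith

theorem coe_mem_closedBall {x a ρ : ℝ} (h : |x - a| ≤ ρ) :
    (x : Torus) ∈ Metric.closedBall (a : Torus) ρ := by
  rw [Metric.mem_closedBall, dist_eq_norm, ← AddCircle.coe_sub]
  exact (QuotientAddGroup.norm_mk_le_norm (S := AddSubgroup.zmultiples (2 * Real.pi))).trans h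

/-- The constant in the estimate of the layer where the hump is small. -/
def layerConst (I : ArcIndex) : ℝ := 2 * arcLength I / (1 - Real.cos (arcLength I / 2))

theorem layerConst_nonneg {I : ArcIndex} (hI : 1 ≤ I.1) : 0 ≤ layerConst I :=
  div_nonneg (mul_nonneg zero_le_two (arcLength_pos I).le) (one_sub_cos_pos hI).le

theorem volume_layer_le {I : ArcIndex} (hI : 1 ≤ I.1) {t : ℝ} (ht : 0 ≤ t) :
    volume {θ ∈ dyadicArc δ I | hump δ I θ < t} ≤ ENNReal.ofReal (layerConst I * t) := by
  have hl := arcLength_pos I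
  have hlp := arcLength_le_pi hI
  have hcos := one_sub_cos_pos hI
  set r := arcLength I / 2 with hr
  set ρ := r * t / (1 - Real.cos r) with hρ
  have hρ0 : 0 ≤ ρ := by positivity
  have hsub : {θ ∈ dyadicArc δ I | hump δ I θ < t} ⊆
      Metric.closedBall ((arcStart δ I : ℝ) : Torus) ρ ∪
        Metric.closedBall ((arcStart δ I + arcLength I : ℝ) : Torus) ρ := by
    rintro θ ⟨hθ, hlt⟩
    rw [dyadicArc_eq_image] at hθ
    obtain ⟨x, ⟨hx1, hx2⟩, rfl⟩ := hθ
    have hlt' : hump δ I (x : Torus) < t := hlt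
    rw [hump_coe] at hlt'
    set y := x - (arcStart δ I + r) with hy
    have hyr : |y| ≤ r := by rw [abs_le]; constructor <;> linarith
    have h1 := tent_le_cos (by linarith) (by linarith) hyr
    have h2 : r - |y| ≤ ρ := by
      rw [hρ, le_div_iff₀ hcos]
      have h3 : (1 - |y| / r) * (1 - Real.cos r) ≤ t := h1.trans hlt'.le
      have hr0 : 0 < r := by linarith
      calc (r - |y|) * (1 - Real.cos r) = r * ((1 - |y| / r) * (1 - Real.cos r)) := by
            field_simp
        _ ≤ r * t := by gcongr
    rcases le_total y 0 with h | h
    · left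
      apply coe_mem_closedBall
      rw [abs_of_nonpos h] at h2
      rw [abs_of_nonneg (by linarith)]
      linarith
    · right
      apply coe_mem_closedBall
      rw [abs_of_nonneg h] at h2
      rw [abs_of_nonpos (by linarith)]
      linarith
  have hball : ∀ z : Torus, volume (Metric.closedBall z ρ) ≤ ENNReal.ofReal (2 * ρ) := by
    intro z
    rw [AddCircle.volume_closedBall]
    exact ENNReal.ofReal_le_ofReal (min_le_right _ _)
  calc _ ≤ ENNReal.ofReal (2 * ρ) + ENNReal.ofReal (2 * ρ) :=
        (measure_mono hsub).trans ((measure_union_le _ _).trans (add_le_add (hball _) (hball _)))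
    _ = _ := by
        rw [← ENNReal.ofReal_add (by positivity) (by positivity)]
        congr 1
        rw [layerConst, hρ, hr]
        ring

/-- A smooth function on the torus that vanishes off `I` and equals `1` where the hump exceeds
`2^{-j}`. -/
def cutoff (δ : ℝ) (I : ArcIndex) (j : ℕ) (θ : Torus) : ℝ :=
  Real.smoothTransition (2 ^ j * hump δ I θ)

/-- The difference `χ_I - s_j` of the indicator function of `I` and the `j`-th cutoff. -/
def defect (δ : ℝ) (I : ArcIndex) (j : ℕ) (θ : Torus) : ℂ :=
  (dyadicArc δ I).indicator (fun _ => (1 : ℂ)) θ - (cutoff δ I j θ : ℂ)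

theorem measurable_cutoff (I : ArcIndex) (j : ℕ) : Measurable (cutoff δ I j) :=
  (Real.smoothTransition.continuous.comp
    (continuous_const.mul (continuous_hump I))).measurable

theorem measurable_defect (I : ArcIndex) (j : ℕ) : Measurable (defect δ I j) :=
  (measurable_const.indicator (measurableSet_dyadicArc I)).sub
    (Complex.measurable_ofReal.comp (measurable_cutoff I j))

theorem cutoff_eq_zero {I : ArcIndex} (hI : 1 ≤ I.1) (j : ℕ) {θ : Torus}
    (hθ : θ ∉ dyadicArc δ I) : cutoff δ I j θ = 0 :=
  Real.smoothTransition.zero_of_nonpos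
    (mul_nonpos_of_nonneg_of_nonpos (by positivity) (hump_nonpos hI hθ))

theorem defect_eq_zero {I : ArcIndex} (hI : 1 ≤ I.1) (j : ℕ) {θ : Torus}
    (hθ : θ ∉ dyadicArc δ I) : defect δ I j θ = 0 := by
  rw [defect, indicator_of_notMem hθ, cutoff_eq_zero hI j hθ]
  simp

theorem defect_of_mem {I : ArcIndex} (j : ℕ) {θ : Torus} (hθ : θ ∈ dyadicArc δ I) :
    defect δ I j θ = ((1 - cutoff δ I j θ : ℝ) : ℂ) := by
  rw [defect, indicator_of_mem hθ]
  simp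

theorem norm_defect_le_one {I : ArcIndex} (hI : 1 ≤ I.1) (j : ℕ) (θ : Torus) :
    ‖defect δ I j θ‖ ≤ 1 := by
  by_cases hθ : θ ∈ dyadicArc δ I
  · rw [defect_of_mem j hθ, Complex.norm_real, Real.norm_eq_abs, abs_le]
    have h1 := Real.smoothTransition.le_one (2 ^ j * hump δ I θ)
    have h2 := Real.smoothTransition.nonneg (2 ^ j * hump δ I θ)
    rw [cutoff]
    constructor <;> linarith
  · rw [defect_eq_zero hI j hθ]
    simp

theorem norm_defect_le {I : ArcIndex} (hI : 1 ≤ I.1) (j : ℕ) (θ : Torus) :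
    ‖defect δ I j θ‖ ≤
      {θ ∈ dyadicArc δ I | hump δ I θ < (2 ^ j)⁻¹}.indicator (fun _ => (1 : ℝ)) θ := by
  by_cases h : θ ∈ {θ ∈ dyadicArc δ I | hump δ I θ < (2 ^ j)⁻¹}
  · rw [indicator_of_mem h]
    exact norm_defect_le_one hI j θ
  · rw [indicator_of_notMem h]
    by_cases hθ : θ ∈ dyadicArc δ I
    · have h1 : (2 ^ j)⁻¹ ≤ hump δ I θ := by
        by_contra! h'
        exact h ⟨hθ, h'⟩
      have h2 : cutoff δ I j θ = 1 := by
        apply Real.smoothTransition.one_of_one_le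
        rwa [inv_le_iff_one_le_mul₀' (by positivity)] at h1
      rw [defect_of_mem j hθ, h2]
      simp
    · rw [defect_eq_zero hI j hθ]
      simp

theorem integral_norm_defect_le {I : ArcIndex} (hI : 1 ≤ I.1) (j : ℕ) :
    ∫ θ, ‖defect δ I j θ‖ ≤ layerConst I * (2 ^ j)⁻¹ := by
  have hm : MeasurableSet {θ ∈ dyadicArc δ I | hump δ I θ < (2 ^ j)⁻¹} :=
    (measurableSet_dyadicArc I).inter
      (measurableSet_lt (continuous_hump I).measurable measurable_const)
  have h0 : 0 ≤ layerConst I * (2 ^ j)⁻¹ := mul_nonneg (layerConst_nonneg hI) (by positivity)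
  calc _ ≤ ∫ θ, {θ ∈ dyadicArc δ I | hump δ I θ < (2 ^ j)⁻¹}.indicator (fun _ => (1 : ℝ)) θ :=
        integral_mono (integrable_of_bounded (measurable_defect I j).aestronglyMeasurable
          (norm_defect_le_one hI j)).norm ((integrable_const _).indicator hm)
          (norm_defect_le hI j)
    _ = volume.real {θ ∈ dyadicArc δ I | hump δ I θ < (2 ^ j)⁻¹} := by
        rw [integral_indicator hm, setIntegral_const, smul_eq_mul, mul_one]
    _ ≤ _ := by
        rw [Measure.real]
        exact ENNReal.toReal_le_of_le_ofReal h0 (volume_layer_le hI (by positivity))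

/-- The cutoffs are tested against a block of generation `k`: for `j ≥ k` the layer where the
defect lives is small, for `j < k` the defect is Lipschitz at scale `2^{-j}`. -/
theorem exists_block_defect_bound {I : ArcIndex} (hI : 1 ≤ I.1) :
    ∃ C : ℝ, 0 ≤ C ∧ ∀ (J : ArcIndex) (β : Torus → ℂ) (b : ℝ), IsBlock δ J β b → ∀ j : ℕ,
      ‖∫ θ, β θ * defect δ I j θ‖ ≤
        C * (b * arcLength J) * (1 / 2) ^ ((j - J.1) + (J.1 - j)) := by
  obtain ⟨K, hK0, hK⟩ := exists_lipschitz_smoothTransition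
  have hpi := Real.pi_pos
  have hL := layerConst_nonneg hI
  refine ⟨layerConst I / (2 * Real.pi) + 2 * Real.pi * K + 2 ^ I.1, by positivity, ?_⟩
  intro J β b h j
  have hb := h.nonneg
  have hl := arcLength_pos J
  have hbl : 0 ≤ b * arcLength J := by positivity
  rcases le_or_gt J.1 j with hj | hj
  · obtain ⟨d, rfl⟩ := Nat.exists_eq_add_of_le hj
    have e : J.1 + d - J.1 + (J.1 - (J.1 + d)) = d := by omega
    rw [e]
    have h1 : ‖∫ θ, β θ * defect δ I (J.1 + d) θ‖ ≤ b * (layerConst I * (2 ^ (J.1 + d))⁻¹) := by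
      calc _ ≤ ∫ θ, ‖β θ * defect δ I (J.1 + d) θ‖ := norm_integral_le_integral_norm _
        _ ≤ ∫ θ, b * ‖defect δ I (J.1 + d) θ‖ := by
          apply integral_mono_ae (h.integrable_mul (measurable_defect I _)
            (norm_defect_le_one hI _)).norm
          · exact ((integrable_of_bounded (measurable_defect I _).aestronglyMeasurable
              (norm_defect_le_one hI _)).norm).const_mul _
          · filter_upwards [h.bound] with θ hθ
            rw [norm_mul]
            gcongr
        _ ≤ _ := by
          rw [integral_const_mul]
          gcongr
          exact integral_norm_defect_le hI _
    refine h1.trans ?_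
    have e2 : b * (layerConst I * (2 ^ (J.1 + d))⁻¹) =
        layerConst I / (2 * Real.pi) * (b * arcLength J) * (1 / 2) ^ d := by
      rw [arcLength, pow_add, one_div, inv_pow]
      field_simp
    rw [e2]
    gcongr
    have : 0 ≤ 2 * Real.pi * K + 2 ^ I.1 := by positivity
    linarith
  · obtain ⟨d, hd⟩ := Nat.exists_eq_add_of_lt hj
    have e : j - J.1 + (J.1 - j) = J.1 - j := by omega
    have e' : (1 / 2 : ℝ) ^ (J.1 - j) = 2 ^ j / 2 ^ J.1 := by
      rw [one_div, inv_pow, eq_div_iff (by positivity), inv_mul_eq_iff_eq_mul₀ (by positivity),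
        ← pow_add]
      congr 1
      omega
    rw [e, e']
    rcases lt_or_ge J.1 I.1 with hJI | hJI
    · have h1 := h.norm_integral_mul_le fun θ _ => norm_defect_le_one (δ := δ) hI j θ
      rw [mul_one] at h1
      have h2 : (1 : ℝ) ≤ 2 ^ I.1 * (2 ^ j / 2 ^ J.1) := by
        have : (2 : ℝ) ^ J.1 ≤ 2 ^ I.1 := pow_le_pow_right₀ one_le_two hJI.le
        have h3 : (1 : ℝ) ≤ 2 ^ j := one_le_pow₀ one_le_two
        rw [mul_div_assoc', one_le_div (by positivity)]
        exact this.trans (le_mul_of_one_le_right (by positivity) h3)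
      calc _ ≤ b * arcLength J * 1 := by rwa [mul_one]
        _ ≤ b * arcLength J * (2 ^ I.1 * (2 ^ j / 2 ^ J.1)) := by gcongr
        _ = 2 ^ I.1 * (b * arcLength J) * (2 ^ j / 2 ^ J.1) := by ring
        _ ≤ _ := by
          gcongr
          have : 0 ≤ layerConst I / (2 * Real.pi) + 2 * Real.pi * K := by positivity
          linarith
    · have hosc : ∀ θ ∈ dyadicArc δ J,
          ‖defect δ I j θ - defect δ I j (arcPoint δ J)‖ ≤ K * 2 ^ j * arcLength J := by
        intro θ hθ
        by_cases hm : arcPoint δ J ∈ dyadicArc δ I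
        · have hs := dyadicArc_subset_of_mem hJI hm
          rw [defect_of_mem j hm, defect_of_mem j (hs hθ), ← Complex.ofReal_sub,
            Complex.norm_real, Real.norm_eq_abs, sub_sub_sub_cancel_left, cutoff, cutoff]
          refine (hK _ _).trans ?_
          rw [← mul_sub, abs_mul, abs_of_pos (by positivity : (0 : ℝ) < 2 ^ j), mul_assoc]
          gcongr
          exact abs_hump_sub_le (arcPoint_mem J) hθ
        · rw [defect_eq_zero hI j hm, defect_eq_zero hI j (disjoint_of_notMem hJI hm θ hθ)]
          simp only [sub_self, norm_zero]
          positivity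
      have h1 := h.norm_integral_mul_le hosc
      have h2 : ∫ θ, β θ * (defect δ I j θ - defect δ I j (arcPoint δ J)) =
          ∫ θ, β θ * defect δ I j θ := by
        simp_rw [mul_sub]
        rw [integral_sub (h.integrable_mul (measurable_defect I j) (norm_defect_le_one hI j))
          (h.integrable.mul_const _), integral_mul_const, h.integral, zero_mul, sub_zero]
      rw [h2] at h1
      have e3 : b * (K * 2 ^ j * arcLength J) * arcLength J =
          2 * Real.pi * K * (b * arcLength J) * (2 ^ j / 2 ^ J.1) := by
        rw [arcLength]
        ring
      rw [e3] at h1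
      refine h1.trans ?_
      gcongr
      have : 0 ≤ layerConst I / (2 * Real.pi) + 2 ^ I.1 := by positivity
      linarith

/-- The harmonic number, the total weight of the cutoffs averaged in `logCutoff`. -/
def harmonicWeight (N : ℕ) : ℝ := ∑ i ∈ Finset.range N, 1 / ((i : ℝ) + 1)

/-- A logarithmic average of the cutoffs of the arc `I`, as a test function. It approximates
`χ_I`; the averaging gains a factor `1 / (k + 1)` in the pairing with blocks of generation `k`, which
a single cutoff does not. -/
def logCutoff (δ : ℝ) (I : ArcIndex) (N : ℕ) : testFunctions where
  val := fun θ => (((harmonicWeight N)⁻¹ *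
    ∑ i ∈ Finset.range N, 1 / ((i : ℝ) + 1) * cutoff δ I (i + 1) θ : ℝ) : ℂ)
  property := by
    show ContDiff ℝ ∞ fun x : ℝ => _
    apply Complex.ofRealCLM.contDiff.comp
    refine contDiff_const.mul (ContDiff.sum fun i _ => contDiff_const.mul ?_)
    refine (Real.smoothTransition.contDiff (n := ⊤)).comp (contDiff_const.mul ?_)
    exact (Real.contDiff_cos.comp (contDiff_id.sub contDiff_const)).sub contDiff_const

theorem two_add_mul_pow_le (d : ℕ) : ((2 : ℝ) + d) * (1 / 2) ^ d ≤ 2 * (3 / 4) ^ d := by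
  induction d with
  | zero => simp
  | succ d ih =>
    have h1 : (0 : ℝ) < (1 / 2) ^ d := by positivity
    have h2 : (0 : ℝ) ≤ d * (1 / 2) ^ d := by positivity
    rw [pow_succ, pow_succ]
    push_cast
    nlinarith

/-- The cutoffs that interact with generation `k` are those with index near `k`, of weight about
`1 / (k + 1)`. -/
theorem sum_weight_le (k N : ℕ) :
    ∑ i ∈ Finset.range N, 1 / ((i : ℝ) + 1) * (1 / 2) ^ ((i + 1 - k) + (k - (i + 1))) ≤
      16 / ((k : ℝ) + 1) := by
  have hterm : ∀ i : ℕ, 1 / ((i : ℝ) + 1) * (1 / 2 : ℝ) ^ ((i + 1 - k) + (k - (i + 1))) ≤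
      2 / ((k : ℝ) + 1) * (3 / 4) ^ ((i + 1 - k) + (k - (i + 1))) := by
    intro i
    set d := (i + 1 - k) + (k - (i + 1)) with hd
    have h1 := two_add_mul_pow_le d
    have h2 : (k : ℝ) + 1 ≤ (i + 1) * (2 + d) := by
      have : k + 1 ≤ (i + 1) * (2 + d) := by
        have : k ≤ i + 1 + d := by omega
        nlinarith
      exact_mod_cast this
    have h3 : (0 : ℝ) < (1 / 2) ^ d := by positivity
    rw [one_div_mul_eq_div, div_mul_eq_mul_div, div_le_div_iff₀ (by positivity) (by positivity)]
    calc (1 / 2 : ℝ) ^ d * (k + 1) ≤ (1 / 2) ^ d * ((i + 1) * (2 + d)) := by gcongr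
      _ = (2 + d) * (1 / 2) ^ d * (i + 1) := by ring
      _ ≤ 2 * (3 / 4) ^ d * (i + 1) := by gcongr
  have hsum := sum_three_quarters_pow_dist_le k (N + 1)
  rw [Finset.sum_range_succ'] at hsum
  have h0 : (0 : ℝ) ≤ (3 / 4) ^ (0 - k + (k - 0)) := by positivity
  calc _ ≤ ∑ i ∈ Finset.range N, 2 / ((k : ℝ) + 1) * (3 / 4) ^ ((i + 1 - k) + (k - (i + 1))) :=
        Finset.sum_le_sum fun i _ => hterm i
    _ ≤ 2 / ((k : ℝ) + 1) * 8 := by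
        rw [← Finset.mul_sum]
        gcongr
        linarith
    _ = _ := by ring

theorem harmonicWeight_pos {N : ℕ} (hN : 1 ≤ N) : 0 < harmonicWeight N :=
  Finset.sum_pos (fun _ _ => by positivity) ⟨0, Finset.mem_range.2 hN⟩

theorem indicator_sub_logCutoff {I : ArcIndex} {N : ℕ} (hN : 1 ≤ N) (θ : Torus) :
    (dyadicArc δ I).indicator (fun _ => (1 : ℂ)) θ - (logCutoff δ I N).1 θ =
      ((harmonicWeight N)⁻¹ : ℝ) *
        ∑ i ∈ Finset.range N, ((1 / ((i : ℝ) + 1) : ℝ) : ℂ) * defect δ I (i + 1) θ := by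
  have hW := (harmonicWeight_pos hN).ne'
  have h1 : ((harmonicWeight N)⁻¹ : ℝ) * ∑ i ∈ Finset.range N, ((1 / ((i : ℝ) + 1) : ℝ) : ℂ) =
      (1 : ℂ) := by
    rw [← Complex.ofReal_sum, ← Complex.ofReal_mul]
    have : (harmonicWeight N)⁻¹ * ∑ i ∈ Finset.range N, 1 / ((i : ℝ) + 1) = 1 :=
      inv_mul_cancel₀ hW
    rw [this, Complex.ofReal_one]
  simp only [defect, logCutoff, mul_sub, Finset.sum_sub_distrib, ← Finset.sum_mul]
  rw [← mul_assoc, h1, one_mul]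
  push_cast
  rfl

/-- Pairings of blocks with `χ_I - logCutoff` are small, uniformly over all blocks after division
by the factor that `IsBlockFamily.summable_div` makes summable. -/
theorem exists_block_logCutoff_bound {I : ArcIndex} (hI : 1 ≤ I.1) :
    ∃ C : ℝ, 0 ≤ C ∧ ∀ (J : ArcIndex) (β : Torus → ℂ) (b : ℝ), IsBlock δ J β b → ∀ N : ℕ, 1 ≤ N →
      ‖∫ θ, β θ * ((dyadicArc δ I).indicator (fun _ => (1 : ℂ)) θ - (logCutoff δ I N).1 θ)‖ ≤
        C * (harmonicWeight N)⁻¹ * (b * arcLength J / (J.1 + 1)) := by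
  obtain ⟨C, hC0, hC⟩ := exists_block_defect_bound (δ := δ) hI
  refine ⟨16 * C, by positivity, fun J β b h N hN => ?_⟩
  have hW := harmonicWeight_pos hN
  have hb := h.nonneg
  have hl := arcLength_pos J
  have e : (fun θ => β θ *
      ((dyadicArc δ I).indicator (fun _ => (1 : ℂ)) θ - (logCutoff δ I N).1 θ)) =
      fun θ => ((harmonicWeight N)⁻¹ : ℝ) * ∑ i ∈ Finset.range N,
        ((1 / ((i : ℝ) + 1) : ℝ) : ℂ) * (β θ * defect δ I (i + 1) θ) := by
    ext θ
    rw [indicator_sub_logCutoff hN, mul_left_comm, Finset.mul_sum]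
    congr 1
    exact Finset.sum_congr rfl fun i _ => by ring
  rw [e, integral_const_mul, integral_finsetSum _ fun i _ =>
    (h.integrable_mul (measurable_defect I (i + 1)) (norm_defect_le_one hI _)).const_mul _,
    norm_mul, Complex.norm_real, Real.norm_of_nonneg (by positivity)]
  simp_rw [integral_const_mul]
  have h1 : ‖∑ i ∈ Finset.range N, ((1 / ((i : ℝ) + 1) : ℝ) : ℂ) *
      ∫ θ, β θ * defect δ I (i + 1) θ‖ ≤ C * (b * arcLength J) * (16 / ((J.1 : ℝ) + 1)) := by
    calc _ ≤ ∑ i ∈ Finset.range N, C * (b * arcLength J) *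
          (1 / ((i : ℝ) + 1) * (1 / 2) ^ ((i + 1 - J.1) + (J.1 - (i + 1)))) := by
          refine (norm_sum_le _ _).trans (Finset.sum_le_sum fun i _ => ?_)
          rw [norm_mul, Complex.norm_real, Real.norm_of_nonneg (by positivity)]
          calc _ ≤ 1 / ((i : ℝ) + 1) * _ :=
                mul_le_mul_of_nonneg_left (hC J β b h (i + 1)) (by positivity)
            _ = _ := by ring
      _ ≤ _ := by
          rw [← Finset.mul_sum]
          exact mul_le_mul_of_nonneg_left (sum_weight_le J.1 N) (by positivity)
  calc _ ≤ (harmonicWeight N)⁻¹ * (C * (b * arcLength J) * (16 / ((J.1 : ℝ) + 1))) := by gcongr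
    _ = _ := by ring

theorem norm_integral_indicator_sub_logCutoff_le {I : ArcIndex} (hI : 1 ≤ I.1) {N : ℕ}
    (hN : 1 ≤ N) :
    ‖∫ θ, ((dyadicArc δ I).indicator (fun _ => (1 : ℂ)) θ - (logCutoff δ I N).1 θ)‖ ≤
      16 * layerConst I * (harmonicWeight N)⁻¹ := by
  have hW := harmonicWeight_pos hN
  have hL := layerConst_nonneg hI
  have hi : ∀ j, Integrable (defect δ I j) (volume : Measure Torus) := fun j =>
    integrable_of_bounded (measurable_defect I j).aestronglyMeasurable (norm_defect_le_one hI j)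
  simp_rw [indicator_sub_logCutoff hN]
  rw [integral_const_mul, integral_finsetSum _ fun i _ => (hi (i + 1)).const_mul _,
    norm_mul, Complex.norm_real, Real.norm_of_nonneg (by positivity)]
  simp_rw [integral_const_mul]
  have h1 : ‖∑ i ∈ Finset.range N, ((1 / ((i : ℝ) + 1) : ℝ) : ℂ) *
      ∫ θ, defect δ I (i + 1) θ‖ ≤ layerConst I * (16 / (((0 : ℕ) : ℝ) + 1)) := by
    calc _ ≤ ∑ i ∈ Finset.range N, layerConst I *
          (1 / ((i : ℝ) + 1) * (1 / 2) ^ ((i + 1 - 0) + (0 - (i + 1)))) := by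
          refine (norm_sum_le _ _).trans (Finset.sum_le_sum fun i _ => ?_)
          rw [norm_mul, Complex.norm_real, Real.norm_of_nonneg (by positivity)]
          calc _ ≤ 1 / ((i : ℝ) + 1) * (layerConst I * (2 ^ (i + 1))⁻¹) :=
                mul_le_mul_of_nonneg_left ((norm_integral_le_integral_norm _).trans
                  (integral_norm_defect_le hI (i + 1))) (by positivity)
            _ = _ := by simp only [Nat.sub_zero, Nat.zero_sub, add_zero, one_div, inv_pow]; ring
      _ ≤ _ := by
          rw [← Finset.mul_sum]
          exact mul_le_mul_of_nonneg_left (sum_weight_le 0 N) hL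
  calc _ ≤ (harmonicWeight N)⁻¹ * (layerConst I * (16 / (((0 : ℕ) : ℝ) + 1))) := by gcongr
    _ = _ := by simp; ring

theorem tendsto_harmonicWeight_inv : Tendsto (fun N => (harmonicWeight N)⁻¹) atTop (𝓝 0) :=
  Real.tendsto_sum_range_one_div_nat_succ_atTop.inv_tendsto_atTop

namespace IsBlockFamily

variable {I : ℕ → ArcIndex} {β : ℕ → Torus → ℂ} {b : ℕ → ℝ}

theorem integrable_mul_indicator (h : IsBlockFamily δ I β b) (J : ArcIndex) (k : ℕ) :
    Integrable (fun θ => β k θ * (dyadicArc δ J).indicator (fun _ => (1 : ℂ)) θ) volume :=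
  (h.block k).integrable_mul (measurable_const.indicator (measurableSet_dyadicArc J)) (A := 1)
    fun θ => (norm_indicator_le_norm_self _ _).trans (by simp)

theorem summable_indicator (h : IsBlockFamily δ I β b) {J : ArcIndex} (hJ : 1 ≤ J.1) :
    Summable fun k => ∫ θ, β k θ * (dyadicArc δ J).indicator (fun _ => (1 : ℂ)) θ := by
  obtain ⟨C, -, hC⟩ := exists_block_logCutoff_bound (δ := δ) hJ
  obtain ⟨B, hB⟩ := exists_bound_testFunction (logCutoff δ J 1)
  have hφ := isDyadicLipschitz_testFunction δ _ hB
  have h1 : Summable fun k => ∫ θ, β k θ *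
      ((dyadicArc δ J).indicator (fun _ => (1 : ℂ)) θ - (logCutoff δ J 1).1 θ) :=
    Summable.of_norm_bounded (h.summable_div.mul_left (C * (harmonicWeight 1)⁻¹))
      fun k => hC _ _ _ (h.block k) 1 le_rfl
  refine (h1.add (h.summable_pairing hφ)).congr fun k => ?_
  simp_rw [mul_sub]
  rw [integral_sub (h.integrable_mul_indicator J k)
    ((h.block k).integrable_mul hφ.measurable hφ.bound), sub_add_cancel]

/-- The integral of the formal sum over an arc is determined by the distribution it represents. -/
theorem tendsto_toDistribution_logCutoff (h : IsBlockFamily δ I β b) (c : ℂ) {J : ArcIndex}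
    (hJ : 1 ≤ J.1) :
    Tendsto (fun N => (h.toDistribution c).1 (logCutoff δ J N)) atTop
      (𝓝 (c * arcLength J +
        ∑' k, ∫ θ, β k θ * (dyadicArc δ J).indicator (fun _ => (1 : ℂ)) θ)) := by
  obtain ⟨C, hC0, hC⟩ := exists_block_logCutoff_bound (δ := δ) hJ
  set S := ∑' k, b k * arcLength (I k) / ((I k).1 + 1) with hS
  have hlim : Tendsto (fun N => ‖c‖ * (16 * layerConst J * (harmonicWeight N)⁻¹) +
      C * (harmonicWeight N)⁻¹ * S) atTop (𝓝 0) := by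
    have h1 := tendsto_harmonicWeight_inv
    simpa using ((h1.const_mul (16 * layerConst J)).const_mul ‖c‖).add
      ((h1.const_mul C).mul_const S)
  rw [tendsto_iff_norm_sub_tendsto_zero]
  refine squeeze_zero' (Eventually.of_forall fun _ => norm_nonneg _) ?_ hlim
  filter_upwards [eventually_ge_atTop 1] with N hN
  obtain ⟨B, hB⟩ := exists_bound_testFunction (logCutoff δ J N)
  have hφ := isDyadicLipschitz_testFunction δ _ hB
  have hφi := integrable_of_bounded hφ.measurable.aestronglyMeasurable hφ.bound
  set χ : Torus → ℂ := (dyadicArc δ J).indicator fun _ => (1 : ℂ) with hχ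
  have hχi : Integrable χ (volume : Measure Torus) :=
    (integrable_const (1 : ℂ)).indicator (measurableSet_dyadicArc J)
  have hχ1 : ∫ θ, χ θ = arcLength J := by
    rw [hχ, integral_indicator (measurableSet_dyadicArc J), setIntegral_const,
      volume_real_dyadicArc, Complex.real_smul, mul_one]
  have hterm : ∀ k, ∫ θ, β k θ * (χ θ - (logCutoff δ J N).1 θ) =
      (∫ θ, β k θ * χ θ) - ∫ θ, β k θ * (logCutoff δ J N).1 θ := by
    intro k
    simp_rw [mul_sub]
    exact integral_sub (h.integrable_mul_indicator J k)
      ((h.block k).integrable_mul hφ.measurable hφ.bound)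
  have hdiff : c * (arcLength J : ℂ) + ∑' k, (∫ θ, β k θ * χ θ) -
      (h.toDistribution c).1 (logCutoff δ J N) =
      c * (∫ θ, (χ θ - (logCutoff δ J N).1 θ)) +
        ∑' k, ∫ θ, β k θ * (χ θ - (logCutoff δ J N).1 θ) := by
    simp_rw [hterm]
    rw [(h.summable_indicator hJ).tsum_sub (h.summable_pairing hφ), integral_sub hχi hφi, hχ1,
      toDistribution_apply]
    ring
  rw [norm_sub_rev, hdiff]
  refine (norm_add_le _ _).trans (add_le_add ?_ ?_)
  · rw [norm_mul]
    gcongr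
    exact norm_integral_indicator_sub_logCutoff_le hJ hN
  · rw [hS, ← tsum_mul_left]
    exact tsum_of_norm_bounded (h.summable_div.mul_left _).hasSum
      fun k => hC _ _ _ (h.block k) N hN

theorem zeroCoeff_toDistribution (h : IsBlockFamily δ I β b) (c : ℂ) :
    zeroCoeff (h.toDistribution c) = c := by
  have hpi : ((2 * Real.pi : ℝ) : ℂ) ≠ 0 := by
    exact_mod_cast Real.two_pi_pos.ne'
  have h1 : ∀ k, ∫ θ, β k θ * oneTest.1 θ = 0 := fun k => by
    simp only [oneTest, mul_one]
    exact (h.block k).integral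
  have h2 : ∫ θ : Torus, oneTest.1 θ = ((2 * Real.pi : ℝ) : ℂ) := by
    simp only [oneTest]
    rw [integral_const, Measure.real, volume_univ_torus,
      ENNReal.toReal_ofReal Real.two_pi_pos.le, Complex.real_smul, mul_one]
  rw [zeroCoeff, toDistribution_apply, h2]
  simp_rw [h1]
  rw [tsum_zero, add_zero, mul_comm c, inv_mul_cancel_left₀ hpi]

theorem blockData_coeff_eq (h : IsBlockFamily δ I β b) (c : ℂ) (J : ArcIndex) :
    (blockData δ c β).coeff J = (((Real.sqrt (arcLength J))⁻¹ : ℝ) : ℂ) *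
      ((∑' k, ∫ θ, β k θ * (dyadicArc δ (leftHalf J)).indicator (fun _ => (1 : ℂ)) θ) -
        ∑' k, ∫ θ, β k θ * (dyadicArc δ (rightHalf J)).indicator (fun _ => (1 : ℂ)) θ) := by
  have h1 : ∀ J k, ∫ θ, β k θ * (dyadicArc δ J).indicator (fun _ => (1 : ℂ)) θ =
      ∫ θ in dyadicArc δ J, β k θ := by
    intro J k
    rw [← integral_indicator (measurableSet_dyadicArc J)]
    congr 1; ext θ
    simp [Set.indicator]
  rw [← (h.summable_indicator (Nat.le_add_left 1 J.1)).tsum_sub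
    (h.summable_indicator (Nat.le_add_left 1 J.1)), ← tsum_mul_left]
  simp only [blockData]
  refine tsum_congr fun k => ?_
  rw [integral_mul_haar (h.block k).integrable, h1, h1]

/-- A distribution determines the Haar data of any family of blocks that represents it. -/
theorem blockData_eq_of_toDistribution_eq (h : IsBlockFamily δ I β b) {I' : ℕ → ArcIndex}
    {β' : ℕ → Torus → ℂ} {b' : ℕ → ℝ} (h' : IsBlockFamily δ I' β' b') {c c' : ℂ}
    (he : h.toDistribution c = h'.toDistribution c') :
    blockData δ c β = blockData δ c' β' := by
  have hc : c = c' := by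
    rw [← h.zeroCoeff_toDistribution c, he, h'.zeroCoeff_toDistribution]
  have key : ∀ {J : ArcIndex}, 1 ≤ J.1 →
      ∑' k, ∫ θ, β k θ * (dyadicArc δ J).indicator (fun _ => (1 : ℂ)) θ =
        ∑' k, ∫ θ, β' k θ * (dyadicArc δ J).indicator (fun _ => (1 : ℂ)) θ := by
    intro J hJ
    have h1 := h.tendsto_toDistribution_logCutoff c hJ
    have h2 := h'.tendsto_toDistribution_logCutoff c' hJ
    rw [he, hc] at h1
    exact add_left_cancel (tendsto_nhds_unique h1 h2)
  ext J
  · exact hc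
  · rw [h.blockData_coeff_eq, h'.blockData_coeff_eq, key (Nat.le_add_left 1 J.1),
      key (Nat.le_add_left 1 J.1)]

end IsBlockFamily

/-! ### Blocks and atoms, and the equivalence of the gauges -/


/-- By `Psi_mul_le_sqrt`, scaling by the number `r` found here brings a finite Orlicz sum or integral
below `1`, so that the sets defining the gauges are nonempty. -/
theorem exists_scale {T : ℝ≥0∞} (hT : T ≠ ⊤) :
    ∃ r : ℝ, 0 < r ∧ r ≤ 1 ∧ ENNReal.ofReal (2 * Real.sqrt r) * T ≤ 1 := by
  have h0 : 0 ≤ T.toReal := ENNReal.toReal_nonneg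
  refine ⟨((2 * (T.toReal + 1))⁻¹) ^ 2, by positivity, ?_, ?_⟩
  · exact pow_le_one₀ (by positivity) (inv_le_one_of_one_le₀ (by linarith))
  · rw [Real.sqrt_sq (by positivity), ← ENNReal.ofReal_toReal hT,
      ← ENNReal.ofReal_mul (by positivity), ENNReal.ofReal_le_one,
      ENNReal.toReal_ofReal h0, mul_inv, ← mul_assoc, mul_inv_cancel₀ two_ne_zero, one_mul,
      inv_mul_le_iff₀ (by positivity)]
    linarith

theorem exists_mem_luxemburg {G : Torus → ℝ≥0∞} (hG : ∫⁻ θ, Psi (G θ) ≠ ⊤) :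
    ∃ l : ℝ, 0 < l ∧
      ENNReal.ofReal (2 * Real.pi)⁻¹ * ∫⁻ θ, Psi (ENNReal.ofReal l⁻¹ * G θ) ≤ 1 := by
  obtain ⟨r, h0, h1, h2⟩ := exists_scale (ENNReal.mul_ne_top
    (ENNReal.ofReal_ne_top (r := (2 * Real.pi)⁻¹)) hG)
  refine ⟨r⁻¹, inv_pos.2 h0, le_trans ?_ h2⟩
  rw [inv_inv, mul_left_comm,
    ← lintegral_const_mul' (ENNReal.ofReal (2 * Real.sqrt r)) _ ENNReal.ofReal_ne_top]
  gcongr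
  exact Psi_mul_le_sqrt h0 h1 _

theorem luxemburg_nonneg (G : Torus → ℝ≥0∞) : 0 ≤ luxemburg G :=
  Real.sInf_nonneg fun _ hl => hl.1.le

theorem luxemburg_le {G : Torus → ℝ≥0∞} {l : ℝ} (h0 : 0 < l)
    (h : ENNReal.ofReal (2 * Real.pi)⁻¹ * ∫⁻ θ, Psi (ENNReal.ofReal l⁻¹ * G θ) ≤ 1) :
    luxemburg G ≤ l :=
  csInf_le ⟨0, fun _ hl => hl.1.le⟩ ⟨h0, h⟩

theorem inv_two_pi_mul_le_one_iff {x : ℝ≥0∞} :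
    ENNReal.ofReal (2 * Real.pi)⁻¹ * x ≤ 1 ↔ x ≤ ENNReal.ofReal (2 * Real.pi) := by
  have h : ENNReal.ofReal (2 * Real.pi) ≠ 0 := by
    simpa using Real.pi_pos
  rw [ENNReal.ofReal_inv_of_pos Real.two_pi_pos, mul_comm, ← div_eq_mul_inv,
    ENNReal.div_le_iff h ENNReal.ofReal_ne_top, one_mul]

/-- The bound imposed on atoms is positive, so that every block is a multiple of an atom. -/
theorem luxemburg_indicator_pos (δ : ℝ) (I : ArcIndex) :
    0 < luxemburg ((dyadicArc δ I).indicator fun _ => (1 : ℝ≥0∞)) := by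
  have hl := arcLength_pos I
  have hpi := Real.two_pi_pos
  have hint : ∀ l : ℝ, 0 < l → ∫⁻ θ, Psi (ENNReal.ofReal l⁻¹ *
      (dyadicArc δ I).indicator (fun _ => (1 : ℝ≥0∞)) θ) =
      ENNReal.ofReal (Psi0 l⁻¹ * arcLength I) := by
    intro l h0
    have e : (fun θ => Psi (ENNReal.ofReal l⁻¹ *
        (dyadicArc δ I).indicator (fun _ => (1 : ℝ≥0∞)) θ)) =
        (dyadicArc δ I).indicator fun _ => ENNReal.ofReal (Psi0 l⁻¹) := by
      ext θ
      by_cases h : θ ∈ dyadicArc δ I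
      · simp only [indicator_of_mem h, mul_one, Psi_ofReal (inv_pos.2 h0).le]
      · simp only [indicator_of_notMem h, mul_zero, Psi_zero]
    rw [e, lintegral_indicator_const (measurableSet_dyadicArc I), volume_dyadicArc,
      ENNReal.ofReal_mul (Psi0_nonneg (inv_pos.2 h0).le)]
  have hfin : ∫⁻ θ, Psi ((dyadicArc δ I).indicator (fun _ => (1 : ℝ≥0∞)) θ) ≠ ⊤ := by
    have := hint 1 one_pos
    simp only [inv_one, ENNReal.ofReal_one, one_mul] at this
    rw [this]
    exact ENNReal.ofReal_ne_top
  set E := 2 * Real.pi / arcLength I with hE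
  refine lt_of_lt_of_le (b := (1 + 16 * E ^ 2)⁻¹) (by positivity)
    (le_csInf (exists_mem_luxemburg hfin) fun l hlm => ?_)
  obtain ⟨h0, h1⟩ := hlm
  rw [inv_two_pi_mul_le_one_iff, hint l h0, ENNReal.ofReal_le_ofReal_iff hpi.le,
    ← le_div_iff₀ hl] at h1
  exact inv_le_of_inv_le₀ h0 (le_of_Psi0_le (inv_pos.2 h0).le h1)

theorem IsBlock.eLpNorm_le {I : ArcIndex} {β : Torus → ℂ} {b : ℝ} (h : IsBlock δ I β b) :
    eLpNorm β ⊤ volume ≤ ENNReal.ofReal b := by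
  rw [eLpNorm_exponent_top]
  exact eLpNormEssSup_le_of_ae_bound h.bound

theorem IsBlock.exists_atom {I : ArcIndex} {β : Torus → ℂ} {b : ℝ} (h : IsBlock δ I β b) :
    ∃ (μ : ℂ) (a : Torus → ℂ), IsAtom δ I a ∧ β = fun θ => μ * a θ := by
  set L := luxemburg ((dyadicArc δ I).indicator fun _ => (1 : ℝ≥0∞)) with hL
  have hL0 : 0 < L := luxemburg_indicator_pos δ I
  have hb := h.nonneg
  -- Dividing by `b + 1` rather than by `b` covers the case `b = 0`.
  have hc : ((L / (b + 1) : ℝ) : ℂ) ≠ 0 := by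
    exact_mod_cast (by positivity : (0 : ℝ) < L / (b + 1)).ne'
  refine ⟨((L / (b + 1) : ℝ) : ℂ)⁻¹, fun θ => ((L / (b + 1) : ℝ) : ℂ) * β θ, ⟨?_, ?_, ?_, ?_⟩, ?_⟩
  · exact h.measurable.const_mul _
  · intro θ hθ
    by_contra hn
    exact hθ (by simp only [h.eq_zero θ hn, mul_zero])
  · rw [integral_const_mul, setIntegral_eq_integral_of_forall_compl_eq_zero h.eq_zero, h.integral,
      mul_zero]
  · rw [eLpNorm_exponent_top]
    refine eLpNormEssSup_le_of_ae_bound ?_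
    filter_upwards [h.bound] with θ hθ
    rw [norm_mul, Complex.norm_real, Real.norm_of_nonneg (by positivity), ← hL,
      div_mul_eq_mul_div, div_le_iff₀ (by positivity)]
    have : ‖β θ‖ ≤ b + 1 := by linarith
    gcongr
  · ext θ
    rw [inv_mul_cancel_left₀ hc]

theorem IsAtom.isBlock_mul {I : ArcIndex} {a : Torus → ℂ} (h : IsAtom δ I a) (μ : ℂ) :
    eLpNorm (fun θ => μ * a θ) ⊤ volume ≠ ⊤ ∧
      IsBlock δ I (fun θ => μ * a θ) (eLpNorm (fun θ => μ * a θ) ⊤ volume).toReal := by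
  have hz : ∀ θ ∉ dyadicArc δ I, a θ = 0 := fun θ hθ => by
    by_contra h0
    exact hθ (h.support_subset h0)
  have htop : eLpNorm (fun θ => μ * a θ) ⊤ volume ≠ ⊤ := by
    have : (fun θ => μ * a θ) = μ • a := rfl
    rw [this, eLpNorm_const_smul]
    exact ENNReal.mul_ne_top enorm_ne_top (ne_top_of_le_ne_top ENNReal.ofReal_ne_top h.norm_le)
  refine ⟨htop, h.measurable.const_mul μ, ENNReal.toReal_nonneg, ?_, fun θ hθ => ?_, ?_⟩
  · filter_upwards [ae_le_eLpNormEssSup (f := fun θ => μ * a θ)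
      (μ := (volume : Measure Torus))] with θ hθ
    rw [← eLpNorm_exponent_top] at hθ
    rw [← toReal_enorm]
    exact ENNReal.toReal_mono htop hθ
  · rw [hz θ hθ, mul_zero]
  · rw [integral_const_mul, ← setIntegral_eq_integral_of_forall_compl_eq_zero hz,
      h.integral_eq_zero, mul_zero]

/-- The blocks of a family with sum `f - c` form an atomic decomposition of `f`. -/
theorem IsBlockFamily.isAtomicDecomposition {I : ℕ → ArcIndex} {β : ℕ → Torus → ℂ} {b : ℕ → ℝ}
    (h : IsBlockFamily δ I β b) (c : ℂ) :
    IsAtomicDecomposition δ (h.toDistribution c) I β where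
  multiple k := (h.block k).exists_atom
  summable := by
    refine lt_of_le_of_lt (ENNReal.tsum_le_tsum fun k => ?_) h.sum.lt_top
    gcongr
    exact Psi_mono (h.block k).eLpNorm_le
  converges φ := by
    obtain ⟨B, hB⟩ := exists_bound_testFunction φ
    have hφ := isDyadicLipschitz_testFunction δ φ hB
    have h1 := (h.summable_pairing hφ).hasSum.tendsto_sum_nat
    rw [h.zeroCoeff_toDistribution, h.toDistribution_apply, pairing, integral_const_mul,
      add_sub_cancel_left]
    refine h1.congr fun N => ?_
    simp only [pairing, Finset.sum_mul]
    rw [integral_finsetSum _ fun k _ => (h.block k).integrable_mul hφ.measurable hφ.bound]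

namespace IsAtomicDecomposition

variable {f : distributions} {I : ℕ → ArcIndex} {β : ℕ → Torus → ℂ}

theorem eLpNorm_ne_top (h : IsAtomicDecomposition δ f I β) (k : ℕ) :
    eLpNorm (β k) ⊤ volume ≠ ⊤ := by
  obtain ⟨μ, a, ha, e⟩ := h.multiple k
  rw [e]
  exact (ha.isBlock_mul μ).1

theorem isBlockFamily (h : IsAtomicDecomposition δ f I β) :
    IsBlockFamily δ I β fun k => (eLpNorm (β k) ⊤ volume).toReal where
  block k := by
    obtain ⟨μ, a, ha, e⟩ := h.multiple k
    rw [e]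
    exact (ha.isBlock_mul μ).2
  sum := by
    simp only [ENNReal.ofReal_toReal (h.eLpNorm_ne_top _)]
    exact h.summable.ne

theorem toDistribution_eq (h : IsAtomicDecomposition δ f I β) :
    h.isBlockFamily.toDistribution (zeroCoeff f) = f := by
  refine Subtype.ext (LinearMap.ext fun φ => ?_)
  have h1 := h.isBlockFamily.isAtomicDecomposition (zeroCoeff f) |>.converges φ
  rw [h.isBlockFamily.zeroCoeff_toDistribution] at h1
  exact sub_left_injective (tendsto_nhds_unique h1 (h.converges φ))

theorem isHaarSum (h : IsAtomicDecomposition δ f I β) :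
    IsHaarSum δ (blockData δ (zeroCoeff f) β) f := by
  have := h.isBlockFamily.isHaarSum (zeroCoeff f)
  rwa [h.toDistribution_eq] at this

theorem hlogNorm_le_Lam (h : IsAtomicDecomposition δ f I β) :
    hlogNorm δ (blockData δ (zeroCoeff f) β) ≤ Lam f I β := by
  have hne : Psi ‖zeroCoeff f‖ₑ + ∑' k, ENNReal.ofReal (arcLength (I k)) *
      Psi (eLpNorm (β k) ⊤ volume) ≠ ⊤ :=
    (ENNReal.add_lt_top.2 ⟨Psi_lt_top enorm_ne_top, h.summable⟩).ne
  obtain ⟨r, hr0, hr1, hr⟩ := exists_scale hne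
  refine le_csInf ⟨r⁻¹, inv_pos.2 hr0, le_trans ?_ hr⟩ fun l hl => luxemburg_le hl.1 ?_
  · rw [inv_inv, mul_add, ← ENNReal.tsum_mul_left]
    refine add_le_add (Psi_mul_le_sqrt hr0 hr1 _) (ENNReal.tsum_le_tsum fun k => ?_)
    rw [mul_left_comm]
    gcongr
    exact Psi_mul_le_sqrt hr0 hr1 _
  · refine (h.isBlockFamily.lintegral_Psi_squareFunction_le (zeroCoeff f) (inv_pos.2 hl.1)).trans ?_
    simp only [ENNReal.ofReal_toReal (h.eLpNorm_ne_top _)]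
    exact hl.2

end IsAtomicDecomposition

/-- Atomic decomposition at the scale `l` of the gauge: the Haar data are those of a family of
blocks with a bound on its size at the same scale. -/
theorem exists_blockFamily_of_luxemburg {F : HaarData} {l : ℝ} (hl : 0 < l)
    (h : ENNReal.ofReal (2 * Real.pi)⁻¹ *
      ∫⁻ θ, Psi (ENNReal.ofReal l⁻¹ * squareFunction δ F θ) ≤ 1) :
    ∃ (I : ℕ → ArcIndex) (β : ℕ → Torus → ℂ) (b : ℕ → ℝ), IsBlockFamily δ I β b ∧
      blockData δ F.mean β = F ∧
      Psi (ENNReal.ofReal l⁻¹ * ‖F.mean‖ₑ) + ∑' k, ENNReal.ofReal (arcLength (I k)) *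
        Psi (ENNReal.ofReal l⁻¹ * ENNReal.ofReal (b k)) ≤ 1300 := by
  have hpi := Real.two_pi_pos
  have h1 : ∫⁻ θ, Psi (ENNReal.ofReal l⁻¹ * sqFun δ F.coeff θ) ≤ ENNReal.ofReal (2 * Real.pi) := by
    refine le_trans (lintegral_mono fun θ => Psi_mono ?_) (inv_two_pi_mul_le_one_iff.1 h)
    rw [squareFunction_eq]
    gcongr
    exact le_add_self
  have h2 : Psi (ENNReal.ofReal l⁻¹ * ‖F.mean‖ₑ) ≤ 1 := by
    refine le_trans ?_ h
    have h3 : ∫⁻ _ : Torus, Psi (ENNReal.ofReal l⁻¹ * ‖F.mean‖ₑ) ≤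
        ∫⁻ θ, Psi (ENNReal.ofReal l⁻¹ * squareFunction δ F θ) := by
      refine lintegral_mono fun θ => Psi_mono ?_
      rw [squareFunction_eq]
      gcongr
      exact le_self_add
    rw [lintegral_const, volume_univ_torus] at h3
    calc Psi (ENNReal.ofReal l⁻¹ * ‖F.mean‖ₑ) = ENNReal.ofReal (2 * Real.pi)⁻¹ *
          (Psi (ENNReal.ofReal l⁻¹ * ‖F.mean‖ₑ) * ENNReal.ofReal (2 * Real.pi)) := by
          rw [mul_comm (Psi _), ← mul_assoc, ← ENNReal.ofReal_mul (by positivity),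
            inv_mul_cancel₀ hpi.ne', ENNReal.ofReal_one, one_mul]
      _ ≤ _ := by gcongr
  obtain ⟨I, β, b, hB, hs, hle⟩ := exists_blockFamily F.coeff hl
    (ne_top_of_le_ne_top ENNReal.ofReal_ne_top h1)
  refine ⟨I, β, b, hB, ?_, ?_⟩
  · ext J
    · rfl
    · exact (hs J).tsum_eq
  · calc _ ≤ 1 + 6 * (ENNReal.ofReal (2 * Real.pi) + 32 * ENNReal.ofReal (2 * Real.pi)) := by
          refine add_le_add h2 (hle.trans ?_)
          gcongr
      _ ≤ 1 + 6 * (ENNReal.ofReal 6.4 + 32 * ENNReal.ofReal 6.4) := by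
          have : 2 * Real.pi ≤ 6.4 := by linarith [Real.pi_lt_d2]
          gcongr
      _ ≤ ENNReal.ofReal 1300 := by
          have e1 : (1 : ℝ≥0∞) = ENNReal.ofReal 1 := by simp
          have e6 : (6 : ℝ≥0∞) = ENNReal.ofReal 6 := by simp
          have e32 : (32 : ℝ≥0∞) = ENNReal.ofReal 32 := by simp
          rw [e1, e6, e32, ← ENNReal.ofReal_mul (by norm_num), ← ENNReal.ofReal_add (by norm_num)
            (by norm_num), ← ENNReal.ofReal_mul (by norm_num), ← ENNReal.ofReal_add (by norm_num)
            (by norm_num)]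
          exact ENNReal.ofReal_le_ofReal (by norm_num)
      _ = 1300 := by simp

theorem exists_blockFamily_of_mem_hlog {F : HaarData} (hF : F ∈ hlog δ) :
    ∃ (I : ℕ → ArcIndex) (β : ℕ → Torus → ℂ) (b : ℕ → ℝ), IsBlockFamily δ I β b ∧
      blockData δ F.mean β = F := by
  obtain ⟨l, hl, h⟩ := exists_mem_luxemburg (ne_of_lt hF)
  obtain ⟨I, β, b, hB, e, -⟩ := exists_blockFamily_of_luxemburg hl h
  exact ⟨I, β, b, hB, e⟩

/-- The constant is `(2 · 1300)²`: by `Psi_mul_le_sqrt`, enlarging `l` by this factor divides the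
bound of `exists_blockFamily_of_luxemburg` by `1300`. -/
theorem exists_isAtomicDecomposition {F : HaarData} {f : distributions} (hf : IsHaarSum δ F f)
    {l : ℝ} (hl : 0 < l) (h : ENNReal.ofReal (2 * Real.pi)⁻¹ *
      ∫⁻ θ, Psi (ENNReal.ofReal l⁻¹ * squareFunction δ F θ) ≤ 1) :
    ∃ I β, IsAtomicDecomposition δ f I β ∧ Lam f I β ≤ 2600 ^ 2 * l := by
  obtain ⟨I, β, b, hB, e, hle⟩ := exists_blockFamily_of_luxemburg hl h
  have h1 := hB.isHaarSum F.mean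
  rw [e] at h1
  obtain rfl := isHaarSum_unique hf h1
  refine ⟨I, β, hB.isAtomicDecomposition F.mean,
    csInf_le ⟨0, fun _ hx => hx.1.le⟩ ⟨by positivity, ?_⟩⟩
  have hscale : ∀ x : ℝ≥0∞, Psi (ENNReal.ofReal (2600 ^ 2 * l)⁻¹ * x) ≤
      ENNReal.ofReal (1 / 1300) * Psi (ENNReal.ofReal l⁻¹ * x) := by
    intro x
    rw [mul_inv, ENNReal.ofReal_mul (by positivity), mul_assoc]
    refine (Psi_mul_le_sqrt (by norm_num) (by norm_num) _).trans (le_of_eq ?_)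
    rw [← inv_pow, Real.sqrt_sq (by norm_num)]
    norm_num
  rw [hB.zeroCoeff_toDistribution]
  calc _ ≤ ENNReal.ofReal (1 / 1300) * (Psi (ENNReal.ofReal l⁻¹ * ‖F.mean‖ₑ) +
        ∑' k, ENNReal.ofReal (arcLength (I k)) *
          Psi (ENNReal.ofReal l⁻¹ * ENNReal.ofReal (b k))) := by
        rw [mul_add, ← ENNReal.tsum_mul_left]
        refine add_le_add (hscale _) (ENNReal.tsum_le_tsum fun k => ?_)
        rw [mul_left_comm]
        gcongr
        refine le_trans (Psi_mono ?_) (hscale _)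
        gcongr
        exact (hB.block k).eLpNorm_le
    _ ≤ ENNReal.ofReal (1 / 1300) * ENNReal.ofReal 1300 := by
        gcongr
        simpa using hle
    _ = 1 := by
        rw [← ENNReal.ofReal_mul (by norm_num)]
        norm_num

theorem HlogDyadic_eq_HlogAtomic (δ : ℝ) : HlogDyadic δ = HlogAtomic δ := by
  ext f
  constructor
  · rintro ⟨F, hF, hf⟩
    obtain ⟨l, hl, h⟩ := exists_mem_luxemburg (ne_of_lt hF)
    obtain ⟨I, β, hd, -⟩ := exists_isAtomicDecomposition hf hl h
    exact ⟨I, β, hd⟩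
  · rintro ⟨I, β, h⟩
    exact ⟨_, h.isBlockFamily.blockData_mem_hlog _, h.isHaarSum⟩

theorem Lam_nonneg (f : distributions) (I : ℕ → ArcIndex) (β : ℕ → Torus → ℂ) : 0 ≤ Lam f I β :=
  Real.sInf_nonneg fun _ hl => hl.1.le

theorem HlogAtomicNorm_nonneg (δ : ℝ) (f : distributions) : 0 ≤ HlogAtomicNorm δ f :=
  Real.sInf_nonneg fun _ ⟨I, β, _, e⟩ => e ▸ Lam_nonneg f I β

theorem HlogAtomicNorm_le {f : distributions} (hf : f ∈ HlogDyadic δ) :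
    HlogAtomicNorm δ f ≤ 2600 ^ 2 * HlogDyadicNorm δ f := by
  obtain ⟨F, hF, hFf⟩ := hf
  rw [← div_le_iff₀' (by norm_num)]
  refine le_csInf ⟨_, F, hF, hFf, rfl⟩ ?_
  rintro _ ⟨G, hG, hGf, rfl⟩
  refine le_csInf (exists_mem_luxemburg (ne_of_lt hG)) fun l ⟨hl, h⟩ => ?_
  obtain ⟨I, β, hd, hle⟩ := exists_isAtomicDecomposition hGf hl h
  rw [div_le_iff₀' (by norm_num)]
  refine le_trans (csInf_le ⟨0, ?_⟩ ⟨I, β, hd, rfl⟩) hle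
  rintro _ ⟨I', β', _, rfl⟩
  exact Lam_nonneg _ _ _

theorem HlogDyadicNorm_le {f : distributions} (hf : f ∈ HlogDyadic δ) :
    HlogDyadicNorm δ f ≤ HlogAtomicNorm δ f := by
  rw [HlogDyadic_eq_HlogAtomic] at hf
  obtain ⟨I, β, h⟩ := hf
  refine le_csInf ⟨_, I, β, h, rfl⟩ ?_
  rintro _ ⟨I', β', h', rfl⟩
  refine le_trans (csInf_le ⟨0, ?_⟩
    ⟨_, h'.isBlockFamily.blockData_mem_hlog _, h'.isHaarSum, rfl⟩) h'.hlogNorm_le_Lam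
  rintro _ ⟨G, _, _, rfl⟩
  exact luxemburg_nonneg _

theorem existsUnique_isHaarSum {F : HaarData} (hF : F ∈ hlog δ) : ∃! f, IsHaarSum δ F f := by
  obtain ⟨I, β, b, hB, e⟩ := exists_blockFamily_of_mem_hlog hF
  have h := hB.isHaarSum F.mean
  rw [e] at h
  exact ⟨_, h, fun g hg => isHaarSum_unique hg h⟩

theorem isHaarSum_injective {F G : HaarData} (hF : F ∈ hlog δ) (hG : G ∈ hlog δ)
    {f : distributions} (hFf : IsHaarSum δ F f) (hGf : IsHaarSum δ G f) : F = G := by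
  obtain ⟨I, β, b, hB, e⟩ := exists_blockFamily_of_mem_hlog hF
  obtain ⟨I', β', b', hB', e'⟩ := exists_blockFamily_of_mem_hlog hG
  have h := hB.isHaarSum F.mean
  have h' := hB'.isHaarSum G.mean
  rw [e] at h
  rw [e'] at h'
  rw [← e, ← e']
  exact hB.blockData_eq_of_toDistribution_eq hB'
    ((isHaarSum_unique h hFf).trans (isHaarSum_unique hGf h'))

end

end DyadicHlog

theorem mainTheorem5 :
    ∃ C : ℝ, 0 < C ∧ ∀ δ ∈ Set.Ico (0 : ℝ) 1,
      (∀ F ∈ DyadicHlog.hlog δ, ∃! f, DyadicHlog.IsHaarSum δ F f) ∧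
      (∀ F ∈ DyadicHlog.hlog δ, ∀ G ∈ DyadicHlog.hlog δ, ∀ f,
        DyadicHlog.IsHaarSum δ F f → DyadicHlog.IsHaarSum δ G f → F = G) ∧
      DyadicHlog.HlogDyadic δ = DyadicHlog.HlogAtomic δ ∧
      ∀ f ∈ DyadicHlog.HlogDyadic δ,
        DyadicHlog.HlogAtomicNorm δ f ≤ C * DyadicHlog.HlogDyadicNorm δ f ∧
        DyadicHlog.HlogDyadicNorm δ f ≤ C * DyadicHlog.HlogAtomicNorm δ f := by
  refine ⟨2600 ^ 2, by norm_num, fun δ _ => ⟨fun F hF => DyadicHlog.existsUnique_isHaarSum hF,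
    fun F hF G hG f => DyadicHlog.isHaarSum_injective hF hG, DyadicHlog.HlogDyadic_eq_HlogAtomic δ,
    fun f hf => ⟨DyadicHlog.HlogAtomicNorm_le hf, ?_⟩⟩⟩
  exact (DyadicHlog.HlogDyadicNorm_le hf).trans
    (le_mul_of_one_le_left (DyadicHlog.HlogAtomicNorm_nonneg δ f) (by norm_num))
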